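/- Let $S$ be a scheme, $\iota\colon D\hookrightarrow S$ an effective Cartier divisor (a closed subscheme whose ideal sheaf is locally generated by one nonzerodivisor), $\mathscr E$ a vector bundle on $S$ (a locally free sheaf of finite, not necessarily constant, rank), $\mathscr F$ a vector bundle on $D$, and $\mathscr E|_D\twoheadrightarrow\mathscr F$ a surjection. Put $\mathscr E'=\ker(\mathscr E\to\iota_*\mathscr F)$ and $\mathscr F'=\ker(\mathscr E|_D\to\mathscr F)$. For a sheaf of modules $\mathscr G$ on a scheme $Z$, let $\pi_{\mathscr G}\colon\mathbf P_Z(\mathscr G)\to Z$ be the projective bundle of rank one quotients of $\mathscr G$, with tautological quotient line bundle $\pi_{\mathscr G}^*\mathscr G\twoheadrightarrow\mathscr O_{\mathscr G}(1)$; that is, pulling back the tautological quotient identifies morphisms $T\to\mathbf P_Z(\mathscr G)$ over $q\colon T\to Z$ with line bundle quotients $q^*\mathscr G\twoheadrightarrow\mathscr L$ up to isomorphism under $q^*\mathscr G$. The blowup of a scheme in a closed subscheme $Y$ is the terminal object among the schemes over it in which the inverse image of $Y$ is an effective Cartier divisor. Write $X=\mathbf P_S(\mathscr E)$, $Y=\mathbf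 P_D(\mathscr F)$, $X'=\mathbf P_S(\mathscr E')$, $Y'=\mathbf P_D(\mathscr F')$. Then $\mathscr E|_D\to\mathscr F$ and the induced map $\mathscr E'|_D\to\mathscr F'$ induce closed immersions $Y\hookrightarrow X$ and $Y'\hookrightarrow X'$. Let $f\colon\tilde X\to X$ be the blowup of $X$ in $Y$, let $f'\colon\tilde X'\to X'$ be the blowup of $X'$ in $Y'$, and put $\tilde\pi=\pi_{\mathscr E}\circ f$. Then there is a natural isomorphism of $S$-schemes $\theta\colon\tilde X\xrightarrow{\ \sim\ }\tilde X'$. Precisely, there is exactly one isomorphism $\theta$ of $S$-schemes for which the pullback $\tilde\pi^*\mathscr E'\twoheadrightarrow(f'\theta)^*\mathscr O_{\mathscr E'}(1)$ of the tautological quotient of $X'$ is the image of the composite $\tilde\pi^*\mathscr E'\to\tilde\pi^*\mathscr E\twoheadrightarrow f^*\mathscr O_{\mathscr E}(1)$, i.e. for which there is an injection $j\colon(f'\theta)^*\mathscr O_{\mathscr E'}(1)\hookrightarrow f^*\mathscr O_{\mathscr E}(1)$ such that the former map followed by $j$ equals this composite. -/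

import Mathlib

open CategoryTheory CategoryTheory.Limits AlgebraicGeometry

universe u

noncomputable section

namespace Elementary

/-- A vector bundle on `X`: an `𝒪_X`-module that is locally free of finite rank. The rank may
vary from one connected component to another, and rank `0` is allowed. -/
def IsVectorBundle {X : Scheme.{u}} (E : X.Modules) : Prop :=
  ∀ x : X, ∃ (U : X.Opens) (n : ℕ), x ∈ U ∧
    Nonempty (E.restrict U.ι ≅
      (SheafOfModules.free (ULift.{u} (Fin n)) : SheafOfModules.{u} U.toScheme.ringCatSheaf))

/-- A line bundle on `X`: an `𝒪_X`-module that is locally isomorphic to the structure sheaf. -/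
def IsLineBundle {X : Scheme.{u}} (L : X.Modules) : Prop :=
  ∀ x : X, ∃ U : X.Opens, x ∈ U ∧
    Nonempty (L.restrict U.ι ≅
      (SheafOfModules.unit U.toScheme.ringCatSheaf : SheafOfModules.{u} U.toScheme.ringCatSheaf))

/-- The closed subscheme with ideal sheaf `I` is an (effective) Cartier divisor: `I` is locally
generated by one nonzerodivisor. -/
def IsCartierDivisor {X : Scheme.{u}} (I : X.IdealSheafData) : Prop :=
  ∀ x : X, ∃ U : X.affineOpens, x ∈ U.1 ∧
    ∃ t ∈ nonZeroDivisors Γ(X, U.1), I.ideal U = Ideal.span {t}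

/-- Let `π : X ⟶ S` and `φ : π^*E ⟶ L`. For `g : T ⟶ X` with `g ≫ π = q`, this is the pullback
`q^*E ≅ g^*π^*E ⟶ g^*L` of `φ` along `g`. -/
def pullTaut {S X T : Scheme.{u}} {E : S.Modules} {π : X ⟶ S} {L : X.Modules}
    (φ : (Scheme.Modules.pullback π).obj E ⟶ L) (g : T ⟶ X) {q : T ⟶ S} (h : g ≫ π = q) :
    (Scheme.Modules.pullback q).obj E ⟶ (Scheme.Modules.pullback g).obj L :=
  (Scheme.Modules.pullbackCongr h).inv.app E ≫ (Scheme.Modules.pullbackComp g π).inv.app E ≫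
    (Scheme.Modules.pullback g).map φ

/-- `g : T ⟶ X` is an `S`-morphism along which `φ : π^*E ⟶ L` pulls back to `ψ : q^*E ⟶ M`, up to
an isomorphism `g^*L ≅ M` under `q^*E`. -/
def Classifies {S X T : Scheme.{u}} {E : S.Modules} {π : X ⟶ S} {L : X.Modules}
    (φ : (Scheme.Modules.pullback π).obj E ⟶ L) (q : T ⟶ S) {M : T.Modules}
    (ψ : (Scheme.Modules.pullback q).obj E ⟶ M) (g : T ⟶ X) : Prop :=
  ∃ (h : g ≫ π = q) (e : (Scheme.Modules.pullback g).obj L ≅ M), pullTaut φ g h ≫ e.hom = ψ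

/-- The projective bundle `π : P_S(E) ⟶ S` of one-dimensional quotients of `E`, with its
tautological quotient line bundle `π^*E ↠ 𝒪(1)`. Morphisms `T ⟶ P_S(E)` over `q : T ⟶ S`
correspond, by pulling back the tautological quotient, to quotient line bundles of `q^*E` up to
isomorphism under `q^*E`. -/
structure ProjectiveBundle {S : Scheme.{u}} (E : S.Modules) where
  /-- the scheme `P_S(E)` -/
  space : Scheme.{u}
  /-- the projection `P_S(E) ⟶ S` -/
  π : space ⟶ S
  /-- the line bundle `𝒪(1)` -/
  O1 : space.Modules
  /-- the tautological quotient -/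
  taut : (Scheme.Modules.pullback π).obj E ⟶ O1
  isLineBundle : IsLineBundle O1
  epi_taut : Epi taut
  universal : ∀ {T : Scheme.{u}} (q : T ⟶ S) (M : T.Modules)
    (ψ : (Scheme.Modules.pullback q).obj E ⟶ M), IsLineBundle M → Epi ψ →
      ∃! g : T ⟶ space, Classifies taut q ψ g

/-- The blowup of `X` in the closed subscheme with ideal sheaf `I`: the terminal `X`-scheme in
which the inverse image of this subscheme is a Cartier divisor. -/
structure Blowup {X : Scheme.{u}} (I : X.IdealSheafData) where
  /-- the blown up scheme -/
  space : Scheme.{u}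
  /-- the morphism to `X` -/
  map : space ⟶ X
  isCartierDivisor : IsCartierDivisor (I.comap map)
  universal : ∀ {T : Scheme.{u}} (g : T ⟶ X), IsCartierDivisor (I.comap g) →
    ∃! h : T ⟶ space, h ≫ map = g

section

variable {S D : Scheme.{u}} (ι : D ⟶ S) {E : S.Modules} {F : D.Modules}
  (p : (Scheme.Modules.pullback ι).obj E ⟶ F)

/-- The morphism `E ⟶ ι_*F` of `𝒪_S`-modules given by `p : E|_D ⟶ F`. -/
def toPushforward : E ⟶ (Scheme.Modules.pushforward ι).obj F :=
  (Scheme.Modules.pullbackPushforwardAdjunction ι).homEquiv E F p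

/-- The `𝒪_S`-module `E' = ker(E ⟶ F)`, where `F` is viewed as an `𝒪_S`-module. -/
def kernelOnBase : S.Modules := kernel (toPushforward ι p)

/-- The inclusion `E' ⟶ E`. -/
def kernelOnBaseι : kernelOnBase ι p ⟶ E := kernel.ι (toPushforward ι p)

/-- The `𝒪_D`-module `F' = ker(E|_D ⟶ F)`. -/
def kernelOnDivisor : D.Modules := kernel p

lemma pullback_kernelOnBaseι_comp :
    (Scheme.Modules.pullback ι).map (kernelOnBaseι ι p) ≫ p = 0 := by
  apply ((Scheme.Modules.pullbackPushforwardAdjunction ι).homEquiv _ _).injective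
  rw [Adjunction.homEquiv_naturality_left]
  refine (kernel.condition (toPushforward ι p)).trans ?_
  simp only [Adjunction.homEquiv_unit, Functor.map_zero, comp_zero]
  rfl

/-- The morphism `E'|_D ⟶ F'` induced by `E' ⟶ E`. -/
def kernelRestriction :
    (Scheme.Modules.pullback ι).obj (kernelOnBase ι p) ⟶ kernelOnDivisor ι p :=
  kernel.lift p ((Scheme.Modules.pullback ι).map (kernelOnBaseι ι p))
    (pullback_kernelOnBaseι_comp ι p)

/-- `i : P_D(F) ⟶ P_S(E)` is the morphism induced by `p : E|_D ⟶ F`: it is the `S`-morphism along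
which `𝒪(1)` on `P_S(E)` pulls back to the quotient `E|_{P_D(F)} ⟶ F|_{P_D(F)} ⟶ 𝒪(1)`. -/
def IsInducedBy (X : ProjectiveBundle E) (Y : ProjectiveBundle F) (i : Y.space ⟶ X.space) : Prop :=
  Classifies X.taut (Y.π ≫ ι)
    ((Scheme.Modules.pullbackComp Y.π ι).inv.app E ≫ (Scheme.Modules.pullback Y.π).map p ≫ Y.taut) i

end

end Elementary

end

/-! Near each point of $S$ there are a basis $e_k$ of $\mathscr E$, a set $J$ of indices and a local
equation $t$ of $D$ such that the $e_k$ with $k\in J$ map to a basis of $\mathscr F$ and the others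
map to $0$ (`exists_isChart`). Then $\mathscr E'$ has the basis $e'_k=te_k$ for $k\in J$, $e'_k=e_k$
for $k\notin J$, and $\mathscr F'$ has the basis $e_k|_D$, $k\notin J$. So $(\mathscr E',\mathscr
F')$ looks like $(\mathscr E,\mathscr F)$ with $J$ replaced by its complement.

In homogeneous coordinates $x$ on $X$ and $y$ on $X'$, $Y$ is cut out by $t$ and the $x_k$ with
$k\notin J$, and $Y'$ by $t$ and the $y_k$ with $k\in J$ (`HasCoords.factors_iff`). Let $T$ be an
$S$-scheme on which local equations of $D$ stay regular, and call $T\to X$, $T\to X'$ related if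
their quotients are compatible with $\mathscr E'\to\mathscr E$ (`Rel`). In coordinates this says
$t=ad$, $y_k=dx_k$ on $J$ and $x_k=ay_k$ off $J$ (`Linked`), which is symmetric in the two sides.
The ideals of $Y$ and $Y'$ then become $(a)$ and $(d)$ on $T$ (`Linked.span_eq`), so both are
Cartier. Conversely, if the ideal of $Y$ becomes $(a)$ with $a$ regular, division by $a$ produces
$d$ and a unimodular $y$ (`exists_linked_of_span_eq`), unique up to a unit (`Linked.exists_isUnit`).
Hence morphisms to $X$ making $Y$ Cartier correspond to morphisms to $X'$ making $Y'$ Cartier, and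
the universal properties of the two blowups give $\theta$ (`exists_iso`).

This applies to the blowups because they pull back local equations of $D$ to regular functions:
projective bundles do so (`preservesRegular_π`), and blowing up does not destroy the property
(`Blowup.preservesRegular`).

Bundles and blowups are given only by universal properties, so the argument runs on $T$-points.
Coordinates exist locally, are unique up to a unit, and any unimodular family comes from exactly one
morphism (`existsUnique_hasCoords`). -/

noncomputable section

/-! ### Sections of pulled-back modules -/

namespace Elementary
open Scheme.Modules hiding pullback pullbackComp

/-- The morphism `M ⟶ f_*N` adjoint to `φ : f^*M ⟶ N`, evaluated at a section of `M`. -/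
def adjSection {X Y : Scheme.{u}} {f : X ⟶ Y} {M : Y.Modules} {N : X.Modules}
    (φ : (Scheme.Modules.pullback f).obj M ⟶ N) (U : Y.Opens) (s : Γ(M, U)) : Γ(N, f ⁻¹ᵁ U) :=
  ((pullbackPushforwardAdjunction f).homEquiv M N φ).app U s

/-- The pullback `f^*s` of a section `s` of `M`. -/
def pullSection {X Y : Scheme.{u}} (f : X ⟶ Y) {M : Y.Modules} {U : Y.Opens} (s : Γ(M, U)) :
    Γ((Scheme.Modules.pullback f).obj M, f ⁻¹ᵁ U) :=
  ((pullbackPushforwardAdjunction f).unit.app M).app U s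

section
variable {X Y Z : Scheme.{u}} {f : X ⟶ Y} {M M' : Y.Modules} {N N' : X.Modules}
    (φ : (Scheme.Modules.pullback f).obj M ⟶ N) (U : Y.Opens)

lemma adjSection_eq (s : Γ(M, U)) : adjSection φ U s = φ.app _ (pullSection f s) := by
  simp only [adjSection, pullSection, Adjunction.homEquiv_unit]
  rfl

lemma adjSection_comp (α : N ⟶ N') (s : Γ(M, U)) :
    adjSection (φ ≫ α) U s = α.app _ (adjSection φ U s) := by
  simp only [adjSection_eq]; rfl

lemma pullback_map_pullSection (κ : M' ⟶ M) (s : Γ(M', U)) :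
    ((Scheme.Modules.pullback f).map κ).app _ (pullSection f s) = pullSection f (κ.app U s) := by
  have := (pullbackPushforwardAdjunction f).unit.naturality κ
  exact congr(($this).app U s).symm

lemma adjSection_map_comp (κ : M' ⟶ M) (s : Γ(M', U)) :
    adjSection ((Scheme.Modules.pullback f).map κ ≫ φ) U s = adjSection φ U (κ.app U s) := by
  simp only [adjSection_eq, ← pullback_map_pullSection]; rfl

lemma pullback_hom_ext {φ ψ : (Scheme.Modules.pullback f).obj M ⟶ N}
    (h : ∀ (U : Y.Opens) (s : Γ(M, U)), adjSection φ U s = adjSection ψ U s) : φ = ψ := by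
  apply ((pullbackPushforwardAdjunction f).homEquiv M N).injective
  ext U s
  exact h U s

lemma pullSection_smul (r : Γ(Y, U)) (s : Γ(M, U)) :
    pullSection f (r • s) = f.app U r • pullSection f s :=
  Hom.app_smul ((pullbackPushforwardAdjunction f).unit.app M) r s

lemma pullSection_map {U V : Y.Opens} (i : U ⟶ V) (s : Γ(M, V)) :
    pullSection f (M.presheaf.map i.op s) =
      ((Scheme.Modules.pullback f).obj M).presheaf.map ((TopologicalSpace.Opens.map f.base).map i).op
        (pullSection f s) :=
  congr($((Hom.mapPresheaf ((pullbackPushforwardAdjunction f).unit.app M)).naturality i.op) s)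

/-- The comparison of pullbacks is the mate of the comparison of pushforwards, which is the identity
on sections; comparing the units of the two adjunctions gives the formula. -/
lemma pullbackComp_inv_pullSection (g : Y ⟶ Z) {K : Z.Modules} {W : Z.Opens} (s : Γ(K, W)) :
    ((Scheme.Modules.pullbackComp f g).inv.app K).app _ (pullSection (f ≫ g) s) =
      pullSection f (pullSection g s) := by
  have h := conjugateEquiv_pullbackComp_inv f g
  have h2 := unit_conjugateEquiv ((pullbackPushforwardAdjunction g).comp (pullbackPushforwardAdjunction f))
      (pullbackPushforwardAdjunction (f ≫ g)) (Scheme.Modules.pullbackComp f g).inv K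
  rw [h] at h2
  have := congr(($h2).app W s)
  exact this.symm

end

end Elementary

/-! ### Module morphisms on sections, and frames -/

namespace Elementary
open Scheme.Modules hiding pullback pullbackComp
open Opposite TopologicalSpace

section
variable {X : Scheme.{u}}

/-- A morphism of `𝒪_X`-modules from compatible linear maps on sections. -/
def mkHom {M N : X.Modules} (φ : ∀ U : X.Opens, Γ(M, U) →+ Γ(N, U))
    (hsmul : ∀ (U : X.Opens) (r : Γ(X, U)) (s : Γ(M, U)), φ U (r • s) = r • φ U s)
    (hmap : ∀ (U V : X.Opens) (i : U ⟶ V) (s : Γ(M, V)),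
      φ U (M.presheaf.map i.op s) = N.presheaf.map i.op (φ V s)) : M ⟶ N :=
  SheafOfModules.Hom.mk (PresheafOfModules.homMk (M₁ := M.val) (M₂ := N.val)
    { app := fun U => AddCommGrpCat.ofHom (φ U.unop)
      naturality := fun U V i => by
        ext s
        exact hmap V.unop U.unop i.unop s }
    (fun U r s => hsmul U.unop r s))

@[simp]
lemma mkHom_app {M N : X.Modules} (φ : ∀ U : X.Opens, Γ(M, U) →+ Γ(N, U)) (hsmul) (hmap)
    (U : X.Opens) (s : Γ(M, U)) : (mkHom φ hsmul hmap).app U s = φ U s := rfl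

/-- The structure sheaf as a module over itself. -/
abbrev unitMod (X : Scheme.{u}) : X.Modules := SheafOfModules.unit X.ringCatSheaf

/-- Sections of the structure sheaf, viewed as a module, are functions. -/
def unitSec (U : X.Opens) : Γ(unitMod X, U) ≃ₗ[Γ(X, U)] Γ(X, U) where
  toFun := fun s => s
  invFun := fun s => s
  map_add' _ _ := rfl
  map_smul' _ _ := rfl
  left_inv _ := rfl
  right_inv _ := rfl

lemma unitSec_map {U V : X.Opens} (i : U ⟶ V) (s : Γ(unitMod X, V)) :
    unitSec U ((unitMod X).presheaf.map i.op s) = X.presheaf.map i.op (unitSec V s) := rfl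

lemma unitSec_symm_map {U V : X.Opens} (i : U ⟶ V) (s : Γ(X, V)) :
    (unitMod X).presheaf.map i.op ((unitSec V).symm s) = (unitSec U).symm (X.presheaf.map i.op s) :=
  rfl

lemma hom_app_map {M N : X.Modules} (φ : M ⟶ N) {U V : X.Opens} (i : U ⟶ V) (s : Γ(M, V)) :
    φ.app U (M.presheaf.map i.op s) = N.presheaf.map i.op (φ.app V s) :=
  congr($((Hom.mapPresheaf φ).naturality i.op) s)

lemma unit_hom_app {M : X.Modules} (φ : unitMod X ⟶ M) (U : X.Opens) (s : Γ(unitMod X, U)) :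
    φ.app U s = unitSec U s • φ.app U ((unitSec U).symm 1) := by
  rw [← Hom.app_smul]
  congr 1
  apply (unitSec U).injective
  simp

lemma map_unitSec_one {U V : X.Opens} (i : U ⟶ V) :
    (unitMod X).presheaf.map i.op ((unitSec V).symm 1) = (unitSec U).symm 1 := by
  rw [unitSec_symm_map, map_one]

/-- The open set is a variable equal to `⊤` only propositionally, because it will be a preimage `q
⁻¹ᵁ U`. -/
lemma unit_hom_ext {M : X.Modules} {φ ψ : unitMod X ⟶ M} {W : X.Opens} (hW : W = ⊤)
    (h : φ.app W ((unitSec W).symm 1) = ψ.app W ((unitSec W).symm 1)) : φ = ψ := by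
  ext U s
  rw [unit_hom_app, unit_hom_app ψ, ← map_unitSec_one (homOfLE (hW ▸ le_top : U ≤ W)),
    hom_app_map, hom_app_map, h]

lemma exists_unit_hom {M : X.Modules} {W : X.Opens} (hW : W = ⊤) (m : Γ(M, W)) :
    ∃ φ : unitMod X ⟶ M, ∀ (U : X.Opens) (hU : U ⟶ W) (r : Γ(X, U)),
      φ.app U ((unitSec U).symm r) = r • M.presheaf.map hU.op m := by
  have hle (U : X.Opens) : U ≤ W := hW ▸ le_top
  refine ⟨mkHom (fun U =>
    { toFun := fun s => unitSec U s • M.presheaf.map (homOfLE (hle U)).op m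
      map_zero' := by simp
      map_add' := fun a b => by simp [add_smul] }) ?_ ?_, ?_⟩
  · intro U r s
    simp [mul_smul]
  · intro U V i s
    simp only [AddMonoidHom.coe_mk, ZeroHom.coe_mk, unitSec_map, map_smul]
    rw [← ConcreteCategory.comp_apply, ← Functor.map_comp]
    rfl
  · intro U hU r
    simp
    rfl

end

lemma bijective_map_of_eq {X : Scheme.{u}} (M : X.Modules) {U V : X.Opens} (i : U ⟶ V)
    (h : U = V) : Function.Bijective (M.presheaf.map i.op) := by
  subst h
  rw [show i = 𝟙 _ from Subsingleton.elim _ _, op_id, CategoryTheory.Functor.map_id]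
  exact Function.bijective_id

lemma preimage_inf_eq_of_eq_top {X Y : Scheme.{u}} {f : Y ⟶ X} {U : X.Opens}
    (hU : f ⁻¹ᵁ U = ⊤) (V : X.Opens) : f ⁻¹ᵁ (V ⊓ U) = f ⁻¹ᵁ V := by
  change f ⁻¹ᵁ V ⊓ f ⁻¹ᵁ U = _
  rw [hU, inf_top_eq]

section Frame
variable {X : Scheme.{u}} {I : Type*} [Fintype I]

/-- A family of sections of `M` over `U` is a frame if it is a basis of the sections over each
smaller open. -/
def IsFrame (M : X.Modules) (U : X.Opens) (e : I → Γ(M, U)) : Prop :=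
  ∀ (V : X.Opens) (i : V ⟶ U), Function.Bijective
    (fun c : I → Γ(X, V) => ∑ k, c k • M.presheaf.map i.op (e k))

lemma IsFrame.eq_of_sum_eq {M : X.Modules} {U : X.Opens} {e : I → Γ(M, U)} (he : IsFrame M U e)
    {c d : I → Γ(X, U)} (h : ∑ k, c k • e k = ∑ k, d k • e k) : c = d := by
  refine (he U (𝟙 U)).1 ?_
  simpa using h

/-- A morphism out of `f^*M` is determined by the values of its adjoint on a frame of `M`. -/
lemma IsFrame.pullback_hom_ext {Y : Scheme.{u}} {f : Y ⟶ X} {M : X.Modules} {N : Y.Modules}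
    {U : X.Opens} {e : I → Γ(M, U)} (he : IsFrame M U e) (hU : f ⁻¹ᵁ U = ⊤)
    {φ ψ : (Scheme.Modules.pullback f).obj M ⟶ N}
    (h : ∀ k, adjSection φ U (e k) = adjSection ψ U (e k)) : φ = ψ := by
  apply ((pullbackPushforwardAdjunction f).homEquiv M N).injective
  set φ' := (pullbackPushforwardAdjunction f).homEquiv M N φ with hφ
  set ψ' := (pullbackPushforwardAdjunction f).homEquiv M N ψ with hψ
  have h' : ∀ k, φ'.app U (e k) = ψ'.app U (e k) := h
  ext V s
  -- The frame lives only over `U`, but `V ⊓ U` and `V` have the same preimage, so comparing over `V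
  -- ⊓ U` loses nothing.
  have key : φ'.app (V ⊓ U) (M.presheaf.map (homOfLE inf_le_left).op s) =
      ψ'.app (V ⊓ U) (M.presheaf.map (homOfLE inf_le_left).op s) := by
    obtain ⟨c, hc⟩ := (he (V ⊓ U) (homOfLE inf_le_right)).2 (M.presheaf.map (homOfLE inf_le_left).op s)
    rw [← hc]
    simp only [map_sum, Hom.app_smul, hom_app_map, h']
  rw [hom_app_map, hom_app_map] at key
  exact (bijective_map_of_eq N ((Opens.map f.base).map (homOfLE inf_le_left))
    (preimage_inf_eq_of_eq_top hU V)).1 key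

lemma map_map_apply (M : X.Modules) {U V W : X.Opens} (i : U ⟶ V) (j : V ⟶ W) (k : U ⟶ W)
    (s : Γ(M, W)) :
    M.presheaf.map i.op (M.presheaf.map j.op s) = M.presheaf.map k.op s := by
  rw [← ConcreteCategory.comp_apply, ← Functor.map_comp]
  rfl

lemma IsFrame.restrict {M : X.Modules} {U V : X.Opens} {e : I → Γ(M, U)} (he : IsFrame M U e)
    (i : V ⟶ U) : IsFrame M V (fun k => M.presheaf.map i.op (e k)) := by
  intro W j
  simp only [map_map_apply M j i (j ≫ i)]
  exact he W (j ≫ i)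

/-- The coordinates of a section with respect to a frame. -/
def IsFrame.repr {M : X.Modules} {U : X.Opens} {e : I → Γ(M, U)} (he : IsFrame M U e)
    (s : Γ(M, U)) : I → Γ(X, U) :=
  Classical.choose ((he U (𝟙 U)).2 s)

lemma IsFrame.sum_repr {M : X.Modules} {U : X.Opens} {e : I → Γ(M, U)} (he : IsFrame M U e)
    (s : Γ(M, U)) : ∑ k, he.repr s k • e k = s := by
  have := Classical.choose_spec ((he U (𝟙 U)).2 s)
  simp only [op_id, CategoryTheory.Functor.map_id] at this
  exact this

lemma IsFrame.repr_unique {M : X.Modules} {U : X.Opens} {e : I → Γ(M, U)} (he : IsFrame M U e)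
    {s : Γ(M, U)} {c : I → Γ(X, U)} (h : ∑ k, c k • e k = s) : he.repr s = c :=
  he.eq_of_sum_eq ((he.sum_repr s).trans h.symm)

lemma IsFrame.repr_add {M : X.Modules} {U : X.Opens} {e : I → Γ(M, U)} (he : IsFrame M U e)
    (s s' : Γ(M, U)) : he.repr (s + s') = he.repr s + he.repr s' :=
  he.repr_unique (by simp [add_smul, Finset.sum_add_distrib, he.sum_repr])

lemma IsFrame.repr_smul {M : X.Modules} {U : X.Opens} {e : I → Γ(M, U)} (he : IsFrame M U e)
    (r : Γ(X, U)) (s : Γ(M, U)) : he.repr (r • s) = r • he.repr s :=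
  he.repr_unique (by simp [mul_smul, ← Finset.smul_sum, he.sum_repr])

lemma IsFrame.repr_map {M : X.Modules} {U V : X.Opens} {e : I → Γ(M, U)} (he : IsFrame M U e)
    (i : V ⟶ U) (s : Γ(M, U)) (k : I) :
    (he.restrict i).repr (M.presheaf.map i.op s) k = X.presheaf.map i.op (he.repr s k) := by
  refine congr_fun ((he.restrict i).repr_unique
    (c := fun k => X.presheaf.map i.op (he.repr s k)) ?_) k
  simp_rw [← map_smul, ← map_sum, he.sum_repr]

lemma IsFrame.repr_map_map {M : X.Modules} {U V W : X.Opens} {e : I → Γ(M, U)} (he : IsFrame M U e)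
    (i : V ⟶ U) (j : W ⟶ V) (l : W ⟶ U) (s : Γ(M, V)) (k : I) :
    (he.restrict l).repr (M.presheaf.map j.op s) k =
      X.presheaf.map j.op ((he.restrict i).repr s k) := by
  refine congr_fun ((he.restrict l).repr_unique
    (c := fun k => X.presheaf.map j.op ((he.restrict i).repr s k)) ?_) k
  simp_rw [← map_map_apply M j i l, ← map_smul, ← map_sum, IsFrame.sum_repr]

lemma IsFrame.repr_self [DecidableEq I] {M : X.Modules} {U : X.Opens} {e : I → Γ(M, U)}
    (he : IsFrame M U e) (k : I) : he.repr (e k) = Pi.single k 1 :=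
  he.repr_unique (by simp [Pi.single_apply])

/-- There is a morphism out of `f^*M` whose adjoint takes given values on a frame of `M`. -/
lemma IsFrame.exists_pullback_hom {Y : Scheme.{u}} {f : Y ⟶ X} {M : X.Modules} {N : Y.Modules}
    {U : X.Opens} {e : I → Γ(M, U)} (he : IsFrame M U e) (hU : f ⁻¹ᵁ U = ⊤)
    (n : I → Γ(N, f ⁻¹ᵁ U)) :
    ∃ φ : (Scheme.Modules.pullback f).obj M ⟶ N, ∀ k, adjSection φ U (e k) = n k := by
  classical
  -- `a V s k` is the `k`-th coordinate of `s` restricted to `V ⊓ U`, pulled back and carried along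
  -- the equality of the preimages of `V` and `V ⊓ U`.
  let ρ (V : X.Opens) : f ⁻¹ᵁ V ⟶ f ⁻¹ᵁ (V ⊓ U) := homOfLE (preimage_inf_eq_of_eq_top hU V).ge
  let τ (V : X.Opens) : f ⁻¹ᵁ V ⟶ f ⁻¹ᵁ U := homOfLE (by rw [hU]; exact le_top)
  let a (V : X.Opens) (s : Γ(M, V)) (k : I) : Γ(Y, f ⁻¹ᵁ V) :=
    Y.presheaf.map (ρ V).op (f.app (V ⊓ U) ((he.restrict (homOfLE inf_le_right)).repr
      (M.presheaf.map (homOfLE inf_le_left).op s) k))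
  have a_add (V) (s s' : Γ(M, V)) (k) : a V (s + s') k = a V s k + a V s' k := by
    simp [a, IsFrame.repr_add]
  have a_smul (V) (r : Γ(X, V)) (s : Γ(M, V)) (k) : a V (r • s) k = f.app V r * a V s k := by
    simp only [a, map_smul, IsFrame.repr_smul, Pi.smul_apply, smul_eq_mul, map_mul]
    congr 1
    rw [← ConcreteCategory.comp_apply (X.presheaf.map _), Scheme.Hom.naturality,
      ← ConcreteCategory.comp_apply, Category.assoc, ← Functor.map_comp]
    rw [show ((Opens.map f.base).map (homOfLE (inf_le_left : V ⊓ U ≤ V)).op.unop).op ≫ (ρ V).op = 𝟙 _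
      from Subsingleton.elim _ _]
    simp
  have a_map (V W) (i : V ⟶ W) (s : Γ(M, W)) (k) : a V (M.presheaf.map i.op s) k =
      Y.presheaf.map ((Opens.map f.base).map i).op (a W s k) := by
    have hi : V ⊓ U ≤ W ⊓ U := inf_le_inf_right _ i.le
    simp only [a]
    rw [map_map_apply M _ _ (homOfLE hi ≫ homOfLE inf_le_left),
      ← map_map_apply M (homOfLE hi) (homOfLE inf_le_left),
      he.repr_map_map (homOfLE inf_le_right) (homOfLE hi) (homOfLE inf_le_right)]
    rw [← ConcreteCategory.comp_apply (X.presheaf.map _), Scheme.Hom.naturality]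
    simp only [← ConcreteCategory.comp_apply, Category.assoc, ← Functor.map_comp, ← op_comp]
    rfl
  let b (V : X.Opens) (s : Γ(M, V)) : Γ(N, f ⁻¹ᵁ V) := ∑ k, a V s k • N.presheaf.map (τ V).op (n k)
  have b_add (V) (s s' : Γ(M, V)) : b V (s + s') = b V s + b V s' := by
    simp only [b, a_add, add_smul, Finset.sum_add_distrib]
  have b_smul (V) (r : Γ(X, V)) (s : Γ(M, V)) : b V (r • s) = f.app V r • b V s := by
    simp only [b, a_smul, mul_smul, ← Finset.smul_sum]
  have b_map (V W) (i : V ⟶ W) (s : Γ(M, W)) : b V (M.presheaf.map i.op s) =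
      N.presheaf.map ((Opens.map f.base).map i).op (b W s) := by
    simp only [b, a_map, map_sum, Scheme.Modules.map_smul]
    refine Finset.sum_congr rfl fun k _ => ?_
    rw [map_map_apply]
  let ψ : M ⟶ (Scheme.Modules.pushforward f).obj N := mkHom
    (fun V => AddMonoidHom.mk' (M := Γ(M, V)) (G := Γ((Scheme.Modules.pushforward f).obj N, V)) (b V) (b_add V)) b_smul b_map
  refine ⟨((pullbackPushforwardAdjunction f).homEquiv M N).symm ψ, fun k => ?_⟩
  simp only [adjSection, Equiv.apply_symm_apply]
  have ha (j : I) : a U (e k) j = (Pi.single k 1 : I → _) j := by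
    simp only [a]
    have := he.repr_map (homOfLE (inf_le_right : U ⊓ U ≤ U)) (e k) j
    rw [show (homOfLE (inf_le_left : U ⊓ U ≤ U)) = homOfLE inf_le_right from rfl, this,
      he.repr_self]
    simp only [Pi.single_apply]
    split_ifs <;> simp
  refine (mkHom_app _ _ _ _ _).trans ?_
  change b U (e k) = n k
  simp only [b, ha, Pi.single_apply, ite_smul, one_smul, zero_smul,
    Finset.sum_ite_eq', Finset.mem_univ, if_true]
  rw [show τ U = 𝟙 _ from Subsingleton.elim _ _]
  simp

end Frame
end Elementary

/-! ### Pullback of the structure sheaf, of quotients and of frames -/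

namespace Elementary
open Scheme.Modules hiding pullback pullbackComp
open Opposite TopologicalSpace

section PullUnit
variable {X Y Z : Scheme.{u}}

lemma isFrame_one (X : Scheme.{u}) (U : X.Opens) :
    IsFrame (unitMod X) U (fun _ : Unit => (unitSec U).symm 1) := by
  intro V i
  simp only [map_unitSec_one, Finset.univ_unique, PUnit.default_eq_unit, Finset.sum_singleton]
  constructor
  · intro c d h
    ext ⟨⟩
    simpa using congr(unitSec V $h)
  · intro s
    refine ⟨fun _ => unitSec V s, ?_⟩
    apply (unitSec V).injective
    simp

/-- The canonical isomorphism `f^*𝒪_Y ≅ 𝒪_X`, on sections. -/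
lemma exists_pullback_unit_iso (f : X ⟶ Y) :
    ∃ ν : (Scheme.Modules.pullback f).obj (unitMod Y) ≅ unitMod X,
      ∀ (U : Y.Opens) (r : Γ(unitMod Y, U)),
        ν.hom.app _ (pullSection f r) = (unitSec _).symm (f.app U (unitSec U r)) := by
  obtain ⟨φ, hφ⟩ := (isFrame_one Y ⊤).exists_pullback_hom (f := f) (N := unitMod X) rfl
    (fun _ => (unitSec _).symm 1)
  obtain ⟨ψ, hψ⟩ := exists_unit_hom (M := (Scheme.Modules.pullback f).obj (unitMod Y))
    (W := f ⁻¹ᵁ ⊤) rfl (pullSection f ((unitSec ⊤).symm 1))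
  have hφ' := hφ ()
  rw [adjSection_eq] at hφ'
  have hψ' := hψ _ (𝟙 _) 1
  simp only [op_id, CategoryTheory.Functor.map_id, one_smul] at hψ'
  refine ⟨⟨φ, ψ, ?_, ?_⟩, ?_⟩
  · refine (isFrame_one Y ⊤).pullback_hom_ext rfl fun _ => ?_
    rw [adjSection_comp, hφ (), hψ']
    rfl
  · refine unit_hom_ext (W := f ⁻¹ᵁ ⊤) rfl ?_
    rw [Hom.comp_app, ConcreteCategory.comp_apply, hψ']
    exact hφ'
  · intro U r
    have : r = (unitSec U r) • (unitMod Y).presheaf.map (homOfLE le_top).op ((unitSec ⊤).symm 1) := by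
      apply (unitSec U).injective
      rw [map_unitSec_one]
      simp
    conv_lhs => rw [this]
    rw [pullSection_smul, pullSection_map, Hom.app_smul, hom_app_map]
    erw [hφ']
    rw [map_unitSec_one]
    apply (unitSec _).injective
    simp

end PullUnit

section PullTaut
variable {S X T T' : Scheme.{u}} {E : S.Modules} {π : X ⟶ S} {L : X.Modules}

/-- Pulled-back quotients are compared through their values on sections. The `eqToHom` is there
because `g ⁻¹ᵁ π ⁻¹ᵁ U` and `q ⁻¹ᵁ U` are identified only through `h`. -/
lemma adjSection_pullTaut (φ : (Scheme.Modules.pullback π).obj E ⟶ L) (g : T ⟶ X) {q : T ⟶ S}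
    (h : g ≫ π = q) (U : S.Opens) (s : Γ(E, U)) :
    adjSection (pullTaut φ g h) U s =
      ((Scheme.Modules.pullback g).obj L).presheaf.map (eqToHom (by rw [← h]; rfl)).op
        (pullSection g (adjSection φ U s)) := by
  subst h
  have h1 : pullTaut φ g rfl = (Scheme.Modules.pullbackComp g π).inv.app E ≫
    (Scheme.Modules.pullback g).map φ := by
    simp only [pullTaut]
    exact Category.id_comp _
  rw [h1, adjSection_eq, Hom.comp_app, ConcreteCategory.comp_apply]
  refine (congrArg _ (pullbackComp_inv_pullSection π s)).trans ?_
  refine (pullback_map_pullSection (f := g) (π ⁻¹ᵁ U) φ (pullSection π s)).trans ?_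
  rw [← adjSection_eq]
  exact congr($(((Scheme.Modules.pullback g).obj L).presheaf.map_id _) _).symm

lemma pullTaut_comp (φ : (Scheme.Modules.pullback π).obj E ⟶ L) (g : T ⟶ X) {q : T ⟶ S}
    (h : g ≫ π = q) (c : T' ⟶ T) {q' : T' ⟶ S} (hq : c ≫ q = q') (h' : (c ≫ g) ≫ π = q') :
    pullTaut φ (c ≫ g) h' ≫ (Scheme.Modules.pullbackComp c g).inv.app L =
      pullTaut (pullTaut φ g h) c hq := by
  subst h
  subst hq
  refine pullback_hom_ext fun U s => ?_
  rw [adjSection_comp, adjSection_pullTaut, adjSection_pullTaut, adjSection_pullTaut, hom_app_map]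
  refine (congrArg _ (pullbackComp_inv_pullSection g _)).trans ?_
  refine congrArg _ (congrArg (pullSection c) ?_)
  exact congr($(((Scheme.Modules.pullback g).obj L).presheaf.map_id _) _).symm

lemma pullTaut_comp_map {L' : X.Modules} (φ : (Scheme.Modules.pullback π).obj E ⟶ L) (α : L ⟶ L')
    (g : T ⟶ X) {q : T ⟶ S} (h : g ≫ π = q) :
    pullTaut φ g h ≫ (Scheme.Modules.pullback g).map α = pullTaut (φ ≫ α) g h := by
  simp [pullTaut]

lemma map_comp_pullTaut {E' : S.Modules} (κ : E' ⟶ E) (φ : (Scheme.Modules.pullback π).obj E ⟶ L)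
    (g : T ⟶ X) {q : T ⟶ S} (h : g ≫ π = q) :
    (Scheme.Modules.pullback q).map κ ≫ pullTaut φ g h =
      pullTaut ((Scheme.Modules.pullback π).map κ ≫ φ) g h := by
  simp [pullTaut]

end PullTaut
section FrameConstructions
variable {X Y : Scheme.{u}} {I : Type*} [Fintype I]

lemma hom_sum_app {J : Type*} (s : Finset J) {M N : X.Modules} (φ : J → (M ⟶ N)) (U : X.Opens)
    (m : Γ(M, U)) : (∑ j ∈ s, φ j).app U m = ∑ j ∈ s, (φ j).app U m := by
  classical
  induction s using Finset.induction_on with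
  | empty => simp
  | insert a s ha ih =>
    rw [Finset.sum_insert ha, Finset.sum_insert ha, Hom.add_app, ← ih]
    rfl

/-- A family of global sections with a dual family of linear forms is a frame. -/
lemma isFrame_of_dual [DecidableEq I] {M : X.Modules} {W : X.Opens} (e : I → Γ(M, W))
    (δ : I → (M ⟶ unitMod X)) (ε : I → (unitMod X ⟶ M))
    (hδ : ∀ j k, (δ k).app W (e j) = (unitSec W).symm (if j = k then 1 else 0))
    (hε : ∀ k, (ε k).app W ((unitSec W).symm 1) = e k)
    (h : ∑ k, δ k ≫ ε k = 𝟙 M) : IsFrame M W e := by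
  intro V i
  constructor
  · intro c d hcd
    ext k
    have := congr(unitSec V ((δ k).app V $hcd))
    simpa [map_sum, hom_app_map, hδ, unitSec_map, apply_ite] using this
  · intro s
    refine ⟨fun k => unitSec V ((δ k).app V s), ?_⟩
    have := congr(($h).app V s)
    rw [hom_sum_app] at this
    refine Eq.trans (Finset.sum_congr rfl fun k _ => ?_) this
    simp only [Hom.comp_app, ConcreteCategory.comp_apply]
    rw [unit_hom_app (ε k), ← hε, ← hom_app_map, map_unitSec_one]

/-- The free module enters as a coproduct: its universal property yields the coordinate forms `δ`,
dual to the inclusions `ε`. -/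
lemma isFrame_free (X : Scheme.{u}) (J : Type u) [Fintype J] :
    ∃ e : J → Γ((SheafOfModules.free J : X.Modules), ⊤), IsFrame _ ⊤ e := by
  classical
  let M : X.Modules := SheafOfModules.free J
  let ε (k : J) : unitMod X ⟶ M := SheafOfModules.ιFree k
  let δ (k : J) : M ⟶ unitMod X := Cofan.IsColimit.desc (SheafOfModules.isColimitFreeCofan J)
    (fun j => if j = k then 𝟙 (unitMod X) else 0)
  have hεδ (j k) : ε j ≫ δ k = if j = k then 𝟙 (unitMod X) else 0 :=
    Cofan.IsColimit.fac (SheafOfModules.isColimitFreeCofan J) _ j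
  refine ⟨fun k => (ε k).app ⊤ ((unitSec ⊤).symm 1), isFrame_of_dual _ δ ε ?_ (fun _ => rfl) ?_⟩
  · intro j k
    have := congr(($(hεδ j k)).app ⊤ ((unitSec ⊤).symm 1))
    refine this.trans ?_
    split_ifs <;> simp
  · have key (j : J) : ε j ≫ (∑ k, δ k ≫ ε k) = ε j ≫ 𝟙 M := by
      rw [Preadditive.comp_sum]
      simp [← Category.assoc, hεδ, ite_comp]
    exact Cofan.IsColimit.hom_ext (SheafOfModules.isColimitFreeCofan J) _ _ key

lemma IsFrame.of_iso {M N : X.Modules} (α : M ≅ N) {U : X.Opens} {e : I → Γ(M, U)}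
    (he : IsFrame M U e) : IsFrame N U (fun k => α.hom.app U (e k)) := by
  intro V i
  have h : Function.Bijective (α.hom.app V) :=
    (ConcreteCategory.isIso_iff_bijective _).1 inferInstance
  convert! h.comp (he V i) using 1
  ext c
  simp [map_sum, hom_app_map]

lemma restrict_smul {M : X.Modules} {U : X.Opens} {V : U.toScheme.Opens} (r : Γ(U.toScheme, V))
    (x : Γ(M.restrict U.ι, V)) :
    r • x = (show Γ(M.restrict U.ι, V) from
      ((show Γ(X, U.ι ''ᵁ V) from r) • (show Γ(M, U.ι ''ᵁ V) from x))) := by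
  have := congr($(smul_restrictAppIso_hom U.ι M V r) x)
  rw [Scheme.Opens.ι_appIso] at this
  exact this

/-- The opens of the scheme `U` are the opens of `X` inside `U`, with the same sections and scalars,
so the two frame conditions coincide. -/
lemma IsFrame.of_restrict {M : X.Modules} {U : X.Opens} {W : U.toScheme.Opens} (hW : W = ⊤)
    {e : I → Γ(M.restrict U.ι, W)} (he : IsFrame (M.restrict U.ι) W e) {e' : I → Γ(M, U)}
    (h : ∀ k, e k = M.presheaf.map (homOfLE (U.ι_image_le W)).op (e' k)) :
    IsFrame M U e' := by
  intro V i
  obtain ⟨V', rfl⟩ : ∃ V' : U.toScheme.Opens, U.ι ''ᵁ V' = V :=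
    ⟨U.ι ⁻¹ᵁ V, by
    rw [Scheme.Hom.image_preimage_eq_opensRange_inf, U.opensRange_ι, inf_eq_right.2 i.le]⟩
  have hV' : V' ≤ W := hW ▸ le_top
  have := he V' (homOfLE hV')
  have h1 (k : I) : (M.restrict U.ι).presheaf.map (homOfLE hV').op (e k) =
      M.presheaf.map i.op (e' k) := by
    rw [h]
    exact map_map_apply M (U.ι.opensFunctor.map (homOfLE hV')) _ _ _
  have h2 (c : I → Γ(X, U.ι ''ᵁ V')) :
      (∑ k, (show Γ(U.toScheme, V') from c k) •
        (M.restrict U.ι).presheaf.map (homOfLE hV').op (e k) : Γ(M.restrict U.ι, V')) =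
      (show Γ(M, U.ι ''ᵁ V') from ∑ k, c k • M.presheaf.map i.op (e' k)) := by
    refine Finset.sum_congr rfl fun k _ => ?_
    rw [h1]
    exact restrict_smul _ _
  exact (congrArg Function.Bijective (funext h2)).mp this

lemma exists_frame {E : X.Modules} (hE : IsVectorBundle E) (x : X) :
    ∃ (U : X.Opens) (n : ℕ) (e : ULift.{u} (Fin n) → Γ(E, U)), x ∈ U ∧ IsFrame E U e := by
  obtain ⟨U, n, hx, ⟨α⟩⟩ := hE x
  obtain ⟨e, he⟩ := isFrame_free U.toScheme (ULift.{u} (Fin n))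
  have he' := he.of_iso α.symm
  refine ⟨U, n, fun k => E.presheaf.map (eqToHom U.ι_image_top.symm).op
    (show Γ(E, U.ι ''ᵁ ⊤) from α.inv.app ⊤ (e k)), hx, IsFrame.of_restrict rfl he' fun k => ?_⟩
  rw [map_map_apply E _ _ (𝟙 _)]
  simp
  rfl

lemma exists_section_of_isLineBundle {L : X.Modules} (hL : IsLineBundle L) (x : X) :
    ∃ (U : X.Opens) (e : Unit → Γ(L, U)), x ∈ U ∧ IsFrame L U e := by
  obtain ⟨U, hx, ⟨α⟩⟩ := hL x
  have he' := (isFrame_one U.toScheme ⊤).of_iso α.symm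
  refine ⟨U, fun k => L.presheaf.map (eqToHom U.ι_image_top.symm).op
    (show Γ(L, U.ι ''ᵁ ⊤) from α.inv.app ⊤ ((unitSec ⊤).symm 1)), hx,
    IsFrame.of_restrict rfl he' fun k => ?_⟩
  rw [map_map_apply L _ _ (𝟙 _)]
  simp
  rfl

/-- Restriction to an open and pullback along its inclusion are both left adjoint to pushforward;
the formula compares the two units. -/
lemma restrictIso_inv_pullSection (U : X.Opens) {M : X.Modules} {V : X.Opens} (s : Γ(M, V)) :
    ((restrictFunctorIsoPullback U.ι).inv.app M).app _ (pullSection U.ι s) =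
      M.presheaf.map (homOfLE (U.ι.image_preimage_le V)).op s := by
  have := Adjunction.unit_leftAdjointUniq_hom_app (pullbackPushforwardAdjunction U.ι)
    (restrictAdjunction U.ι) M
  exact congr(($this).app V s)

/-- The pullback of a frame along a morphism with image in its domain is a frame. -/
lemma IsFrame.pullback_of_eq_top {f : Y ⟶ X} {M : X.Modules} {U : X.Opens}
    {e : I → Γ(M, U)} (he : IsFrame M U e) (hU : f ⁻¹ᵁ U = ⊤) :
    IsFrame ((Scheme.Modules.pullback f).obj M) (f ⁻¹ᵁ U) (fun k => pullSection f (e k)) := by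
  classical
  -- The `δ k` are the coordinate forms of the pulled-back family, and the `ε k` send `1` to its
  -- members.
  choose δ hδ using fun k => he.exists_pullback_hom (N := unitMod Y) hU
    (fun j => (unitSec _).symm (if j = k then 1 else 0))
  choose ε hε using fun k => exists_unit_hom hU (pullSection f (e k))
  have hε1 (k) : (ε k).app _ ((unitSec _).symm 1) = pullSection f (e k) := by
    have := hε k _ (𝟙 _) 1
    simpa using this
  refine isFrame_of_dual _ δ ε (fun j k => ?_) hε1 ?_
  · rw [← adjSection_eq, hδ]
  · refine he.pullback_hom_ext hU fun j => ?_
    rw [adjSection_eq, hom_sum_app]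
    simp only [Hom.comp_app, ConcreteCategory.comp_apply, ← adjSection_eq, hδ]
    have (k : I) : (ε k).app (f ⁻¹ᵁ U) ((unitSec (f ⁻¹ᵁ U)).symm (if j = k then 1 else 0)) =
        if j = k then pullSection f (e j) else 0 := by
      split_ifs with h
      · rw [hε1, h]
      · simp
    simp [this, adjSection_eq]

/-- The pullback of a frame is a frame. -/
lemma IsFrame.pullback (f : Y ⟶ X) {M : X.Modules} {U : X.Opens}
    {e : I → Γ(M, U)} (he : IsFrame M U e) :
    IsFrame ((Scheme.Modules.pullback f).obj M) (f ⁻¹ᵁ U) (fun k => pullSection f (e k)) := by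
  -- Over `W` the morphism lands in `U`, so the previous case applies to `W.ι ≫ f`; pullback along
  -- `W.ι` is then identified with restriction.
  let W := f ⁻¹ᵁ U
  have hW : (W.ι ≫ f) ⁻¹ᵁ U = ⊤ := W.ι_preimage_self
  have h1 := ((he.pullback_of_eq_top (f := W.ι ≫ f) hW).of_iso
    ((Scheme.Modules.pullbackComp W.ι f).symm.app M)).of_iso
    ((restrictFunctorIsoPullback W.ι).symm.app ((Scheme.Modules.pullback f).obj M))
  refine IsFrame.of_restrict hW h1 fun k => ?_
  refine (congrArg _ (pullbackComp_inv_pullSection f (e k))).trans ?_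
  exact restrictIso_inv_pullSection W (pullSection f (e k))

end FrameConstructions
end Elementary

namespace Elementary
open Scheme.Modules hiding pullback pullbackComp
open Opposite TopologicalSpace

/-! ### Unimodular families and epimorphisms -/

section Local
variable {T : Scheme.{u}}

lemma section_eq_zero_of_locally {K : T.Modules} {W : T.Opens} (m : Γ(K, W))
    (h : ∀ t ∈ W, ∃ (V : T.Opens) (i : V ⟶ W), t ∈ V ∧ K.presheaf.map i.op m = 0) : m = 0 := by
  choose V i hV hm using fun t : W => h t.1 t.2
  refine TopCat.Sheaf.eq_of_locally_eq' (⟨K.presheaf, K.isSheaf⟩ : TopCat.Sheaf Ab T) V W i ?_ _ _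
    fun t => ?_
  · intro t ht
    exact Opens.mem_iSup.2 ⟨⟨t, ht⟩, hV _⟩
  · refine (hm t).trans ?_
    exact (map_zero _).symm

/-- The functions `x k` on `W` have no common zero. -/
def Unimodular {I : Type*} {W : T.Opens} (x : I → Γ(T, W)) : Prop :=
  ∀ t ∈ W, ∃ k, t ∈ T.basicOpen (x k)

/-- Where the value of `ψ` on `n k` is invertible, a morphism killing the image of `ψ` must kill
`1`; these loci cover. -/
lemma epi_of_unimodular {I : Type*} {N : T.Modules} {W : T.Opens} (hW : W = ⊤)
    (ψ : N ⟶ unitMod T) (n : I → Γ(N, W)) (h : Unimodular (fun k => unitSec W (ψ.app W (n k)))) :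
    Epi ψ := by
  refine Preadditive.epi_of_cancel_zero ψ fun {K} α hα => unit_hom_ext hW ?_
  change _ = 0
  refine section_eq_zero_of_locally _ fun t ht => ?_
  obtain ⟨k, hk⟩ := h t ht
  refine ⟨_, homOfLE (T.basicOpen_le _), hk, ?_⟩
  have h1 := congr(($hα).app W (n k))
  rw [Hom.comp_app, ConcreteCategory.comp_apply, unit_hom_app] at h1
  have h2 := congr(K.presheaf.map (homOfLE (T.basicOpen_le (unitSec W (ψ.app W (n k))))).op $h1)
  rw [Scheme.Modules.map_smul] at h2
  have h3 : IsUnit (T.presheaf.map (homOfLE (T.basicOpen_le (unitSec W (ψ.app W (n k))))).op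
    (unitSec W (ψ.app W (n k)))) := T.toRingedSpace.isUnit_res_basicOpen _
  refine h3.smul_eq_zero.1 (h2.trans ?_)
  exact map_zero _

/-- The spectrum of a field is reduced, so a function with empty nonvanishing locus is zero. -/
lemma app_fromSpecResidueField_eq_zero {W : T.Opens} {t : T} (x : Γ(T, W))
    (hx : t ∉ T.basicOpen x) : (T.fromSpecResidueField t).app W x = 0 := by
  rw [← AlgebraicGeometry.basicOpen_eq_bot_iff, ← Scheme.preimage_basicOpen]
  ext z
  simp only [Opens.coe_bot, Set.mem_empty_iff_false, iff_false]
  intro hz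
  have : T.fromSpecResidueField t z = t := by
    have h := Set.mem_range_self (f := T.fromSpecResidueField t) z
    rw [Scheme.range_fromSpecResidueField] at h
    exact h
  exact hx (this ▸ hz)

lemma fromSpecResidueField_preimage {W : T.Opens} {t : T} (ht : t ∈ W) :
    T.fromSpecResidueField t ⁻¹ᵁ W = ⊤ := by
  ext z
  simp only [Opens.coe_top, Set.mem_univ, iff_true]
  have h := Set.mem_range_self (f := T.fromSpecResidueField t) z
  rw [Scheme.range_fromSpecResidueField] at h
  change T.fromSpecResidueField t z ∈ W
  rw [show T.fromSpecResidueField t z = t from h]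
  exact ht

/-- The matrix of an epimorphism between modules with frames has no cokernel, after any base
change. -/
lemma eq_zero_of_epi {I R : Type*} [Fintype I] [Fintype R] {N F : T.Modules} {W : T.Opens}
    {n : I → Γ(N, W)} (hn : IsFrame N W n) {f : R → Γ(F, W)} (hf : IsFrame F W f)
    (p : N ⟶ F) [Epi p] (A : I → R → Γ(T, W)) (hA : ∀ i, p.app W (n i) = ∑ j, A i j • f j)
    {T' : Scheme.{u}} (c : T' ⟶ T) (hc : c ⁻¹ᵁ W = ⊤) (l : R → Γ(T', c ⁻¹ᵁ W))
    (hl : ∀ i, ∑ j, c.app W (A i j) * l j = 0) : l = 0 := by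
  -- The vector `l` is read as a linear form on `c^*F`. By `hl` it vanishes after composition with
  -- `c^*p`, which is epi since pullback is a left adjoint.
  obtain ⟨ψ, hψ⟩ := hf.exists_pullback_hom (N := unitMod _) hc (fun j => (unitSec _).symm (l j))
  have hz : (Scheme.Modules.pullback c).map p ≫ ψ = 0 := by
    refine hn.pullback_hom_ext hc fun i => ?_
    rw [adjSection_map_comp, hA, adjSection_eq]
    have h0 : adjSection (0 : (Scheme.Modules.pullback c).obj N ⟶ unitMod _) W (n i) = 0 := by
      rw [adjSection_eq]; rfl
    rw [h0]
    have h1 : pullSection c (∑ j, A i j • f j) = ∑ j, c.app W (A i j) • pullSection c (f j) := by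
      have := map_sum (((pullbackPushforwardAdjunction c).unit.app F).app W).hom
        (fun j => A i j • f j) Finset.univ
      refine this.trans ?_
      refine Finset.sum_congr rfl fun j _ => pullSection_smul _ _ _
    rw [h1]
    simp only [map_sum, Hom.app_smul, ← adjSection_eq, hψ]
    apply (unitSec _).injective
    simpa using hl i
  have hψ0 : ψ = 0 := by
    have : Epi ((Scheme.Modules.pullback c).map p) := inferInstance
    rw [← cancel_epi ((Scheme.Modules.pullback c).map p), hz, comp_zero]
  ext j
  have := hψ j
  rw [hψ0, adjSection_eq] at this
  have := congr(unitSec _ $this)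
  simpa using this.symm

/-- If all the values vanished at `t`, the matrix of `ψ` over the residue field would be zero and
would kill the vector `1`, against `eq_zero_of_epi`. -/
lemma unimodular_of_epi {I : Type*} [Fintype I] {N : T.Modules} {W : T.Opens}
    {n : I → Γ(N, W)} (hn : IsFrame N W n) (ψ : N ⟶ unitMod T) [Epi ψ] :
    Unimodular (fun k => unitSec W (ψ.app W (n k))) := by
  intro t ht
  by_contra! h
  have := eq_zero_of_epi hn (isFrame_one T W) ψ (fun k _ => unitSec W (ψ.app W (n k)))
    (fun i => by
      apply (unitSec W).injective
      simp) (T.fromSpecResidueField t) (fromSpecResidueField_preimage ht) 1 (fun i => by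
      simp only [Finset.univ_unique, Finset.sum_singleton,
        app_fromSpecResidueField_eq_zero _ (h i), zero_mul])
  have h1 := congr_fun this ()
  have : Nonempty (T.fromSpecResidueField t ⁻¹ᵁ W : (Spec (T.residueField t)).Opens) := by
    rw [fromSpecResidueField_preimage ht]
    obtain ⟨z⟩ : Nonempty (Spec (T.residueField t)) := inferInstance
    exact ⟨z, trivial⟩
  exact one_ne_zero h1

lemma exists_iso_unit {L : T.Modules} {W : T.Opens} (hW : W = ⊤) {l : Unit → Γ(L, W)}
    (hl : IsFrame L W l) : Nonempty (L ≅ unitMod T) := by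
  obtain ⟨φ, hφ⟩ := exists_unit_hom hW (l ())
  have : IsIso φ := by
    rw [Hom.isIso_iff_isIso_app]
    intro V
    rw [ConcreteCategory.isIso_iff_bijective]
    have h := hl V (homOfLE (hW ▸ le_top))
    let σ : Γ(unitMod T, V) → (Unit → Γ(T, V)) := fun s _ => unitSec V s
    have hσ : Function.Bijective σ :=
      ⟨fun a b hab => (unitSec V).injective (congr_fun hab ()),
        fun c => ⟨(unitSec V).symm (c ()), by ext; simp [σ]⟩⟩
    convert! h.comp hσ using 1
    ext s
    have := hφ V (homOfLE (hW ▸ le_top)) (unitSec V s)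
    simpa [σ] using this
  exact ⟨(asIso φ).symm⟩

lemma isLineBundle_unit : IsLineBundle (unitMod T) := fun _ =>
  ⟨⊤, trivial, ⟨restrictUnitIso _⟩⟩

end Local

/-! ### Homogeneous coordinates of morphisms to a projective bundle -/

section Coords
variable {S : Scheme.{u}} {E : S.Modules} (P : ProjectiveBundle E) {U : S.Opens}
  {I : Type*} (e : I → Γ(E, U)) {T T' : Scheme.{u}}

/-- `g : T ⟶ P_S(E)` is a morphism over `q : T ⟶ S` with homogeneous coordinates `x` with respect
to the sections `e` of `E`. -/
def HasCoords (g : T ⟶ P.space) (q : T ⟶ S) (x : I → Γ(T, q ⁻¹ᵁ U)) : Prop :=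
  ∃ (h : g ≫ P.π = q) (β : (Scheme.Modules.pullback g).obj P.O1 ≅ unitMod T),
    ∀ k, adjSection (pullTaut P.taut g h ≫ β.hom) U (e k) = (unitSec _).symm (x k)

variable {P e}

lemma epi_pullTaut (g : T ⟶ P.space) {q : T ⟶ S} (h : g ≫ P.π = q) :
    Epi (pullTaut P.taut g h) := by
  have := P.epi_taut
  have : Epi ((Scheme.Modules.pullback g).map P.taut) := inferInstance
  unfold pullTaut
  infer_instance

lemma hasCoords_iff_classifies [Fintype I] (he : IsFrame E U e) {g : T ⟶ P.space} {q : T ⟶ S}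
    (hq : q ⁻¹ᵁ U = ⊤) {x : I → Γ(T, q ⁻¹ᵁ U)} {ψ : (Scheme.Modules.pullback q).obj E ⟶ unitMod T}
    (hψ : ∀ k, adjSection ψ U (e k) = (unitSec _).symm (x k)) :
    HasCoords P e g q x ↔ Classifies P.taut q ψ g := by
  refine exists_congr fun h => exists_congr fun β => ⟨fun H => ?_, fun H k => ?_⟩
  · exact he.pullback_hom_ext hq fun k => (H k).trans (hψ k).symm
  · rw [H, hψ]

/-- A unimodular family is the list of values of an epimorphism from `q^*E` to the structure sheaf,
to which the universal property applies. -/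
lemma existsUnique_hasCoords [Fintype I] (he : IsFrame E U e) {q : T ⟶ S} (hq : q ⁻¹ᵁ U = ⊤)
    {x : I → Γ(T, q ⁻¹ᵁ U)} (hx : Unimodular x) : ∃! g, HasCoords P e g q x := by
  obtain ⟨ψ, hψ⟩ := he.exists_pullback_hom (N := unitMod T) hq (fun k => (unitSec _).symm (x k))
  simp only [hasCoords_iff_classifies he hq hψ]
  refine P.universal q _ ψ isLineBundle_unit
    (epi_of_unimodular hq ψ (fun k => pullSection q (e k)) ?_)
  simpa only [← adjSection_eq, hψ, LinearEquiv.apply_symm_apply] using hx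

lemma HasCoords.unimodular [Fintype I] (he : IsFrame E U e) {g : T ⟶ P.space} {q : T ⟶ S} (hq : q ⁻¹ᵁ U = ⊤)
    {x : I → Γ(T, q ⁻¹ᵁ U)} (h : HasCoords P e g q x) : Unimodular x := by
  obtain ⟨h, β, H⟩ := h
  have := epi_pullTaut g h
  have := unimodular_of_epi (he.pullback_of_eq_top hq) (pullTaut P.taut g h ≫ β.hom)
  simpa only [← adjSection_eq, H, LinearEquiv.apply_symm_apply] using this

lemma HasCoords.eq [Fintype I] (he : IsFrame E U e) {g g' : T ⟶ P.space} {q : T ⟶ S} (hq : q ⁻¹ᵁ U = ⊤)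
    {x : I → Γ(T, q ⁻¹ᵁ U)} (h : HasCoords P e g q x) (h' : HasCoords P e g' q x) : g = g' :=
  (existsUnique_hasCoords he hq (h.unimodular he hq)).unique h h'

/-- Two trivialisations of the pulled-back `𝒪(1)` differ by an automorphism of the structure sheaf,
that is, by a unit. -/
lemma HasCoords.exists_isUnit {g : T ⟶ P.space} {q : T ⟶ S}
    {x y : I → Γ(T, q ⁻¹ᵁ U)} (h : HasCoords P e g q x) (h' : HasCoords P e g q y) :
    ∃ u : Γ(T, q ⁻¹ᵁ U), IsUnit u ∧ ∀ k, y k = u * x k := by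
  obtain ⟨h, β, H⟩ := h
  obtain ⟨_, β', H'⟩ := h'
  let ρ := β.symm ≪≫ β'
  let one : Γ(unitMod T, q ⁻¹ᵁ U) := (unitSec _).symm 1
  have h1 : unitSec _ (ρ.inv.app _ one) * unitSec _ (ρ.hom.app _ one) = 1 := by
    have := congr(unitSec _ (($(ρ.inv_hom_id)).app (q ⁻¹ᵁ U) one))
    rw [Hom.comp_app, ConcreteCategory.comp_apply, unit_hom_app ρ.hom] at this
    simpa [one] using this
  refine ⟨unitSec _ (ρ.hom.app _ one), .of_mul_eq_one_right _ h1, fun k => ?_⟩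
  have h2 : pullTaut P.taut g h ≫ β'.hom = (pullTaut P.taut g h ≫ β.hom) ≫ ρ.hom := by simp [ρ]
  have h3 := H' k
  rw [h2, adjSection_comp, H k, unit_hom_app] at h3
  have := congr(unitSec _ $h3)
  simpa [mul_comm] using this.symm

lemma HasCoords.smul {g : T ⟶ P.space} {q : T ⟶ S} (hq : q ⁻¹ᵁ U = ⊤)
    {x : I → Γ(T, q ⁻¹ᵁ U)} (h : HasCoords P e g q x) {u : Γ(T, q ⁻¹ᵁ U)} (hu : IsUnit u) :
    HasCoords P e g q (fun k => u * x k) := by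
  obtain ⟨h, β, H⟩ := h
  obtain ⟨u, rfl⟩ := hu
  obtain ⟨φ, hφ⟩ := exists_unit_hom hq ((unitSec _).symm u.1)
  obtain ⟨ψ, hψ⟩ := exists_unit_hom hq ((unitSec _).symm u.2)
  have hφ' (r) : φ.app (q ⁻¹ᵁ U) ((unitSec _).symm r) = (unitSec _).symm (r * u.1) := by
    have := hφ _ (𝟙 _) r
    apply (unitSec _).injective
    simpa using congr(unitSec _ $this)
  have hψ' (r) : ψ.app (q ⁻¹ᵁ U) ((unitSec _).symm r) = (unitSec _).symm (r * u.2) := by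
    have := hψ _ (𝟙 _) r
    apply (unitSec _).injective
    simpa using congr(unitSec _ $this)
  let ρ : unitMod T ≅ unitMod T := ⟨φ, ψ,
    unit_hom_ext hq (by
      rw [Hom.comp_app, ConcreteCategory.comp_apply, hφ', hψ', one_mul]
      exact congrArg _ u.val_inv),
    unit_hom_ext hq (by
      rw [Hom.comp_app, ConcreteCategory.comp_apply, hψ', hφ', one_mul]
      exact congrArg _ u.inv_val)⟩
  refine ⟨h, β ≪≫ ρ, fun k => ?_⟩
  rw [Iso.trans_hom, ← Category.assoc, adjSection_comp, H, hφ', mul_comm]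

lemma HasCoords.comp {g : T ⟶ P.space} {q : T ⟶ S} {x : I → Γ(T, q ⁻¹ᵁ U)}
    (h : HasCoords P e g q x) (c : T' ⟶ T) :
    HasCoords P e (c ≫ g) (c ≫ q) (fun k => c.app _ (x k)) := by
  obtain ⟨h, β, H⟩ := h
  subst h
  obtain ⟨ν, hν⟩ := exists_pullback_unit_iso c
  refine ⟨Category.assoc _ _ _,
    ((Scheme.Modules.pullbackComp c g).symm.app P.O1) ≪≫ (Scheme.Modules.pullback c).mapIso β ≪≫ ν,
    fun k => ?_⟩
  have H := H k
  rw [adjSection_comp, adjSection_pullTaut] at H ⊢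
  rw [hom_app_map] at H ⊢
  set m := adjSection P.taut U (e k)
  have key : (((Scheme.Modules.pullbackComp c g).symm.app P.O1) ≪≫
      (Scheme.Modules.pullback c).mapIso β ≪≫ ν).hom.app _ (pullSection (c ≫ g) m) =
      (unitSec _).symm (c.app _ (unitSec _ (β.hom.app _ (pullSection g m)))) := by
    refine (congrArg (ν.hom.app _) (congrArg (((Scheme.Modules.pullback c).map β.hom).app _)
      (pullbackComp_inv_pullSection g m))).trans ?_
    refine (congrArg (ν.hom.app _) (pullback_map_pullSection _ β.hom (pullSection g m))).trans ?_
    exact hν _ _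
  have H' : β.hom.app _ (pullSection g m) = (unitSec _).symm (x k) :=
    congr($((unitMod T).presheaf.map_id _) _).symm.trans H
  rw [H'] at key
  refine (congrArg _ key).trans ?_
  exact congr($((unitMod T').presheaf.map_id _) _)

lemma exists_hasCoords {g : T ⟶ P.space} {q : T ⟶ S} (h : g ≫ P.π = q)
    {O : P.space.Opens} {l : Unit → Γ(P.O1, O)} (hl : IsFrame P.O1 O l) (hO : g ⁻¹ᵁ O = ⊤) :
    ∃ x, HasCoords P e g q x := by
  obtain ⟨β⟩ := exists_iso_unit hO (hl.pullback_of_eq_top hO)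
  exact ⟨fun k => unitSec _ (adjSection (pullTaut P.taut g h ≫ β.hom) U (e k)), h, β,
    fun k => by simp⟩

end Coords
end Elementary

/-! ### Regular functions, closed subschemes and Cartier divisors -/

namespace Elementary
open Opposite TopologicalSpace

section Schemes
variable {T X Y S D : Scheme.{u}}

lemma function_eq_zero_of_locally {W : T.Opens} (m : Γ(T, W))
    (h : ∀ t ∈ W, ∃ (V : T.Opens) (i : V ⟶ W), t ∈ V ∧ T.presheaf.map i.op m = 0) : m = 0 := by
  have := section_eq_zero_of_locally (K := unitMod T) ((unitSec W).symm m) h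
  exact this

lemma app_map_apply (f : X ⟶ Y) {U V : Y.Opens} (i : U ⟶ V) (s : Γ(Y, V)) :
    f.app U (Y.presheaf.map i.op s) =
      X.presheaf.map ((Opens.map f.base).map i).op (f.app V s) :=
  congr($(f.naturality i.op) s)

lemma comp_app_apply (f : T ⟶ X) (g : X ⟶ Y) (U : Y.Opens) (s : Γ(Y, U)) :
    (f ≫ g).app U s = f.app (g ⁻¹ᵁ U) (g.app U s) :=
  congr($(Scheme.Hom.comp_app f g U) s)

lemma presheaf_map_map {U V W : X.Opens} (i : U ⟶ V) (j : V ⟶ W) (k : U ⟶ W) (s : Γ(X, W)) :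
    X.presheaf.map i.op (X.presheaf.map j.op s) = X.presheaf.map k.op s :=
  map_map_apply (unitMod X) i j k s

/-- The function `a` is a nonzerodivisor on each smaller open. -/
def IsRegularFun {V : T.Opens} (a : Γ(T, V)) : Prop :=
  ∀ (W : T.Opens) (i : W ⟶ V), T.presheaf.map i.op a ∈ nonZeroDivisors Γ(T, W)

lemma IsRegularFun.mem {V : T.Opens} {a : Γ(T, V)} (h : IsRegularFun a) :
    a ∈ nonZeroDivisors Γ(T, V) := by
  simpa using h V (𝟙 V)

lemma IsRegularFun.map {V W : T.Opens} {a : Γ(T, V)} (h : IsRegularFun a) (i : W ⟶ V) :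
    IsRegularFun (T.presheaf.map i.op a) := fun W' j => by
  rw [presheaf_map_map j i (j ≫ i)]
  exact h _ _

lemma isRegularFun_of_locally {V : T.Opens} {a : Γ(T, V)}
    (h : ∀ t ∈ V, ∃ (W : T.Opens) (i : W ⟶ V), t ∈ W ∧ IsRegularFun (T.presheaf.map i.op a)) :
    IsRegularFun a := by
  intro W i
  rw [mem_nonZeroDivisors_iff_right]
  intro b hb
  refine function_eq_zero_of_locally b fun t ht => ?_
  obtain ⟨W', j, htW', h'⟩ := h t (i.le ht)
  refine ⟨W ⊓ W', homOfLE inf_le_left, ⟨ht, htW'⟩, ?_⟩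
  have h1 := h' (W ⊓ W') (homOfLE inf_le_right)
  rw [presheaf_map_map _ _ (homOfLE inf_le_left ≫ i),
    ← presheaf_map_map (homOfLE inf_le_left) i] at h1
  rw [mem_nonZeroDivisors_iff_right] at h1
  refine h1 _ ?_
  rw [← map_mul, hb, map_zero]

/-- Nonzerodivisors survive localisation, and basic opens of `V` cover each smaller open. -/
lemma isRegularFun_of_isAffineOpen {V : T.Opens} (hV : IsAffineOpen V) {a : Γ(T, V)}
    (ha : a ∈ nonZeroDivisors Γ(T, V)) : IsRegularFun a := by
  intro W i
  rw [mem_nonZeroDivisors_iff_right]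
  intro b hb
  refine function_eq_zero_of_locally b fun t ht => ?_
  obtain ⟨f, hf, htf⟩ := hV.exists_basicOpen_le ⟨t, ht⟩ (i.le ht)
  refine ⟨_, homOfLE hf, htf, ?_⟩
  have := hV.isLocalization_basicOpen f
  have h1 : T.presheaf.map (homOfLE (T.basicOpen_le f)).op a ∈ nonZeroDivisors _ :=
    IsLocalization.map_nonZeroDivisors_le (.powers f) Γ(T, T.basicOpen f) ⟨a, ha, rfl⟩
  rw [mem_nonZeroDivisors_iff_right] at h1
  refine h1 _ ?_
  rw [← presheaf_map_map (homOfLE hf) i, ← map_mul, hb, map_zero]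

lemma IsRegularFun.of_mul_left {V : T.Opens} {a b : Γ(T, V)} (h : IsRegularFun (a * b)) :
    IsRegularFun a := fun W i => by
  have := h W i
  rw [map_mul, mul_mem_nonZeroDivisors] at this
  exact this.1

lemma IsRegularFun.of_mul_right {V : T.Opens} {a b : Γ(T, V)} (h : IsRegularFun (a * b)) :
    IsRegularFun b := IsRegularFun.of_mul_left (mul_comm a b ▸ h)

/-- A function is regular if its pullback along a morphism with a section over `V` is. -/
lemma mem_nonZeroDivisors_of_section {V : X.Opens} (c : T ⟶ X) (h : V.toScheme ⟶ T)
    (hc : h ≫ c = V.ι) {a : Γ(X, V)} (ha : c.app V a ∈ nonZeroDivisors Γ(T, c ⁻¹ᵁ V)) :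
    a ∈ nonZeroDivisors Γ(X, V) := by
  -- Pulling back further along `h` gives the isomorphism `V.ι.app V`, so pullback along `c` is
  -- injective.
  have hinj : Function.Injective (c.app V) := by
    have h1 : Function.Injective (V.ι.app V) :=
      ((ConcreteCategory.isIso_iff_bijective _).1 (V.ι.isIso_app V (by simp))).1
    rw [← hc] at h1
    exact Function.Injective.of_comp (f := h.app (c ⁻¹ᵁ V)) h1
  rw [mem_nonZeroDivisors_iff_right] at ha ⊢
  intro b hb
  apply hinj
  rw [map_zero]
  exact ha _ (by rw [← map_mul, hb, map_zero])

lemma exists_closed_subscheme [IsAffine T] {W : T.Opens} (hW : W = ⊤) (A : Ideal Γ(T, W)) :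
    ∃ (Z : Scheme.{u}) (c : Z ⟶ T), IsClosedImmersion c ∧ RingHom.ker (c.app W).hom = A ∧
      ∀ {T' : Scheme.{u}} (d : T' ⟶ T), (∀ r ∈ A, d.app W r = 0) → ∃ a, a ≫ c = d := by
  subst hW
  let K : T.IdealSheafData := .ofIdealTop A
  have hK : K.ideal ⟨⊤, isAffineOpen_top T⟩ = A := by simp [K]
  refine ⟨K.subscheme, K.subschemeι, inferInstance,
    (K.ker_subschemeι_app ⟨⊤, isAffineOpen_top T⟩).trans hK, fun d hd => ?_⟩
  refine ⟨IsClosedImmersion.lift K.subschemeι d ?_, IsClosedImmersion.lift_fac _ _ _⟩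
  rw [Scheme.IdealSheafData.ker_subschemeι]
  refine Scheme.IdealSheafData.le_of_isAffine ?_
  rw [hK, Scheme.ker_of_isAffine]
  simpa [Ideal.map_id] using! hd

/-- The ideal of the inverse image of a closed subscheme, by its functor of points. -/
lemma ideal_comap_ker_eq [IsAffine T] (i : Y ⟶ X) [IsClosedImmersion i] (b : T ⟶ X) {W : T.Opens}
    (hW : W = ⊤) (hWa : IsAffineOpen W) (A : Ideal Γ(T, W))
    (h : ∀ {T' : Scheme.{u}} (c : T' ⟶ T), (∀ r ∈ A, c.app W r = 0) ↔ ∃ g, g ≫ i = c ≫ b) :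
    (i.ker.comap b).ideal ⟨W, hWa⟩ = A := by
  subst hW
  rw [← Scheme.IdealSheafData.ker_fst_of_isClosedImmersion]
  apply le_antisymm
  -- Testing on the closed subscheme cut out by `A`: it maps to the inverse image of `Y`, so the
  -- ideal of the latter lies in `A`.
  · obtain ⟨Z, c, hc, hA, -⟩ := exists_closed_subscheme rfl A
    obtain ⟨g, hg⟩ := (h c).1 fun r hr => by rw [← hA] at hr; exact hr
    have h1 := Scheme.Hom.le_ker_comp (pullback.lift c g hg.symm) (pullback.fst b i)
      ⟨⊤, isAffineOpen_top T⟩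
    rw [pullback.lift_fst, Scheme.Hom.ker_apply c, hA] at h1
    exact h1
  -- Testing on the inverse image itself gives the other inclusion.
  · intro r hr
    rw [Scheme.Hom.ker_apply]
    exact (h (pullback.fst b i)).2 ⟨pullback.snd b i, pullback.condition.symm⟩ r hr

/-- Over `V` the monomorphisms `i` and `c` factor through one another, so `Z` is isomorphic to the
preimage of `V`. -/
lemma isClosedImmersion_of_locally (i : Y ⟶ X) [Mono i]
    (h : ∀ x : X, ∃ (V : X.Opens) (Z : Scheme.{u}) (c : Z ⟶ V.toScheme) (s : Z ⟶ Y)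
      (a : (i ⁻¹ᵁ V).toScheme ⟶ Z), x ∈ V ∧ IsClosedImmersion c ∧ s ≫ i = c ≫ V.ι ∧
        a ≫ c ≫ V.ι = (i ⁻¹ᵁ V).ι ≫ i) : IsClosedImmersion i := by
  choose V Z c s a hV hc hs ha using h
  refine (IsZariskiLocalAtTarget.iff_of_iSup_eq_top (P := @IsClosedImmersion) V ?_).2 fun x => ?_
  · exact top_le_iff.1 fun x _ => Opens.mem_iSup.2 ⟨x, hV x⟩
  · have h1 : a x ≫ c x = i ∣_ V x := by
      rw [← cancel_mono (V x).ι, Category.assoc, ha, morphismRestrict_ι]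
    have hle : s x ⁻¹ᵁ (i ⁻¹ᵁ V x) = ⊤ := by
      change (s x ≫ i) ⁻¹ᵁ V x = ⊤
      rw [hs]
      change c x ⁻¹ᵁ ((V x).ι ⁻¹ᵁ V x) = ⊤
      simp
    let s' : Z x ⟶ (i ⁻¹ᵁ V x).toScheme := IsOpenImmersion.lift (i ⁻¹ᵁ V x).ι (s x) (by
      rw [Scheme.Opens.range_ι]
      rintro _ ⟨z, rfl⟩
      exact (hle ▸ trivial : z ∈ s x ⁻¹ᵁ (i ⁻¹ᵁ V x)))
    have hs' : s' ≫ (i ⁻¹ᵁ V x).ι = s x := IsOpenImmersion.lift_fac _ _ _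
    have : IsIso (a x) := by
      refine ⟨s', ?_, ?_⟩
      · rw [← cancel_mono (i ⁻¹ᵁ V x).ι, ← cancel_mono i]
        simp only [Category.assoc, hs', hs, ha, Category.id_comp]
      · rw [← cancel_mono (c x), ← cancel_mono (V x).ι]
        simp only [Category.assoc, ha, reassoc_of% hs', hs, Category.id_comp]
    rw [← h1]
    infer_instance

/-- The ideal over one affine open containing the image of `q` suffices: near a point, any other
affine open is compared with `U` on a smaller affine `V'`, where the ideal is generated by that of
`U`. -/
lemma exists_factor_iff (ι : D ⟶ S) [IsClosedImmersion ι] {U : S.affineOpens} {q : T ⟶ S}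
    (hq : q ⁻¹ᵁ U.1 = ⊤) :
    (∃ r, r ≫ ι = q) ↔ ∀ s ∈ ι.ker.ideal U, q.app U s = 0 := by
  constructor
  · rintro ⟨r, rfl⟩ s hs
    rw [Scheme.Hom.ker_apply] at hs
    have : ι.app U s = 0 := hs
    rw [comp_app_apply, this]
    exact map_zero _
  · intro h
    refine ⟨IsClosedImmersion.lift ι q ?_, IsClosedImmersion.lift_fac _ _ _⟩
    refine Scheme.IdealSheafData.le_ofIdeals_iff.2 fun V s hs => ?_
    change q.app V s = 0
    refine function_eq_zero_of_locally _ fun t ht => ?_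
    have htU : q t ∈ U.1 := (hq ▸ trivial : t ∈ q ⁻¹ᵁ U.1)
    obtain ⟨_, ⟨V', hV', rfl⟩, htV', hle⟩ := (S.isBasis_affineOpens).exists_subset_of_mem_open
      (show q t ∈ (V.1 ⊓ U.1 : S.Opens) from ⟨ht, htU⟩) (V.1 ⊓ U.1).2
    replace hle : V' ≤ V.1 ⊓ U.1 := hle
    have h1 : S.presheaf.map (homOfLE (hle.trans inf_le_left)).op s ∈
        ι.ker.ideal ⟨V', hV'⟩ :=
      ι.ker.ideal_le_comap_ideal (U := ⟨V', hV'⟩) (V := V) (hle.trans inf_le_left) hs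
    rw [← ι.ker.map_ideal (U := ⟨V', hV'⟩) (V := U) (hle.trans inf_le_right)] at h1
    have h2 : (ι.ker.ideal U).map (S.presheaf.map (homOfLE (hle.trans inf_le_right)).op).hom ≤
        RingHom.ker (q.app V').hom := by
      rw [Ideal.map_le_iff_le_comap]
      intro r hr
      change q.app V' (S.presheaf.map (homOfLE (hle.trans inf_le_right)).op r) = 0
      rw [app_map_apply, h r hr, map_zero]
    have h3 : q.app V' (S.presheaf.map (homOfLE (hle.trans inf_le_left)).op s) = 0 := h2 h1
    rw [app_map_apply] at h3
    exact ⟨_, _, htV', h3⟩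

lemma exists_factor_iff_of_span (ι : D ⟶ S) [IsClosedImmersion ι] {U : S.affineOpens} {q : T ⟶ S}
    (hq : q ⁻¹ᵁ U.1 = ⊤) {t : Γ(S, U)} (ht : ι.ker.ideal U = Ideal.span {t}) :
    (∃ r, r ≫ ι = q) ↔ q.app U t = 0 := by
  rw [exists_factor_iff ι hq, ht]
  refine ⟨fun h => h t (Ideal.mem_span_singleton_self t), fun h s hs => ?_⟩
  obtain ⟨c, rfl⟩ := Ideal.mem_span_singleton'.1 hs
  rw [map_mul, h, mul_zero]

/-- The Cartier condition, in terms of affine open subschemes. -/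
lemma isCartierDivisor_of_locally {K : T.IdealSheafData}
    (h : ∀ t : T, ∃ (V : T.Opens) (W : V.toScheme.affineOpens), t ∈ V ∧ W.1 = ⊤ ∧
      ∃ a ∈ nonZeroDivisors Γ(V.toScheme, W), (K.comap V.ι).ideal W = Ideal.span {a}) :
    IsCartierDivisor K := by
  intro t
  obtain ⟨V, W, ht, hW, a, ha, hK⟩ := h t
  refine ⟨⟨V.ι ''ᵁ W.1, W.2.image_of_isOpenImmersion _⟩, ?_, a, ha, ?_⟩
  · change t ∈ V.ι ''ᵁ W.1
    rw [hW, V.ι_image_top]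
    exact ht
  · rw [Scheme.IdealSheafData.ideal_comap_of_isOpenImmersion, Scheme.Opens.ι_appIso] at hK
    exact hK

/-- The generator on a given affine open still generates on a basic open inside `O`, and stays
regular there. -/
lemma IsCartierDivisor.exists_local {K : T.IdealSheafData} (h : IsCartierDivisor K) (t : T)
    (O : T.Opens) (ht : t ∈ O) :
    ∃ V : T.Opens, t ∈ V ∧ V ≤ O ∧ IsAffineOpen V ∧ ∀ (W : V.toScheme.affineOpens), W.1 = ⊤ →
      ∃ a : Γ(V.toScheme, W), IsRegularFun a ∧ (K.comap V.ι).ideal W = Ideal.span {a} := by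
  obtain ⟨V₀, htV₀, a, ha, hK⟩ := h t
  obtain ⟨f, hf, htf⟩ := V₀.2.exists_basicOpen_le ⟨t, ht⟩ htV₀
  refine ⟨T.basicOpen f, htf, hf, V₀.2.basicOpen f, fun W hW => ?_⟩
  have hle : (T.basicOpen f).ι ''ᵁ W.1 ≤ V₀ := ((T.basicOpen f).ι_image_le _).trans (T.basicOpen_le f)
  have hreg := isRegularFun_of_isAffineOpen V₀.2 ha
  refine ⟨T.presheaf.map (homOfLE hle).op a, fun W' i => ?_, ?_⟩
  · have := hreg.map (homOfLE hle) ((T.basicOpen f).ι ''ᵁ W')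
      ((T.basicOpen f).ι.opensFunctor.map i)
    exact this
  · rw [Scheme.IdealSheafData.ideal_comap_of_isOpenImmersion, Scheme.Opens.ι_appIso]
    have h1 := K.map_ideal (U := ⟨_, W.2.image_of_isOpenImmersion _⟩) (V := V₀) hle
    rw [hK, Ideal.map_span, Set.image_singleton] at h1
    exact h1.symm

end Schemes
end Elementary

namespace Elementary
open Scheme.Modules hiding pullback pullbackComp
open Opposite TopologicalSpace

lemma adjSection_zero {X Y : Scheme.{u}} {f : X ⟶ Y} {M : Y.Modules} {N : X.Modules}
    (φ : (Scheme.Modules.pullback f).obj M ⟶ N) (U : Y.Opens) : adjSection φ U 0 = 0 :=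
  map_zero (((pullbackPushforwardAdjunction f).homEquiv M N φ).app U).hom

/-! ### Adapted frames and the closed immersion of projective bundles -/

section Adapted
variable {S D : Scheme.{u}} {ι : D ⟶ S} {E : S.Modules} {F : D.Modules}
  {p : (Scheme.Modules.pullback ι).obj E ⟶ F} {I : Type u} [Fintype I]

/-- Frames `e` of `E` over the affine open `U` and `f` of `F` over `ι⁻¹U` for which `p` is the
projection to the coordinates in `J`, and a generator `t` of the ideal of `D` on `U`. -/
structure IsAdapted (ι : D ⟶ S) (p : (Scheme.Modules.pullback ι).obj E ⟶ F) (U : S.affineOpens)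
    (t : Γ(S, U)) (J : Finset I) (e : I → Γ(E, U)) (f : J → Γ(F, ι ⁻¹ᵁ U.1)) : Prop where
  frame : IsFrame E U.1 e
  frame' : IsFrame F (ι ⁻¹ᵁ U.1) f
  map_mem : ∀ j : J, adjSection p U.1 (e j) = f j
  map_notMem : ∀ k ∉ J, adjSection p U.1 (e k) = 0
  ker : ι.ker.ideal U = Ideal.span {t}

open Classical in
/-- Extension of a family by zero. -/
def extendZero {I : Type*} {R : Type*} [Zero R] (J : Finset I) (z : J → R) : I → R :=
  fun k => if h : k ∈ J then z ⟨k, h⟩ else 0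

lemma extendZero_mem {I : Type*} {R : Type*} [Zero R] {J : Finset I} (z : J → R) {k : I}
    (h : k ∈ J) : extendZero J z k = z ⟨k, h⟩ := dif_pos h

lemma extendZero_notMem {I : Type*} {R : Type*} [Zero R] {J : Finset I} (z : J → R) {k : I}
    (h : k ∉ J) : extendZero J z k = 0 := dif_neg h

lemma function_eq_zero_of_ι_app {T : Scheme.{u}} {W : T.Opens} (m : Γ(T, W))
    (h : ∀ s ∈ W, ∃ V : T.Opens, s ∈ V ∧ V.ι.app W m = 0) : m = 0 := by
  refine function_eq_zero_of_locally m fun s hs => ?_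
  obtain ⟨V, hV, hm⟩ := h s hs
  rw [Scheme.Opens.ι_app] at hm
  exact ⟨V.ι ''ᵁ V.ι ⁻¹ᵁ W, _, ⟨⟨s, hV⟩, hs, rfl⟩, hm⟩

lemma ι_comp_preimage {T : Scheme.{u}} {q : T ⟶ S} {U : S.Opens} {V : T.Opens}
    (h : V ≤ q ⁻¹ᵁ U) : (V.ι ≫ q) ⁻¹ᵁ U = ⊤ := by
  ext z
  simp only [Opens.coe_top, Set.mem_univ, iff_true]
  exact h z.2

/-- `V₀` is a locus where the pullback of `𝒪(1)` is trivial; it is thus chosen before any frame, and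
every smaller open inherits coordinates. -/
lemma exists_hasCoords_nhds {P : ProjectiveBundle E} {T : Scheme.{u}} {g : T ⟶ P.space}
    {q : T ⟶ S} (h : g ≫ P.π = q) (t : T) :
    ∃ V₀ : T.Opens, t ∈ V₀ ∧ ∀ V ≤ V₀, ∀ {U : S.Opens} {I : Type u} (e : I → Γ(E, U)),
      ∃ x, HasCoords P e (V.ι ≫ g) (V.ι ≫ q) x := by
  obtain ⟨O, l, hO, hl⟩ := exists_section_of_isLineBundle P.isLineBundle (g t)
  refine ⟨g ⁻¹ᵁ O, hO, fun V hV U I e => ?_⟩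
  exact exists_hasCoords (by rw [Category.assoc, h]) hl (ι_comp_preimage hV)

variable {X : ProjectiveBundle E} {Y : ProjectiveBundle F} {i : Y.space ⟶ X.space}
  {U : S.affineOpens} {t : Γ(S, U)} {J : Finset I} {e : I → Γ(E, U)} {f : J → Γ(F, ι ⁻¹ᵁ U.1)}
  {T : Scheme.{u}}

/-- The quotient induced on `P_D(F)` factors through `p`, which sends `e k` to `f k` for `k` in `J`
and to zero otherwise. -/
lemma HasCoords.comp_induced (hi : IsInducedBy ι p X Y i) (ha : IsAdapted ι p U t J e f)
    {g : T ⟶ Y.space} {r : T ⟶ D} {z : J → Γ(T, r ⁻¹ᵁ (ι ⁻¹ᵁ U.1))} (hz : HasCoords Y f g r z) :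
    HasCoords X e (g ≫ i) (r ≫ ι) (extendZero J z) := by
  obtain ⟨hπ, ε, hε⟩ := hi
  obtain ⟨h, β, H⟩ := hz
  have h' : (g ≫ i) ≫ X.π = r ≫ ι := by rw [Category.assoc, hπ, reassoc_of% h]
  have h'' : g ≫ (Y.π ≫ ι) = r ≫ ι := by rw [reassoc_of% h]
  refine ⟨h', (Scheme.Modules.pullbackComp g i).symm.app X.O1 ≪≫
    (Scheme.Modules.pullback g).mapIso ε ≪≫ β, fun k => ?_⟩
  have key : pullTaut X.taut (g ≫ i) h' ≫ ((Scheme.Modules.pullbackComp g i).symm.app X.O1 ≪≫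
      (Scheme.Modules.pullback g).mapIso ε ≪≫ β).hom =
      pullTaut ((Scheme.Modules.pullbackComp Y.π ι).inv.app E ≫
        (Scheme.Modules.pullback Y.π).map p ≫ Y.taut) g h'' ≫ β.hom := by
    rw [← hε, ← pullTaut_comp_map, ← pullTaut_comp X.taut i hπ g h'' h']
    simp
  rw [key, adjSection_comp, adjSection_pullTaut]
  have h1 : adjSection ((Scheme.Modules.pullbackComp Y.π ι).inv.app E ≫
        (Scheme.Modules.pullback Y.π).map p ≫ Y.taut) U.1 (e k) =
        adjSection Y.taut (ι ⁻¹ᵁ U.1) (adjSection p U.1 (e k)) := by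
    rw [adjSection_eq, Hom.comp_app, ConcreteCategory.comp_apply]
    refine (congrArg _ (pullbackComp_inv_pullSection ι (e k))).trans ?_
    exact (adjSection_eq ((Scheme.Modules.pullback Y.π).map p ≫ Y.taut) _
      (pullSection ι (e k))).symm.trans ((adjSection_map_comp _ _ _ _).trans
        (congrArg _ (adjSection_eq p _ _).symm))
  have h2 (s : Γ(F, ι ⁻¹ᵁ U.1)) : β.hom.app ((r ≫ ι) ⁻¹ᵁ U.1)
      (((Scheme.Modules.pullback g).obj Y.O1).presheaf.map (eqToHom (by rw [← h'']; rfl)).op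
        (pullSection g (adjSection Y.taut (ι ⁻¹ᵁ U.1) s))) =
      adjSection (pullTaut Y.taut g h ≫ β.hom) (ι ⁻¹ᵁ U.1) s := by
    rw [adjSection_comp, adjSection_pullTaut]
    rfl
  refine (congrArg (fun m => β.hom.app ((r ≫ ι) ⁻¹ᵁ U.1)
      (((Scheme.Modules.pullback g).obj Y.O1).presheaf.map (eqToHom (by rw [← h'']; rfl)).op
        (pullSection g m))) h1).trans ((h2 _).trans ?_)
  by_cases hk : k ∈ J
  · refine (congrArg _ (ha.map_mem ⟨k, hk⟩)).trans ((H _).trans ?_)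
    exact congrArg (unitSec (r ⁻¹ᵁ ι ⁻¹ᵁ U.1)).symm (extendZero_mem z hk).symm
  · rw [ha.map_notMem k hk, adjSection_zero]
    refine Eq.trans ?_ (congrArg (unitSec (r ⁻¹ᵁ ι ⁻¹ᵁ U.1)).symm (extendZero_notMem z hk).symm)
    exact (map_zero _).symm

lemma Unimodular.restrict {I : Type*} {J : Finset I} {W : T.Opens} {x : I → Γ(T, W)} (hx : Unimodular x)
    (h : ∀ k ∉ J, x k = 0) : Unimodular (fun j : J => x j) := by
  intro s hs
  obtain ⟨k, hk⟩ := hx s hs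
  by_cases hkJ : k ∈ J
  · exact ⟨⟨k, hkJ⟩, hk⟩
  · rw [h k hkJ, Scheme.basicOpen_zero] at hk
    exact hk.elim

variable [IsClosedImmersion ι]

/-- A morphism to `P_S(E)` with coordinates `x` factors through `P_D(F)` if and only if `t` and the
coordinates outside `J` vanish. -/
lemma HasCoords.factors_iff (hi : IsInducedBy ι p X Y i) (ha : IsAdapted ι p U t J e f)
    {b : T ⟶ X.space} {q : T ⟶ S} (hq : q ⁻¹ᵁ U.1 = ⊤) {x : I → Γ(T, q ⁻¹ᵁ U.1)}
    (hx : HasCoords X e b q x) :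
    (∃ g, g ≫ i = b) ↔ q.app U t = 0 ∧ ∀ k ∉ J, x k = 0 := by
  classical
  constructor
  · rintro ⟨g, rfl⟩
    have hr : (g ≫ Y.π) ≫ ι = q := by
      rw [← hx.1, Category.assoc, Category.assoc, hi.1]
    refine ⟨(exists_factor_iff_of_span ι hq ha.ker).1 ⟨_, hr⟩, fun k hk => ?_⟩
    -- Coordinates of `g` exist only locally on `T`; there `x` is a unit times their extension by
    -- zero.
    refine function_eq_zero_of_ι_app _ fun s _ => ?_
    subst hr
    obtain ⟨V, hsV, hV⟩ := exists_hasCoords_nhds (P := Y) (g := g) rfl s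
    obtain ⟨z, hz⟩ := hV V le_rfl f
    have h1 := hz.comp_induced hi ha
    have h2 := hx.comp V.ι
    obtain ⟨u, -, hu⟩ := HasCoords.exists_isUnit (g := V.ι ≫ g ≫ i) (q := V.ι ≫ (g ≫ Y.π) ≫ ι) h1 h2
    refine ⟨V, hsV, (hu k).trans ((congrArg (u * ·) (extendZero_notMem z hk)).trans (mul_zero u))⟩
  -- Vanishing of `t` gives a morphism to `D`. The coordinates in `J` are still unimodular, hence
  -- define `g`, and extending them by zero recovers `x`.
  · rintro ⟨ht, hx0⟩
    obtain ⟨r, rfl⟩ := (exists_factor_iff_of_span ι hq ha.ker).2 ht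
    obtain ⟨g, hg, -⟩ := existsUnique_hasCoords (P := Y) ha.frame' (q := r) hq
      (x := fun j : J => x j) ((hx.unimodular ha.frame hq).restrict hx0)
    refine ⟨g, HasCoords.eq ha.frame hq (hg.comp_induced hi ha) ?_⟩
    convert hx using 1
    ext k
    by_cases h : k ∈ J
    · exact extendZero_mem _ h
    · exact (extendZero_notMem _ h).trans (hx0 k h).symm

/-- This is `HasCoords.factors_iff` after base change along `c`, in the form that
`ideal_comap_ker_eq` consumes. -/
lemma HasCoords.vanish_iff (hi : IsInducedBy ι p X Y i) (ha : IsAdapted ι p U t J e f)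
    {b : T ⟶ X.space} {q : T ⟶ S} (hq : q ⁻¹ᵁ U.1 = ⊤) {x : I → Γ(T, q ⁻¹ᵁ U.1)}
    (hx : HasCoords X e b q x) {T' : Scheme.{u}} (c : T' ⟶ T) :
    (∀ r ∈ Ideal.span (insert (q.app U t) (x '' {k | k ∉ J})), c.app (q ⁻¹ᵁ U.1) r = 0) ↔
      ∃ g, g ≫ i = c ≫ b := by
  have hq' : (c ≫ q) ⁻¹ᵁ U.1 = ⊤ := by
    change c ⁻¹ᵁ (q ⁻¹ᵁ U.1) = ⊤
    rw [hq]
    rfl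
  rw [(hx.comp c).factors_iff hi ha hq', comp_app_apply]
  have : (∀ r ∈ Ideal.span (insert (q.app U t) (x '' {k | k ∉ J})), c.app (q ⁻¹ᵁ U.1) r = 0) ↔
      Ideal.span (insert (q.app U t) (x '' {k | k ∉ J})) ≤ RingHom.ker (c.app (q ⁻¹ᵁ U.1)).hom :=
    Iff.rfl
  rw [this, Ideal.span_le, Set.insert_subset_iff, Set.image_subset_iff]
  rfl

/-- The ideal of the inverse image of `P_D(F)` in terms of coordinates. -/
lemma HasCoords.ideal_comap [IsAffine T] (hi : IsInducedBy ι p X Y i) [IsClosedImmersion i]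
    (ha : IsAdapted ι p U t J e f)
    {b : T ⟶ X.space} {q : T ⟶ S} (hq : q ⁻¹ᵁ U.1 = ⊤) (hqa : IsAffineOpen (q ⁻¹ᵁ U.1))
    {x : I → Γ(T, q ⁻¹ᵁ U.1)} (hx : HasCoords X e b q x) :
    (i.ker.comap b).ideal ⟨q ⁻¹ᵁ U.1, hqa⟩ =
      Ideal.span (insert (q.app U t) (x '' {k | k ∉ J})) :=
  ideal_comap_ker_eq i b hq hqa _ fun c => hx.vanish_iff hi ha hq c

lemma exists_isAffineOpen_le {T : Scheme.{u}} {x : T} {O : T.Opens} (hx : x ∈ O) :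
    ∃ V : T.Opens, IsAffineOpen V ∧ x ∈ V ∧ V ≤ O := by
  obtain ⟨_, ⟨V, hVa, rfl⟩, hxV, hle⟩ := (T.isBasis_affineOpens).exists_subset_of_mem_open hx O.2
  exact ⟨V, hVa, hxV, hle⟩

/-- Extension by zero is injective, so the coordinates of `g ≫ i`, up to a unit, determine those of
`g`. -/
lemma mono_of_isInducedBy (hi : IsInducedBy ι p X Y i)
    (hc : ∀ s : S, ∃ (U : S.affineOpens) (t : Γ(S, U)) (I : Type u) (_ : Fintype I) (J : Finset I)
      (e : I → Γ(E, U)) (f : J → Γ(F, ι ⁻¹ᵁ U.1)), s ∈ U.1 ∧ IsAdapted ι p U t J e f) :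
    Mono i := by
  refine ⟨fun {T} g g' h => Scheme.hom_ext_of_forall _ _ fun s => ?_⟩
  have hr : g ≫ Y.π = g' ≫ Y.π := by
    rw [← cancel_mono ι, Category.assoc, Category.assoc, ← hi.1, reassoc_of% h]
  obtain ⟨U, t, I, _, J, e, f, hs, ha⟩ := hc (ι (Y.π (g s)))
  obtain ⟨V, hsV, hV⟩ := exists_hasCoords_nhds (P := Y) (g := g) rfl s
  obtain ⟨V', hsV', hV'⟩ := exists_hasCoords_nhds (P := Y) (g := g') hr.symm s
  let W : T.Opens := V ⊓ V' ⊓ (g ≫ Y.π ≫ ι) ⁻¹ᵁ U.1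
  refine ⟨W, ⟨⟨hsV, hsV'⟩, hs⟩, ?_⟩
  obtain ⟨z, hz⟩ := hV W (inf_le_left.trans inf_le_left) f
  obtain ⟨z', hz'⟩ := hV' W (inf_le_left.trans inf_le_right) f
  have hW : (W.ι ≫ g ≫ Y.π) ⁻¹ᵁ ι ⁻¹ᵁ U.1 = ⊤ :=
    ι_comp_preimage (q := g ≫ Y.π ≫ ι) (inf_le_right : W ≤ _)
  have h1 := hz.comp_induced hi ha
  have h2 := hz'.comp_induced hi ha
  rw [Category.assoc, h, ← Category.assoc] at h1
  obtain ⟨u, hu, hzz⟩ := h1.exists_isUnit h2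
  refine HasCoords.eq ha.frame' hW (hz.smul hW hu) ?_
  convert hz' using 1
  ext j
  have := hzz j
  refine Eq.trans ?_ (this.symm.trans (extendZero_mem z' j.2))
  exact congrArg (u * ·) (extendZero_mem z j.2).symm

/-- On a small affine open the candidate is the closed subscheme cut out by `t` and the coordinates
outside `J`; `HasCoords.vanish_iff` supplies the maps in both directions. -/
lemma isClosedImmersion_of_isInducedBy (hi : IsInducedBy ι p X Y i)
    (hc : ∀ s : S, ∃ (U : S.affineOpens) (t : Γ(S, U)) (I : Type u) (_ : Fintype I) (J : Finset I)
      (e : I → Γ(E, U)) (f : J → Γ(F, ι ⁻¹ᵁ U.1)), s ∈ U.1 ∧ IsAdapted ι p U t J e f) :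
    IsClosedImmersion i := by
  have := mono_of_isInducedBy hi hc
  refine isClosedImmersion_of_locally i fun x => ?_
  obtain ⟨U, t, I, _, J, e, f, hs, ha⟩ := hc (X.π x)
  obtain ⟨V₀, hxV₀, hV₀⟩ := exists_hasCoords_nhds (P := X) (g := 𝟙 X.space) (Category.id_comp _) x
  obtain ⟨V, hVa, hxV, hle⟩ := exists_isAffineOpen_le
    (show x ∈ (V₀ ⊓ X.π ⁻¹ᵁ U.1 : X.space.Opens) from ⟨hxV₀, hs⟩)
  obtain ⟨x, hx⟩ := hV₀ V (hle.trans inf_le_left) e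
  rw [Category.comp_id] at hx
  have hq : (V.ι ≫ X.π) ⁻¹ᵁ U.1 = ⊤ := ι_comp_preimage (hle.trans inf_le_right)
  have : IsAffine V := hVa
  let A := Ideal.span (insert ((V.ι ≫ X.π).app U t) (x '' {k | k ∉ J}))
  obtain ⟨Z, c, hcl, hker, hlift⟩ := exists_closed_subscheme hq A
  have key {T : Scheme.{u}} (d : T ⟶ V.toScheme) := hx.vanish_iff hi ha hq d
  obtain ⟨s, hs⟩ := (key c).1 fun r hr => hker.ge hr
  obtain ⟨a, ha'⟩ := hlift (i ∣_ V) ((key (i ∣_ V)).2 ⟨(i ⁻¹ᵁ V).ι, (morphismRestrict_ι i V).symm⟩)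
  exact ⟨V, Z, c, s, a, hxV, hcl, hs, by rw [← Category.assoc, ha', morphismRestrict_ι]⟩

end Adapted
end Elementary

namespace Elementary
open Scheme.Modules hiding pullback pullbackComp
open Opposite TopologicalSpace

/-! ### Sections of kernels, division by a regular function, linear algebra -/

section Kernel
variable {X : Scheme.{u}} {M N : X.Modules}

/-- Sections over a fixed open, as a functor. -/
def sectionsFunctor (X : Scheme.{u}) (V : X.Opens) : X.Modules ⥤ Ab.{u} :=
  Scheme.Modules.toPresheaf X ⋙ (evaluation _ _).obj (op V)

instance (V : X.Opens) : PreservesLimits (sectionsFunctor X V) := by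
  have : PreservesLimits ((evaluation (Opens X)ᵒᵖ Ab.{u}).obj (op V)) := inferInstance
  exact comp_preservesLimits (Scheme.Modules.toPresheaf X)
    (show TopCat.Presheaf Ab.{u} X ⥤ Ab.{u} from (evaluation (Opens X)ᵒᵖ Ab.{u}).obj (op V))

instance (V : X.Opens) : (sectionsFunctor X V).PreservesZeroMorphisms where
  map_zero _ _ := rfl

lemma app_injective_of_mono (φ : M ⟶ N) [Mono φ] (V : X.Opens) : Function.Injective (φ.app V) :=
  (AddCommGrpCat.mono_iff_injective ((sectionsFunctor X V).map φ)).1 inferInstance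

lemma exists_app_kernel_ι_eq (φ : M ⟶ N) {V : X.Opens} (s : Γ(M, V)) (hs : φ.app V s = 0) :
    ∃ m : Γ(kernel φ, V), (kernel.ι φ).app V m = s := by
  have h := (ShortComplex.exact_kernel φ).map_of_mono_of_preservesKernel (sectionsFunctor X V)
    (by dsimp; infer_instance) inferInstance
  rw [ShortComplex.ab_exact_iff] at h
  exact h s hs

lemma mono_of_app_injective (φ : M ⟶ N) (h : ∀ V : X.Opens, Function.Injective (φ.app V)) :
    Mono φ := by
  refine Preadditive.mono_of_cancel_zero φ fun {K} α hα => ?_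
  ext V s
  exact h V (congr(($hα).app V s).trans (map_zero (φ.app V).hom).symm)

end Kernel

section Glue
variable {T : Scheme.{u}}

/-- The condition `P` is stable under restriction and determines its function, so local solutions
agree on overlaps. -/
lemma exists_glue {W : T.Opens} (P : ∀ V : T.Opens, Γ(T, V) → Prop)
    (hP : ∀ (V V' : T.Opens) (i : V ⟶ V') (b : Γ(T, V')), P V' b → P V (T.presheaf.map i.op b))
    (huniq : ∀ (V : T.Opens) (_ : V ≤ W) (b b' : Γ(T, V)), P V b → P V b' → b = b')
    (h : ∀ t ∈ W, ∃ (V : T.Opens) (_ : V ≤ W), t ∈ V ∧ ∃ b, P V b) :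
    ∃ b : Γ(T, W), ∀ t ∈ W, ∃ (V : T.Opens) (i : V ⟶ W), t ∈ V ∧ P V (T.presheaf.map i.op b) := by
  choose V hV htV b hb using fun t : W => h t.1 t.2
  obtain ⟨s, hs, -⟩ := TopCat.Sheaf.existsUnique_gluing' T.sheaf V W (fun t => homOfLE (hV t))
    (fun t ht => Opens.mem_iSup.2 ⟨⟨t, ht⟩, htV _⟩) b (fun t t' =>
      huniq _ (inf_le_left.trans (hV t)) _ _ (hP _ _ _ _ (hb t)) (hP _ _ _ _ (hb t')))
  refine ⟨s, fun t ht => ⟨V ⟨t, ht⟩, homOfLE (hV _), htV _, ?_⟩⟩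
  exact (hs ⟨t, ht⟩).symm ▸ hb _

/-- Divisibility by a regular function is a local condition. -/
lemma IsRegularFun.exists_eq_mul {W : T.Opens} {t : Γ(T, W)} (ht : IsRegularFun t) {a : Γ(T, W)}
    (h : ∀ s ∈ W, ∃ (V : T.Opens) (i : V ⟶ W), s ∈ V ∧
      T.presheaf.map i.op t ∣ T.presheaf.map i.op a) : ∃ b, a = t * b := by
  have hP (V V' : T.Opens) (i : V ⟶ V') (b : Γ(T, V')) (hb : ∃ j : V' ⟶ W, T.presheaf.map j.op a =
      T.presheaf.map j.op t * b) : ∃ j : V ⟶ W, T.presheaf.map j.op a =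
      T.presheaf.map j.op t * T.presheaf.map i.op b := by
    obtain ⟨j, hb⟩ := hb
    exact ⟨i ≫ j, by rw [← presheaf_map_map i j, ← presheaf_map_map i j, hb, map_mul]⟩
  obtain ⟨b, hb⟩ := exists_glue (W := W) (fun V b => ∃ i : V ⟶ W, T.presheaf.map i.op a =
      T.presheaf.map i.op t * b) hP
      (fun V hV b b' ⟨i, h⟩ ⟨j, h'⟩ => by
        rw [Subsingleton.elim j i] at h'
        exact (mul_cancel_left_mem_nonZeroDivisors (ht V i)).1 (h.symm.trans h'))
      (fun s hs => by
        obtain ⟨V, i, hsV, b, hb⟩ := h s hs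
        exact ⟨V, i.le, hsV, b, i, hb⟩)
  refine ⟨b, sub_eq_zero.1 (function_eq_zero_of_locally _ fun s hs => ?_)⟩
  obtain ⟨V, i, hsV, j, hi⟩ := hb s hs
  rw [Subsingleton.elim j i] at hi
  exact ⟨V, i, hsV, by rw [map_sub, map_mul]; exact sub_eq_zero.2 hi⟩

end Glue

section FrameChange
variable {X : Scheme.{u}} {I I' : Type*} [Fintype I] [Fintype I']

lemma IsFrame.of_matrix [DecidableEq I] [DecidableEq I'] {M : X.Modules} {U : X.Opens}
    {e : I → Γ(M, U)} (he : IsFrame M U e) (A : Matrix I' I Γ(X, U)) (B : Matrix I I' Γ(X, U))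
    (hAB : A * B = 1) (hBA : B * A = 1) {e' : I' → Γ(M, U)} (h : ∀ i, e' i = ∑ j, A i j • e j) :
    IsFrame M U e' := by
  intro V i
  let r := (X.presheaf.map i.op).hom
  have h1 : (fun c : I' → Γ(X, V) => ∑ k, c k • M.presheaf.map i.op (e' k)) =
      (fun c : I → Γ(X, V) => ∑ k, c k • M.presheaf.map i.op (e k)) ∘
        (fun c => Matrix.vecMul c (A.map r)) := by
    ext c
    simp only [Function.comp_apply, h, map_sum, Scheme.Modules.map_smul, Finset.smul_sum, smul_smul,
      Matrix.vecMul, dotProduct, Finset.sum_smul]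
    rw [Finset.sum_comm]
    rfl
  rw [h1]
  refine (he V i).comp (Function.bijective_iff_has_inverse.2
    ⟨fun c => Matrix.vecMul c (B.map r), fun c => ?_, fun c => ?_⟩)
  · simp only [Matrix.vecMul_vecMul]
    rw [← Matrix.map_mul, hAB, Matrix.map_one _ (map_zero r) (map_one r), Matrix.vecMul_one]
  · simp only [Matrix.vecMul_vecMul]
    rw [← Matrix.map_mul, hBA, Matrix.map_one _ (map_zero r) (map_one r), Matrix.vecMul_one]

end FrameChange
section LinAlg

/-- The columns are independent, so the rank is the number of columns. The row space has the same
dimension, and rows forming a basis of it give the minor. -/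
lemma exists_submatrix_det_ne_zero {K I R : Type*} [Field K] [Fintype I] [Fintype R]
    [DecidableEq R] (A : Matrix I R K) (hA : ∀ l, A.mulVec l = 0 → l = 0) :
    ∃ r : R → I, Function.Injective r ∧ (A.submatrix r id).det ≠ 0 := by
  have hli : LinearIndependent K A.col := Matrix.mulVec_injective_iff.1
    ((injective_iff_map_eq_zero A.mulVecLin).2 hA)
  have hrank : A.rank = Fintype.card R := by
    rw [Matrix.rank_eq_finrank_span_cols, finrank_span_eq_card hli]
  rw [← Matrix.rank_transpose] at hrank
  rw [Matrix.rank_eq_finrank_span_cols] at hrank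
  obtain ⟨f, hf, -, hlf⟩ := Submodule.exists_fun_fin_finrank_span_eq K (Set.range A.transpose.col)
  choose g hg using hf
  let ε : R ≃ Fin (Module.finrank K (Submodule.span K (Set.range A.transpose.col))) :=
    Fintype.equivFinOfCardEq hrank.symm
  have h1 : (A.submatrix (g ∘ ε) id).row = f ∘ ε := by
    ext i j
    exact congr_fun (hg (ε i)) j
  have h2 : LinearIndependent K (A.submatrix (g ∘ ε) id).row := by
    rw [h1]; exact hlf.comp _ ε.injective
  refine ⟨g ∘ ε, fun a b hab => ε.injective (hlf.injective ?_), ?_⟩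
  · rw [← hg, ← hg]; exact congrArg _ hab
  · rw [Matrix.linearIndependent_rows_iff_isUnit, Matrix.isUnit_iff_isUnit_det] at h2
    exact h2.ne_zero

end LinAlg
end Elementary

namespace Elementary
open Scheme.Modules hiding pullback pullbackComp
open Opposite TopologicalSpace

/-! ### Bases of the two kernels -/

section Charts
variable {S D : Scheme.{u}} {ι : D ⟶ S} {E : S.Modules} {F : D.Modules}
  {p : (Scheme.Modules.pullback ι).obj E ⟶ F} {I : Type u} [Fintype I]

/-- Frames adapted to both `p : E|_D ⟶ F` and `E'|_D ⟶ F'`, with a regular local equation of `D`. -/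
structure IsChart (ι : D ⟶ S) (p : (Scheme.Modules.pullback ι).obj E ⟶ F) (U : S.affineOpens)
    (t : Γ(S, U)) (J J' : Finset I) (e : I → Γ(E, U)) (e' : I → Γ(kernelOnBase ι p, U)) :
    Prop where
  compl : ∀ k, k ∈ J' ↔ k ∉ J
  regular : IsRegularFun t
  adapted : ∃ f, IsAdapted ι p U t J e f
  adapted' : ∃ f', IsAdapted ι (kernelRestriction ι p) U t J' e' f'
  map_mem : ∀ k ∈ J, (kernelOnBaseι ι p).app U (e' k) = t • e k
  map_notMem : ∀ k ∉ J, (kernelOnBaseι ι p).app U (e' k) = e k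

/-- The inclusion `F' ⟶ E|_D`. -/
def kernelOnDivisorι (ι : D ⟶ S) (p : (Scheme.Modules.pullback ι).obj E ⟶ F) :
    kernelOnDivisor ι p ⟶ (Scheme.Modules.pullback ι).obj E := kernel.ι p

instance : Mono (kernelOnDivisorι ι p) := inferInstanceAs (Mono (kernel.ι p))

instance : Mono (kernelOnBaseι ι p) := inferInstanceAs (Mono (kernel.ι _))

lemma exists_kernelOnDivisorι_app {V : D.Opens} (s : Γ((Scheme.Modules.pullback ι).obj E, V))
    (hs : p.app V s = 0) : ∃ m, (kernelOnDivisorι ι p).app V m = s :=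
  exists_app_kernel_ι_eq p s hs

lemma exists_kernelOnBaseι_app {V : S.Opens} (s : Γ(E, V)) (hs : adjSection p V s = 0) :
    ∃ m, (kernelOnBaseι ι p).app V m = s :=
  exists_app_kernel_ι_eq (toPushforward ι p) s hs

lemma kernelRestriction_comp : kernelRestriction ι p ≫ kernelOnDivisorι ι p =
    (Scheme.Modules.pullback ι).map (kernelOnBaseι ι p) := kernel.lift_ι _ _ _

lemma adjSection_sum {X Y : Scheme.{u}} {f : X ⟶ Y} {M : Y.Modules} {N : X.Modules}
    (φ : (Scheme.Modules.pullback f).obj M ⟶ N) (U : Y.Opens) {K : Type*} (s : Finset K)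
    (m : K → Γ(M, U)) :
    adjSection φ U (∑ k ∈ s, m k) = ∑ k ∈ s, adjSection φ U (m k) :=
  map_sum (((pullbackPushforwardAdjunction f).homEquiv M N φ).app U).hom m s

lemma adjSection_smul {X Y : Scheme.{u}} {f : X ⟶ Y} {M : Y.Modules} {N : X.Modules}
    (φ : (Scheme.Modules.pullback f).obj M ⟶ N) (U : Y.Opens) (r : Γ(Y, U)) (s : Γ(M, U)) :
    adjSection φ U (r • s) = f.app U r • adjSection φ U s := by
  rw [adjSection_eq, pullSection_smul, Hom.app_smul, adjSection_eq]

lemma adjSection_map {X Y : Scheme.{u}} {f : X ⟶ Y} {M : Y.Modules} {N : X.Modules}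
    (φ : (Scheme.Modules.pullback f).obj M ⟶ N) {U V : Y.Opens} (i : V ⟶ U) (s : Γ(M, U)) :
    adjSection φ V (M.presheaf.map i.op s) =
      N.presheaf.map ((Opens.map f.base).map i).op (adjSection φ U s) := by
  rw [adjSection_eq, pullSection_map, hom_app_map, adjSection_eq]

/-- On affine opens a function vanishing on `D` lies in the ideal generated by `t`; the quotients
glue because `t` is regular. -/
lemma IsAdapted.dvd {U : S.affineOpens} {t : Γ(S, U)} {J : Finset I} {e : I → Γ(E, U)}
    {f : J → Γ(F, ι ⁻¹ᵁ U.1)} [QuasiCompact ι] (ha : IsAdapted ι p U t J e f) (ht : IsRegularFun t)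
    {V : S.Opens} (i : V ⟶ U.1) {a : Γ(S, V)} (h : ι.app V a = 0) :
    ∃ b, a = S.presheaf.map i.op t * b := by
  refine (ht.map i).exists_eq_mul fun s hs => ?_
  obtain ⟨V', hV', hsV', hle⟩ := exists_isAffineOpen_le hs
  refine ⟨V', homOfLE hle, hsV', ?_⟩
  have h1 : S.presheaf.map (homOfLE hle).op a ∈ ι.ker.ideal ⟨V', hV'⟩ := by
    rw [Scheme.Hom.ker_apply]
    change ι.app V' (S.presheaf.map (homOfLE hle).op a) = 0
    rw [app_map_apply, h, map_zero]
  rw [← ι.ker.map_ideal (U := ⟨V', hV'⟩) (V := U) (hle.trans i.le), ha.ker, Ideal.map_span,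
    Set.image_singleton, Ideal.mem_span_singleton] at h1
  rwa [presheaf_map_map (homOfLE hle) i (homOfLE hle ≫ i)]

/-- The sum of a family supported in `J`. -/
lemma sum_eq_sum_of_notMem {A : Type*} [AddCommMonoid A] (J : Finset I) (g : I → A)
    (hg : ∀ k ∉ J, g k = 0) : ∑ k, g k = ∑ j : J, g j := by
  rw [Finset.sum_coe_sort]
  exact (Finset.sum_subset (Finset.subset_univ J) fun k _ hk => hg k hk).symm

lemma IsAdapted.sum_eq {U : S.affineOpens} {t : Γ(S, U)} {J : Finset I} {e : I → Γ(E, U)}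
    {f : J → Γ(F, ι ⁻¹ᵁ U.1)} (ha : IsAdapted ι p U t J e f) {V : D.Opens} (i : V ⟶ ι ⁻¹ᵁ U.1)
    (a : I → Γ(D, V)) :
    p.app V (∑ k, a k • ((Scheme.Modules.pullback ι).obj E).presheaf.map i.op
      (pullSection ι (e k))) = ∑ j : J, a j • F.presheaf.map i.op (f j) := by
  simp only [map_sum, Hom.app_smul, hom_app_map, ← adjSection_eq]
  rw [sum_eq_sum_of_notMem J _ fun k hk => by rw [ha.map_notMem k hk, map_zero, smul_zero]]
  simp only [ha.map_mem]

variable {U : S.affineOpens} {t : Γ(S, U)} {J J' : Finset I} {e : I → Γ(E, U)}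
    {f : J → Γ(F, ι ⁻¹ᵁ U.1)}

/-- In the pulled-back frame `p` is the projection to the coordinates in `J`, so its kernel is
spanned by the remaining basis vectors. -/
lemma IsAdapted.isFrame_kernelOnDivisor (ha : IsAdapted ι p U t J e f)
    (hJ : ∀ k, k ∈ J' ↔ k ∉ J) {f' : J' → Γ(kernelOnDivisor ι p, ι ⁻¹ᵁ U.1)}
    (hf' : ∀ k, (kernelOnDivisorι ι p).app _ (f' k) = pullSection ι (e k)) :
    IsFrame (kernelOnDivisor ι p) (ι ⁻¹ᵁ U.1) f' := by
  intro V i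
  have he := ha.frame.pullback ι
  have hsum (a : I → Γ(D, V)) (h0 : ∀ k ∈ J, a k = 0) :
      (kernelOnDivisorι ι p).app V (∑ k : J', a k • (kernelOnDivisor ι p).presheaf.map i.op (f' k)) =
      ∑ k, a k • ((Scheme.Modules.pullback ι).obj E).presheaf.map i.op (pullSection ι (e k)) := by
    rw [sum_eq_sum_of_notMem J' _ fun k hk => by
      rw [h0 k (by by_contra h; exact hk ((hJ k).2 h)), zero_smul], map_sum]
    refine Finset.sum_congr rfl fun k _ => ?_
    exact (Hom.app_smul _ _ _).trans (congrArg _ ((hom_app_map _ _ _).trans (congrArg _ (hf' k))))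
  have hext (c : J' → Γ(D, V)) : ∀ k ∈ J, extendZero J' c k = 0 := fun k hk =>
    extendZero_notMem _ (fun h => (hJ k).1 h hk)
  have hext' (c : J' → Γ(D, V)) (k : J') : extendZero J' c k = c k := extendZero_mem _ k.2
  constructor
  · intro c d hcd
    have h1 := hsum _ (hext c)
    have h2 := hsum _ (hext d)
    simp only [hext'] at h1 h2
    have h3 := (he V i).1 (h1.symm.trans ((congrArg _ hcd).trans h2))
    ext k
    rw [← hext' c, h3, hext']
  · intro s
    obtain ⟨a, h⟩ := (he V i).2 ((kernelOnDivisorι ι p).app V s)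
    have h0 : p.app V ((kernelOnDivisorι ι p).app V s) = 0 := congr(($(kernel.condition p)).app V s)
    rw [← h] at h0
    have h1 : (fun j : J => a j) = 0 := (ha.frame' V i).1 (by
      simpa using (ha.sum_eq i a).symm.trans h0)
    refine ⟨fun k => a k, app_injective_of_mono (kernelOnDivisorι ι p) V ?_⟩
    exact (hsum a fun k hk => congr_fun h1 ⟨k, hk⟩).trans h

variable [QuasiCompact ι]

-- A section of `E` lies in `E'` exactly when its coordinates in `J` vanish on `D`, that is, are
-- divisible by `t`; regularity of `t` makes the quotients unique.
open Classical in
lemma IsAdapted.isFrame_kernelOnBase (ha : IsAdapted ι p U t J e f) (ht : IsRegularFun t)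
    {e' : I → Γ(kernelOnBase ι p, U)}
    (h' : ∀ k, (kernelOnBaseι ι p).app U (e' k) = (if k ∈ J then t else 1) • e k) :
    IsFrame (kernelOnBase ι p) U.1 e' := by
  intro V i
  have hinj := app_injective_of_mono (kernelOnBaseι ι p) V
  have hsum (a : I → Γ(S, V)) :
      (kernelOnBaseι ι p).app V (∑ k, a k • (kernelOnBase ι p).presheaf.map i.op (e' k)) =
      ∑ k, (a k * if k ∈ J then S.presheaf.map i.op t else 1) • E.presheaf.map i.op (e k) := by
    rw [map_sum]
    refine Finset.sum_congr rfl fun k _ => ?_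
    rw [Hom.app_smul, hom_app_map, h', Scheme.Modules.map_smul, smul_smul]
    split_ifs <;> simp
  constructor
  · intro c d hcd
    have h3 := (ha.frame V i).1 ((hsum c).symm.trans ((congrArg _ hcd).trans (hsum d)))
    ext k
    have h4 := congr_fun h3 k
    simp only at h4
    split_ifs at h4
    · exact (mul_cancel_right_mem_nonZeroDivisors (ht V i)).1 h4
    · simpa using h4
  · intro s
    obtain ⟨a, h⟩ := (ha.frame V i).2 ((kernelOnBaseι ι p).app V s)
    have h0 : adjSection p V ((kernelOnBaseι ι p).app V s) = 0 :=
      congr(($(kernel.condition (toPushforward ι p))).app V s)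
    have h1 : (fun j : J => ι.app V (a j)) = 0 := by
      refine (ha.frame' (ι ⁻¹ᵁ V) ((Opens.map ι.base).map i)).1 ?_
      have h2 := ha.sum_eq ((Opens.map ι.base).map i) (fun k => ι.app V (a k))
      refine (h2.symm.trans ?_).trans (b := 0) (by simp)
      rw [← h, adjSection_sum] at h0
      rw [map_sum, ← h0]
      refine Finset.sum_congr rfl fun k _ => ?_
      rw [adjSection_smul, Hom.app_smul, adjSection_map, hom_app_map, adjSection_eq]
    have hdvd (k : I) : ∃ b, a k = b * if k ∈ J then S.presheaf.map i.op t else 1 := by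
      split_ifs with hk
      · obtain ⟨b, hb⟩ := ha.dvd ht i (congr_fun h1 ⟨k, hk⟩)
        exact ⟨b, by rw [hb, mul_comm]⟩
      · exact ⟨a k, by rw [mul_one]⟩
    choose b hb using hdvd
    refine ⟨b, hinj ((hsum b).trans (Eq.trans ?_ h))⟩
    simp only [← hb]

lemma IsAdapted.ι_app_eq_zero (ha : IsAdapted ι p U t J e f) : ι.app U t = 0 := by
  have : t ∈ ι.ker.ideal U := by rw [ha.ker]; exact Ideal.mem_span_singleton_self t
  rwa [Scheme.Hom.ker_apply] at this

/-- For `k` in `J`, the vector `e' k` restricts to `t e_k = 0` on `D`; for the other `k` it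
restricts to a basis vector of `F'`. So the complement of `J` is the index set for `E'|_D ⟶ F'`.
Values in `F'` are compared inside `E|_D`. -/
lemma IsAdapted.exists_isChart (ha : IsAdapted ι p U t J e f) (ht : IsRegularFun t) :
    ∃ J' e', IsChart ι p U t J J' e e' := by
  classical
  have hJ : ∀ k, k ∈ Jᶜ ↔ k ∉ J := fun k => Finset.mem_compl
  have h0 (k) : adjSection p U.1 ((if k ∈ J then t else 1) • e k) = 0 := by
    split_ifs with hk
    · rw [adjSection_smul, ha.ι_app_eq_zero, zero_smul]
    · rw [one_smul, ha.map_notMem k hk]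
  choose e' he' using fun k => exists_kernelOnBaseι_app _ (h0 k)
  choose f' hf' using fun k : (Jᶜ : Finset I) => exists_kernelOnDivisorι_app (p := p) (pullSection ι (e k))
    (by rw [← adjSection_eq, ha.map_notMem _ ((hJ _).1 k.2)])
  have key (k : I) : (kernelOnDivisorι ι p).app _ (adjSection (kernelRestriction ι p) U.1 (e' k)) =
      pullSection ι ((if k ∈ J then t else 1) • e k) := by
    rw [← adjSection_comp]
    rw [kernelRestriction_comp, adjSection_eq, pullback_map_pullSection]
    rw [he']
  have hinj := app_injective_of_mono (kernelOnDivisorι ι p) (ι ⁻¹ᵁ U.1)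
  refine ⟨Jᶜ, e', hJ, ht, ⟨f, ha⟩, ⟨f', ha.isFrame_kernelOnBase ht he',
    ha.isFrame_kernelOnDivisor hJ hf', fun k => hinj ?_, fun k hk => hinj ?_, ha.ker⟩,
    fun k hk => (he' k).trans (by rw [if_pos hk]),
    fun k hk => (he' k).trans (by rw [if_neg hk, one_smul])⟩
  · rw [key, if_neg ((hJ _).1 k.2), one_smul, hf']
  · rw [key, if_pos (by by_contra h; exact hk ((hJ k).2 h)), pullSection_smul, ha.ι_app_eq_zero,
      zero_smul]
    exact (map_zero _).symm

end Charts
end Elementary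

namespace Elementary
open Scheme.Modules hiding pullback pullbackComp
open Opposite TopologicalSpace

/-! ### Existence of adapted frames -/

section ExistsAdapted
variable {S D : Scheme.{u}} {ι : D ⟶ S} [IsClosedImmersion ι] {E : S.Modules} {F : D.Modules}
  {p : (Scheme.Modules.pullback ι).obj E ⟶ F}

lemma isFrame_of_eq_bot {X : Scheme.{u}} {M : X.Modules} {U : X.Opens} (hU : U = ⊥) {I : Type*}
    [Fintype I] (e : I → Γ(M, U)) : IsFrame M U e := by
  intro V i
  have hV (x : X) (hx : x ∈ V) : False := by
    have := i.le hx
    rw [hU] at this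
    exact this
  constructor
  · intro c d _
    ext k
    exact sub_eq_zero.1 (function_eq_zero_of_locally _ fun x hx => (hV x hx).elim)
  · intro s
    exact ⟨0, sub_eq_zero.1 (section_eq_zero_of_locally _ fun x hx => (hV x hx).elim)⟩

lemma exists_isAdapted_of_notMem_range (hE : IsVectorBundle E) {s : S} (hs : s ∉ Set.range ι) :
    ∃ (U : S.affineOpens) (t : Γ(S, U)) (I : Type u) (_ : Fintype I) (J : Finset I)
      (e : I → Γ(E, U)) (f : J → Γ(F, ι ⁻¹ᵁ U.1)), s ∈ U.1 ∧ IsRegularFun t ∧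
        IsAdapted ι p U t J e f := by
  obtain ⟨U₁, n, e, hsU, he⟩ := exists_frame hE s
  let O : S.Opens := ⟨(Set.range ι)ᶜ, ι.isClosedEmbedding.isClosed_range.isOpen_compl⟩
  obtain ⟨U, hU, hsU', hle⟩ := exists_isAffineOpen_le (show s ∈ U₁ ⊓ O from ⟨hsU, hs⟩)
  have hbot : ι ⁻¹ᵁ U = ⊥ := by
    ext d
    simp only [Opens.coe_bot, Set.mem_empty_iff_false, iff_false]
    exact fun hd => (hle hd).2 ⟨d, rfl⟩
  have hbot' (d : D) (hd : d ∈ ι ⁻¹ᵁ U) : False := by rw [hbot] at hd; exact hd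
  -- `D` is empty over `U`: its equation is `1`, `J` is empty, and the zero in the frame of `F` is a
  -- family over the empty index set.
  refine ⟨⟨U, hU⟩, 1, ULift (Fin n), inferInstance, ∅,
    fun k => E.presheaf.map (homOfLE (hle.trans inf_le_left)).op (e k), fun _ => 0, hsU', ?_,
    he.restrict _, isFrame_of_eq_bot hbot _, ?_, ?_, ?_⟩
  · intro W i
    rw [map_one]
    exact one_mem _
  · exact fun j => sub_eq_zero.1 (section_eq_zero_of_locally _ fun x hx => (hbot' x hx).elim)
  · exact fun k _ => section_eq_zero_of_locally _ fun x hx => (hbot' x hx).elim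
  · rw [Ideal.span_singleton_one, Ideal.eq_top_iff_one, Scheme.Hom.ker_apply]
    exact function_eq_zero_of_locally _ fun x hx => (hbot' x hx).elim

lemma adjSection_sub {X Y : Scheme.{u}} {f : X ⟶ Y} {M : Y.Modules} {N : X.Modules}
    (φ : (Scheme.Modules.pullback f).obj M ⟶ N) (U : Y.Opens) (s s' : Γ(M, U)) :
    adjSection φ U (s - s') = adjSection φ U s - adjSection φ U s' :=
  map_sub (((pullbackPushforwardAdjunction f).homEquiv M N φ).app U).hom s s'

lemma isField_fromSpecResidueField {T : Scheme.{u}} {W : T.Opens} {t : T} (ht : t ∈ W) :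
    IsField Γ(Spec (T.residueField t), T.fromSpecResidueField t ⁻¹ᵁ W) := by
  rw [fromSpecResidueField_preimage ht]
  exact (Scheme.ΓSpecIso (T.residueField t)).commRingCatIsoToRingEquiv.toMulEquiv.isField
    (Field.toIsField (T.residueField t))

/-- Near a point, the matrix of an epimorphism between modules with frames has an invertible maximal
minor. -/
lemma exists_minor {T : Scheme.{u}} {I R : Type*} [Fintype I] [Fintype R] [DecidableEq R]
    {N F : T.Modules} {W : T.Opens}
    {n : I → Γ(N, W)} (hn : IsFrame N W n) {f : R → Γ(F, W)} (hf : IsFrame F W f)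
    (p : N ⟶ F) [Epi p] (A : Matrix I R Γ(T, W)) (hA : ∀ i, p.app W (n i) = ∑ j, A i j • f j)
    {t : T} (ht : t ∈ W) :
    ∃ r : R → I, Function.Injective r ∧ t ∈ T.basicOpen (A.submatrix r id).det := by
  let c := T.fromSpecResidueField t
  let _ := (isField_fromSpecResidueField ht).toField
  obtain ⟨r, hr, hdet⟩ := exists_submatrix_det_ne_zero (A.map (c.app W).hom) fun l hl =>
    eq_zero_of_epi hn hf p A hA c (fromSpecResidueField_preimage ht) l fun i => congr_fun hl i
  refine ⟨r, hr, ?_⟩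
  by_contra h
  refine hdet ?_
  have := app_fromSpecResidueField_eq_zero _ h
  have h2 := RingHom.map_det (c.app W).hom (A.submatrix r id)
  exact h2.symm.trans this

lemma isFrame_of_minor {X : Scheme.{u}} {M : X.Modules} {U : X.Opens} {R : Type*} [Fintype R]
    [DecidableEq R] {f : R → Γ(M, U)} (hf : IsFrame M U f) {I : Type*} {g : I → Γ(M, U)}
    (A : Matrix I R Γ(X, U)) (hA : ∀ i, g i = ∑ j, A i j • f j) (r : R → I)
    (hr : Function.Injective r) (hdet : IsUnit (A.submatrix r id).det) (J : Finset I)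
    (hJ : ∀ k, k ∈ J ↔ k ∈ Set.range r) :
    IsFrame M U (fun j : J => g j) := by
  classical
  let ε : R ≃ J := (Equiv.ofInjective r hr).trans (Equiv.subtypeEquivRight fun k => (hJ k).symm)
  have hε (k : R) : (ε k : I) = r k := rfl
  have hr' (j : J) : r (ε.symm j) = j := by rw [← hε, ε.apply_symm_apply]
  let B := A.submatrix r id
  have h1 : B * B⁻¹ = 1 := Matrix.mul_nonsing_inv _ hdet
  have h2 : B⁻¹ * B = 1 := Matrix.nonsing_inv_mul _ hdet
  refine hf.of_matrix (B.submatrix ε.symm id) (B⁻¹.submatrix id ε.symm) ?_ ?_ fun j => ?_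
  · rw [← Matrix.submatrix_mul _ _ _ _ _ Function.bijective_id, h1, Matrix.submatrix_one_equiv]
  · rw [Matrix.submatrix_mul_equiv, h2, Matrix.submatrix_one _ Function.injective_id]
  · rw [hA]
    simp [B, hr']

/-- The nonzero entries of `C` have row outside `J` and column in `J`, so `C * C = 0` and `1 + C`
inverts `1 - C`. -/
lemma IsFrame.sub_of_notMem {X : Scheme.{u}} {M : X.Modules} {U : X.Opens} {I : Type*} [Fintype I]
    {e : I → Γ(M, U)} (he : IsFrame M U e) (J : Finset I) (C : Matrix I I Γ(X, U))
    (hC : ∀ k j, k ∈ J ∨ j ∉ J → C k j = 0) : IsFrame M U (fun k => e k - ∑ j, C k j • e j) := by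
  classical
  have hCC : C * C = 0 := by
    ext i j
    rw [Matrix.mul_apply]
    refine Finset.sum_eq_zero fun k _ => ?_
    by_cases hk : k ∈ J
    · rw [hC k j (.inl hk), mul_zero]
    · rw [hC i k (.inr hk), zero_mul]
  refine he.of_matrix (1 - C) (1 + C) ?_ ?_ fun i => ?_
  · rw [sub_mul, mul_add, mul_add, hCC]; simp
  · rw [add_mul, mul_sub, mul_sub, hCC]; simp
  · simp [sub_smul, Finset.sum_sub_distrib, Matrix.one_apply]

/-- A maximal minor of the matrix of `p` is invertible near `d`. Its rows form `J`, and the images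
of these `e j` are a frame of `F`. Subtracting suitable combinations of them from the other `e k`
moves those into the kernel of `p`. -/
lemma exists_isAdapted_of_mem_range [Epi p] (hD : IsCartierDivisor ι.ker) (hE : IsVectorBundle E)
    (hF : IsVectorBundle F) (d : D) :
    ∃ (U : S.affineOpens) (t : Γ(S, U)) (I : Type u) (_ : Fintype I) (J : Finset I)
      (e : I → Γ(E, U)) (f : J → Γ(F, ι ⁻¹ᵁ U.1)), ι d ∈ U.1 ∧ IsRegularFun t ∧
        IsAdapted ι p U t J e f := by
  classical
  obtain ⟨U₁, n, e₁, hU₁, he₁⟩ := exists_frame hE (ι d)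
  obtain ⟨W, m, f₁, hdW, hf₁⟩ := exists_frame hF d
  obtain ⟨U₂, hU₂, t₂, ht₂, hker⟩ := hD (ι d)
  obtain ⟨O, hO⟩ : ∃ O : S.Opens, ι ⁻¹ᵁ O = W := by
    obtain ⟨O, hO, h⟩ := ι.isClosedEmbedding.isInducing.isOpen_iff.1 W.2
    exact ⟨⟨O, hO⟩, Opens.ext h⟩
  obtain ⟨U₃, hU₃, hsU₃, hle⟩ := exists_isAffineOpen_le (show ι d ∈ U₁ ⊓ O ⊓ U₂.1 from
    ⟨⟨hU₁, by rw [← hO] at hdW; exact hdW⟩, hU₂⟩)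
  let i₃ : U₃ ⟶ U₁ := homOfLE (hle.trans (inf_le_left.trans inf_le_left))
  let j₃ : ι ⁻¹ᵁ U₃ ⟶ W := homOfLE (fun z hz => hO ▸ (hle hz).1.2)
  have he₃ := he₁.restrict i₃
  have hf₃ := hf₁.restrict j₃
  set e₃ := fun k => E.presheaf.map i₃.op (e₁ k)
  set f₃ := fun k => F.presheaf.map j₃.op (f₁ k)
  let A : Matrix (ULift (Fin n)) (ULift (Fin m)) Γ(D, ι ⁻¹ᵁ U₃) :=
    fun i => hf₃.repr (adjSection p U₃ (e₃ i))
  have hA (i) : adjSection p U₃ (e₃ i) = ∑ j, A i j • f₃ j := (hf₃.sum_repr _).symm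
  obtain ⟨r, hr, hdet⟩ := exists_minor (he₃.pullback ι) hf₃ p A
    (fun i => by rw [← adjSection_eq, hA]) (t := d) hsU₃
  -- The minor is a function on `D`; lifting it to `S` gives an affine neighbourhood of `ι d` over
  -- which the minor is invertible.
  obtain ⟨δ, hδ⟩ := ι.app_surjective U₃ hU₃ (A.submatrix r id).det
  let U : S.affineOpens := ⟨S.basicOpen δ, hU₃.basicOpen δ⟩
  have hdU : ι d ∈ U.1 := by
    change d ∈ ι ⁻¹ᵁ S.basicOpen δ
    rw [Scheme.preimage_basicOpen, hδ]
    exact hdet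
  let i : U.1 ⟶ U₃ := homOfLE (S.basicOpen_le δ)
  let i' : ι ⁻¹ᵁ U.1 ⟶ ι ⁻¹ᵁ U₃ := (Opens.map ι.base).map i
  have he := he₃.restrict i
  have hf := hf₃.restrict i'
  set e₀ := fun k => E.presheaf.map i.op (e₃ k)
  set f₀ := fun k => F.presheaf.map i'.op (f₃ k)
  let B : Matrix (ULift (Fin n)) (ULift (Fin m)) Γ(D, ι ⁻¹ᵁ U.1) := A.map (D.presheaf.map i'.op).hom
  have hB (k) : adjSection p U.1 (e₀ k) = ∑ j, B k j • f₀ j := by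
    rw [adjSection_map, hA, map_sum]
    simp only [Scheme.Modules.map_smul]
    rfl
  have hdetB : IsUnit (B.submatrix r id).det := by
    have h1 : (B.submatrix r id).det = D.presheaf.map i'.op (A.submatrix r id).det :=
      (RingHom.map_det (D.presheaf.map i'.op).hom (A.submatrix r id)).symm
    rw [h1, ← hδ]
    have h2 := D.toRingedSpace.isUnit_res_basicOpen (ι.app U₃ δ)
    have h3 := app_map_apply ι i δ
    rw [← h3]
    exact (S.toRingedSpace.isUnit_res_basicOpen δ).map (ι.app U.1).hom
  let J : Finset (ULift (Fin n)) := Finset.univ.image r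
  have hframe := isFrame_of_minor hf B hB r hr hdetB J (fun k => by simp [J])
  -- The coordinates of `p (e k)` in the frame indexed by `J` are functions on `D`; lifts of them to
  -- `S` are the coefficients to subtract.
  choose C₀ hC₀ using fun (k : ULift (Fin n)) (j : J) =>
    ι.app_surjective U.1 U.2 (hframe.repr (adjSection p U.1 (e₀ k)) j)
  let C : Matrix (ULift (Fin n)) (ULift (Fin n)) Γ(S, U) := fun k j =>
    if k ∈ J then 0 else extendZero J (C₀ k) j
  have hCmem (k) (hk : k ∈ J) (j) : C k j = 0 := if_pos hk
  have hC : ∀ k j, k ∈ J ∨ j ∉ J → C k j = 0 := by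
    rintro k j h
    by_cases hk : k ∈ J
    · exact hCmem k hk j
    · exact (if_neg hk).trans (extendZero_notMem _ (h.resolve_left hk))
  have hle₂ : U.1 ≤ U₂ := i.le.trans (hle.trans inf_le_right)
  refine ⟨U, S.presheaf.map (homOfLE hle₂).op t₂, _, inferInstance, J,
    fun k => e₀ k - ∑ j, C k j • e₀ j, fun j => adjSection p U.1 (e₀ j), hdU,
    (isRegularFun_of_isAffineOpen U₂.2 ht₂).map _, he.sub_of_notMem J C hC, hframe, ?_, ?_, ?_⟩
  · intro j
    simp [hCmem j j.2]
  · intro k hk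
    rw [adjSection_sub, adjSection_sum]
    simp only [adjSection_smul]
    rw [sub_eq_zero, sum_eq_sum_of_notMem J _ fun j hj => by rw [hC k j (.inr hj), map_zero, zero_smul]]
    refine (hframe.sum_repr _).symm.trans (Finset.sum_congr rfl fun j _ => ?_)
    rw [show C k j = C₀ k j from (if_neg hk).trans (extendZero_mem _ j.2), hC₀]
  · rw [← ι.ker.map_ideal (U := U) (V := U₂) hle₂, hker, Ideal.map_span, Set.image_singleton]
    rfl

/-- Charts exist near each point. -/
lemma exists_isChart [Epi p] (hD : IsCartierDivisor ι.ker) (hE : IsVectorBundle E)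
    (hF : IsVectorBundle F) (s : S) :
    ∃ (U : S.affineOpens) (t : Γ(S, U)) (I : Type u) (_ : Fintype I) (J J' : Finset I)
      (e : I → Γ(E, U)) (e' : I → Γ(kernelOnBase ι p, U)), s ∈ U.1 ∧
        IsChart ι p U t J J' e e' := by
  obtain ⟨U, t, I, _, J, e, f, hs, ht, ha⟩ : ∃ (U : S.affineOpens) (t : Γ(S, U)) (I : Type u)
      (_ : Fintype I) (J : Finset I) (e : I → Γ(E, U)) (f : J → Γ(F, ι ⁻¹ᵁ U.1)), s ∈ U.1 ∧
        IsRegularFun t ∧ IsAdapted ι p U t J e f := by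
    by_cases hs : s ∈ Set.range ι
    · obtain ⟨d, rfl⟩ := hs
      exact exists_isAdapted_of_mem_range hD hE hF d
    · exact exists_isAdapted_of_notMem_range hE hs
  obtain ⟨J', e', h⟩ := ha.exists_isChart ht
  exact ⟨U, t, I, inferInstance, J, J', e, e', hs, h⟩

end ExistsAdapted
end Elementary

namespace Elementary
open Scheme.Modules hiding pullback pullbackComp
open Opposite TopologicalSpace

/-! ### Regularity of the equation of `D` on projective bundles and blowups -/

section Regular
variable {S T X : Scheme.{u}}

/-- The morphism `q` pulls back regular functions to regular functions. -/
def PreservesRegular (q : T ⟶ S) : Prop :=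
  ∀ (U : S.Opens) (t : Γ(S, U)), IsRegularFun t → IsRegularFun (q.app U t)

lemma PreservesRegular.of_flat (q : T ⟶ S) [Flat q] : PreservesRegular q := by
  intro U t ht
  refine isRegularFun_of_locally fun x hx => ?_
  obtain ⟨U', hU', hxU', hle⟩ := exists_isAffineOpen_le (show q x ∈ U from hx)
  obtain ⟨V, hV, hxV, hle'⟩ := exists_isAffineOpen_le (show x ∈ q ⁻¹ᵁ U' from hxU')
  have hVU : V ≤ q ⁻¹ᵁ U := fun z hz => hle (hle' hz)
  refine ⟨V, homOfLE hVU, hxV, isRegularFun_of_isAffineOpen hV ?_⟩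
  have h1 := Flat.flat_appLE q hU' hV hle'
  have h2 := ht U' (homOfLE hle)
  algebraize [(q.appLE U' V hle').hom]
  have h3 := Module.Flat.isSMulRegular_of_nonZeroDivisors (M := Γ(T, V)) h2
  have h4 : T.presheaf.map (homOfLE hVU).op (q.app U t) =
      q.appLE U' V hle' (S.presheaf.map (homOfLE hle).op t) := by
    rw [Scheme.Hom.appLE, ConcreteCategory.comp_apply, app_map_apply]
    exact (presheaf_map_map _ _ _ _).symm
  rw [h4, mem_nonZeroDivisors_iff]
  have h5 (b : Γ(T, V)) (hb : q.appLE U' V hle' (S.presheaf.map (homOfLE hle).op t) * b = 0) :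
      b = 0 := h3 (show _ • b = _ • 0 by rw [smul_zero]; exact hb)
  exact ⟨h5, fun b hb => h5 b (by rwa [mul_comm])⟩

lemma PreservesRegular.comp {q : T ⟶ X} {r : X ⟶ S} (hq : PreservesRegular q)
    (hr : PreservesRegular r) : PreservesRegular (q ≫ r) :=
  fun U t ht => by
    have := hq _ _ (hr U t ht)
    rwa [← comp_app_apply] at this

lemma PreservesRegular.ι_comp {q : T ⟶ S} (hq : PreservesRegular q) (V : T.Opens) :
    PreservesRegular (V.ι ≫ q) :=
  (PreservesRegular.of_flat V.ι).comp hq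

/-- The section over `V` makes pullback along `c` injective on functions over `W`, so regularity
descends from `T` to `W`. -/
lemma PreservesRegular.map_mem_of_section {q : X ⟶ S} {V : X.Opens} (c : T ⟶ X)
    (h : V.toScheme ⟶ T) (hc : h ≫ c = V.ι) (hq : PreservesRegular (c ≫ q)) {U : S.Opens}
    {t : Γ(S, U)} (ht : IsRegularFun t) {W : X.Opens} (hWV : W ≤ V) (i : W ⟶ q ⁻¹ᵁ U) :
    X.presheaf.map i.op (q.app U t) ∈ nonZeroDivisors Γ(X, W) := by
  refine mem_nonZeroDivisors_of_section c (X.homOfLE hWV ≫ h) (by simp [hc]) ?_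
  have h1 := hq U t ht (c ⁻¹ᵁ W) ((Opens.map c.base).map i)
  rw [comp_app_apply] at h1
  rw [app_map_apply]
  exact h1

lemma PreservesRegular.of_locally_section {q : X ⟶ S}
    (h : ∀ x : X, ∃ (V : X.Opens) (T : Scheme.{u}) (c : T ⟶ X) (h : V.toScheme ⟶ T), x ∈ V ∧
      h ≫ c = V.ι ∧ PreservesRegular (c ≫ q)) : PreservesRegular q := by
  intro U t ht
  refine isRegularFun_of_locally fun x hx => ?_
  obtain ⟨V, T, c, h, hxV, hc, hq⟩ := h x
  refine ⟨V ⊓ q ⁻¹ᵁ U, homOfLE inf_le_right, ⟨hxV, hx⟩, fun W i => ?_⟩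
  rw [presheaf_map_map _ _ (i ≫ homOfLE inf_le_right)]
  exact hq.map_mem_of_section c h hc ht (i.le.trans inf_le_left) _

/-- Affine space is a base change of the spectrum of a polynomial ring over the integers, which is
flat because polynomial rings are free. -/
lemma exists_affineSpace (S : Scheme.{u}) (I : Type u) :
    ∃ (A : Scheme.{u}) (ρ : A ⟶ S) (z : I → Γ(A, ⊤)), Flat ρ ∧
      ∀ {T : Scheme.{u}} (q : T ⟶ S) (v : I → Γ(T, ⊤)),
        ∃ w : T ⟶ A, w ≫ ρ = q ∧ ∀ k, w.app ⊤ (z k) = v k := by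
  refine ⟨𝔸(I; S), 𝔸(I; S) ↘ S, AffineSpace.coord S, ?_, fun q v =>
    ⟨AffineSpace.homOfVector q v, AffineSpace.homOfVector_over _ _,
      AffineSpace.homOfVector_appTop_coord _ _⟩⟩
  have h : Flat (terminal.from (Spec (.of (MvPolynomial I (ULift.{u} ℤ))))) := by
    have := isIso_of_isTerminal specULiftZIsTerminal.{u} terminalIsTerminal (terminal.from _)
    have h1 : Flat (Spec.map (CommRingCat.ofHom
        (MvPolynomial.C : ULift.{u} ℤ →+* MvPolynomial I (ULift.{u} ℤ)))) := by
      rw [Flat.SpecMap_iff]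
      exact (RingHom.flat_algebraMap_iff (R := ULift.{u} ℤ)
        (S := MvPolynomial I (ULift.{u} ℤ))).2 inferInstance
    rw [← terminal.comp_from (Spec.map (CommRingCat.ofHom
        (MvPolynomial.C : ULift.{u} ℤ →+* MvPolynomial I (ULift.{u} ℤ))))]
    infer_instance
  exact inferInstanceAs (Flat (pullback.fst (terminal.from S)
    (terminal.from (Spec (.of (MvPolynomial I (ULift.{u} ℤ)))))))

lemma HasCoords.congr {E : S.Modules} {P : ProjectiveBundle E} {U : S.Opens} {I : Type*}
    {e : I → Γ(E, U)} {g : T ⟶ P.space} {q q' : T ⟶ S} {x : I → Γ(T, q ⁻¹ᵁ U)}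
    (h : HasCoords P e g q x) {x' : I → Γ(T, q' ⁻¹ᵁ U)} (hq : q = q')
    (i : q' ⁻¹ᵁ U ⟶ q ⁻¹ᵁ U) (hx : ∀ k, x' k = T.presheaf.map i.op (x k)) :
    HasCoords P e g q' x' := by
  subst hq
  convert h using 1
  ext k
  rw [hx, Subsingleton.elim i (𝟙 _)]
  simp

/-- Over `U`, the punctured affine space maps to `P_S(E)` by its tautological coordinates.
Coordinates of the identity of `P_S(E)` give local sections of this map. The punctured affine space
is flat over `S`, so regularity holds there and descends along the sections. -/
lemma preservesRegular_π {E : S.Modules} (P : ProjectiveBundle E)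
    (hE : ∀ s : S, ∃ (U : S.Opens) (I : Type u) (_ : Fintype I) (e : I → Γ(E, U)),
      s ∈ U ∧ IsFrame E U e) : PreservesRegular P.π := by
  refine .of_locally_section fun x => ?_
  obtain ⟨U, I, _, e, hsU, he⟩ := hE (P.π x)
  obtain ⟨V₀, hxV₀, hV₀⟩ := exists_hasCoords_nhds (P := P) (g := 𝟙 _) (Category.id_comp _) x
  let V := V₀ ⊓ P.π ⁻¹ᵁ U
  obtain ⟨y, hy⟩ := hV₀ V inf_le_left e
  rw [Category.comp_id] at hy
  have hq : (V.ι ≫ P.π) ⁻¹ᵁ U = ⊤ := ι_comp_preimage inf_le_right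
  obtain ⟨A, ρ, ζ, hρ, hA⟩ := exists_affineSpace S I
  let O : A.Opens := (⨆ k, A.basicOpen (ζ k)) ⊓ ρ ⁻¹ᵁ U
  have hqO : (O.ι ≫ ρ) ⁻¹ᵁ U = ⊤ := ι_comp_preimage inf_le_right
  let z₀ (k : I) : Γ(A, ρ ⁻¹ᵁ U) := A.presheaf.map (homOfLE le_top).op (ζ k)
  let z (k : I) : Γ(O.toScheme, (O.ι ≫ ρ) ⁻¹ᵁ U) := O.ι.app (ρ ⁻¹ᵁ U) (z₀ k)
  have hz : Unimodular z := by
    intro o ho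
    obtain ⟨k, hk⟩ := Opens.mem_iSup.1 o.2.1
    refine ⟨k, ?_⟩
    change o ∈ O.toScheme.basicOpen (O.ι.app (ρ ⁻¹ᵁ U) (z₀ k))
    rw [← Scheme.preimage_basicOpen]
    change o.1 ∈ A.basicOpen (z₀ k)
    rw [Scheme.basicOpen_res]
    exact ⟨o.2.2, hk⟩
  obtain ⟨c, hc, -⟩ := existsUnique_hasCoords (P := P) he hqO hz
  let v (k : I) : Γ(V.toScheme, ⊤) := V.toScheme.presheaf.map (homOfLE hq.ge).op (y k)
  obtain ⟨w, hw, hwv⟩ := hA (V.ι ≫ P.π) v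
  have hrange : Set.range w ⊆ Set.range O.ι := by
    rw [Scheme.Opens.range_ι]
    rintro _ ⟨a, rfl⟩
    refine ⟨?_, ?_⟩
    · obtain ⟨k, hk⟩ := hy.unimodular he hq a (hq ▸ trivial)
      refine Opens.mem_iSup.2 ⟨k, ?_⟩
      have h1 : w ⁻¹ᵁ A.basicOpen (ζ k) = V.toScheme.basicOpen (v k) :=
        (Scheme.preimage_basicOpen w (ζ k)).trans (congrArg _ (hwv k))
      have h2 : a ∈ V.toScheme.basicOpen (v k) := by
        rw [Scheme.basicOpen_res]
        exact ⟨trivial, hk⟩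
      rw [← h1] at h2
      exact h2
    · change a ∈ (w ≫ ρ) ⁻¹ᵁ U
      rw [hw, hq]
      trivial
  let h := IsOpenImmersion.lift O.ι w hrange
  have hh : h ≫ O.ι = w := IsOpenImmersion.lift_fac _ _ _
  refine ⟨V, O, c, h, ⟨hxV₀, hsU⟩, ?_, ?_⟩
  · have hq' : h ≫ O.ι ≫ ρ = V.ι ≫ P.π := by rw [← hw, ← hh, Category.assoc]
    have hcomp := hc.comp h
    -- `h ≫ c` is the inclusion of `V`, because both have the coordinates `y`.
    refine HasCoords.eq he hq (hcomp.congr (x' := y) hq' (homOfLE (by rw [hq'])) fun k => ?_) hy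
    have h1 : h.app ((O.ι ≫ ρ) ⁻¹ᵁ U) (z k) = (h ≫ O.ι).app (ρ ⁻¹ᵁ U) (z₀ k) :=
      (comp_app_apply h O.ι (ρ ⁻¹ᵁ U) (z₀ k)).symm
    have h2 (w' : V.toScheme ⟶ A) (hw' : w' = w) : w'.app (ρ ⁻¹ᵁ U) (z₀ k) =
        V.toScheme.presheaf.map (homOfLE le_top).op (v k) := by
      subst hw'
      rw [app_map_apply, hwv]
      rfl
    rw [h1, h2 _ hh]
    simp only [v]
    rw [presheaf_map_map _ _ (homOfLE (by rw [hq]; exact le_top))]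
    refine Eq.trans ?_ (presheaf_map_map (X := V.toScheme) _ _ (𝟙 _) (y k)).symm
    exact congr($(V.toScheme.presheaf.map_id _) (y k)).symm
  · rw [hc.1]
    exact (PreservesRegular.of_flat ρ).ι_comp O

end Regular

section BlowupRegular
variable {S X : Scheme.{u}} {K : X.IdealSheafData}

lemma isCartierDivisor_top : IsCartierDivisor (⊤ : X.IdealSheafData) := fun x => by
  obtain ⟨V, hV, hx, -⟩ := exists_isAffineOpen_le (show x ∈ (⊤ : X.Opens) from trivial)
  exact ⟨⟨V, hV⟩, hx, 1, one_mem _, by simp⟩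

/-- A morphism which preserves regular functions still does so after blowing up. -/
lemma Blowup.preservesRegular (B : Blowup K) {q : X ⟶ S} (hq : PreservesRegular q) :
    PreservesRegular (B.map ≫ q) := by
  -- Away from the centre the ideal is the unit ideal, so the universal property gives a morphism
  -- `l` from `O` to the blowup.
  let O : X.Opens := ⟨(K.support : Set X)ᶜ, K.support.isClosed.isOpen_compl⟩
  have hO {T : Scheme.{u}} (r : T ⟶ O.toScheme) : K.comap (r ≫ O.ι) = ⊤ := by
    rw [← Scheme.IdealSheafData.support_eq_bot_iff, Scheme.IdealSheafData.support_comap]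
    ext x
    simp only [Closeds.coe_preimage, Set.mem_preimage, Closeds.coe_bot, Set.mem_empty_iff_false, iff_false]
    exact (r x).2
  obtain ⟨l, hl, -⟩ := B.universal O.ι (by
    rw [← Category.id_comp O.ι, hO]; exact isCartierDivisor_top)
  let B₀ := B.map ⁻¹ᵁ O
  -- By uniqueness in the universal property, `l` has a section over the preimage of `O`; this
  -- yields regularity away from the exceptional divisor.
  have hsec : (B.map ∣_ O) ≫ l = B₀.ι := by
    have hm : ((B.map ∣_ O) ≫ l) ≫ B.map = (B.map ∣_ O) ≫ O.ι := by rw [Category.assoc, hl]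
    refine (B.universal ((B.map ∣_ O) ≫ O.ι) ?_).unique hm (morphismRestrict_ι _ _).symm
    rw [hO]
    exact isCartierDivisor_top
  have hlq : PreservesRegular (l ≫ B.map ≫ q) := by
    rw [← Category.assoc, hl]
    exact hq.ι_comp O
  intro U t ht
  refine isRegularFun_of_locally fun x hx => ?_
  obtain ⟨V₀, hxV₀, a, ha, hK⟩ := B.isCartierDivisor x
  obtain ⟨V, hV, hxV, hle⟩ := exists_isAffineOpen_le (show x ∈ V₀.1 ⊓ (B.map ≫ q) ⁻¹ᵁ U from
    ⟨hxV₀, hx⟩)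
  refine ⟨V, homOfLE (hle.trans inf_le_right), hxV, isRegularFun_of_isAffineOpen hV ?_⟩
  let a' := B.space.presheaf.map (homOfLE (hle.trans inf_le_left)).op a
  have ha' : a' ∈ nonZeroDivisors _ := isRegularFun_of_isAffineOpen V₀.2 ha _ _
  have hK' : (K.comap B.map).ideal ⟨V, hV⟩ = Ideal.span {a'} := by
    rw [← (K.comap B.map).map_ideal (U := ⟨V, hV⟩) (V := V₀) (hle.trans inf_le_left), hK,
      Ideal.map_span, Set.image_singleton]
    rfl
  -- Where the equation `a'` of the exceptional divisor is invertible, a point cannot lie over the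
  -- centre.
  have hB₀ : B.space.basicOpen a' ≤ B₀ := by
    intro y hy hy'
    have h1 : y ∈ (K.comap B.map).support := by
      rw [Scheme.IdealSheafData.support_comap]
      exact hy'
    rw [Scheme.IdealSheafData.mem_support_iff_of_mem (U := ⟨V, hV⟩) (B.space.basicOpen_le _ hy), hK'] at h1
    exact (B.space.mem_zeroLocus_iff _ _).1 h1 a' (Ideal.mem_span_singleton_self a') hy
  have h1 := hlq.map_mem_of_section l _ hsec ht hB₀
    (homOfLE ((B.space.basicOpen_le _).trans (hle.trans inf_le_right)))
  -- Since `a'` is a nonzerodivisor, functions on `V` embed in its localisation, where regularity is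
  -- already known.
  have hinj : Function.Injective (B.space.presheaf.map (homOfLE (B.space.basicOpen_le a')).op) := by
    have := hV.isLocalization_basicOpen a'
    exact IsLocalization.injective (M := .powers a') _ (Submonoid.powers_le.2 ha')
  rw [mem_nonZeroDivisors_iff_right] at h1 ⊢
  intro b hb
  refine hinj ((h1 _ ?_).trans (map_zero _).symm)
  rw [← presheaf_map_map (homOfLE (B.space.basicOpen_le a')) (homOfLE (hle.trans inf_le_right)),
    ← map_mul, hb, map_zero]

end BlowupRegular
end Elementary

namespace Elementary
open Scheme.Modules hiding pullback pullbackComp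
open Opposite TopologicalSpace

/-! ### Algebra of linked coordinates -/

section Linked
variable {R I : Type*} [CommRing R] {J J' : Finset I} {t a d : R} {x y : I → R}

/-- The relation between homogeneous coordinates `x` of a point of `P(E)` and `y` of the
corresponding point of `P(E')`, in adapted frames. -/
structure Linked (J : Finset I) (t a d : R) (x y : I → R) : Prop where
  mul_eq : t = a * d
  mem : ∀ k ∈ J, y k = d * x k
  notMem : ∀ k ∉ J, x k = a * y k

/-- Exchanging the two bundles exchanges `a` with `d` and `J` with its complement. -/
lemma Linked.symm (hJ : ∀ k, k ∈ J' ↔ k ∉ J) (h : Linked J t a d x y) : Linked J' t d a y x :=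
  ⟨h.mul_eq.trans (mul_comm a d), fun k hk => h.notMem k ((hJ k).1 hk),
    fun k hk => h.mem k (by by_contra h; exact hk ((hJ k).2 h))⟩

open Classical in
lemma Linked.eq (h : Linked J t a d x y) (k : I) : (if k ∈ J then t else 1) * x k = a * y k := by
  split_ifs with hk
  · rw [h.mem k hk, h.mul_eq, mul_assoc]
  · rw [one_mul, h.notMem k hk]

variable [Fintype I]

lemma exists_sum_eq_one (hx : Ideal.span (Set.range x) = ⊤) : ∃ s : I → R, ∑ k, s k * x k = 1 :=
  Ideal.mem_span_range_iff_exists_fun.1 (hx ▸ Submodule.mem_top)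

-- Write `1 = ∑ s k * x k` and multiply by `t`. Each `t * x k` is a multiple of `a`: it is `a * y k`
-- on `J` and `t * a * y k` off `J`. The quotient is `d`, and cancelling `a` gives `y k = d * x k`
-- on `J`.
open Classical in
lemma exists_linked (ht : t ∈ nonZeroDivisors R) (hx : Ideal.span (Set.range x) = ⊤)
    (h : ∀ k, (if k ∈ J then t else 1) * x k = a * y k) : ∃ d, Linked J t a d x y := by
  obtain ⟨s, hs⟩ := exists_sum_eq_one hx
  have hmul : t = a * ∑ k, s k * ((if k ∈ J then 1 else t) * y k) := by
    conv_lhs => rw [← mul_one t, ← hs]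
    rw [Finset.mul_sum, Finset.mul_sum]
    refine Finset.sum_congr rfl fun k _ => ?_
    have := h k
    split_ifs at this ⊢
    · linear_combination s k * this
    · linear_combination t * s k * this
  refine ⟨_, hmul, fun k hk => ?_, fun k hk => ?_⟩
  · have ha : a ∈ nonZeroDivisors R := (mul_mem_nonZeroDivisors.1 (hmul ▸ ht)).1
    refine (mul_cancel_left_mem_nonZeroDivisors ha).1 ?_
    rw [← mul_assoc, ← hmul, ← h k, if_pos hk]
  · rw [← h k, if_neg hk, one_mul]

/-- Since `x` is unimodular, `d` is a combination of the `d * x k`; these are `y k` for `k` in `J`,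
and `t * y k` otherwise. -/
lemma Linked.span_eq (h : Linked J t a d x y) (hx : Ideal.span (Set.range x) = ⊤)
    (hJ : ∀ k, k ∈ J' ↔ k ∉ J) :
    Ideal.span (insert t (y '' {k | k ∉ J'})) = Ideal.span {d} := by
  apply le_antisymm
  · rw [Ideal.span_le, Set.insert_subset_iff, Set.image_subset_iff]
    refine ⟨Ideal.mem_span_singleton.2 ⟨a, by rw [h.mul_eq, mul_comm]⟩, fun k hk => ?_⟩
    exact Ideal.mem_span_singleton.2 ⟨x k, h.mem k (by by_contra h; exact hk ((hJ k).2 h))⟩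
  · rw [Ideal.span_singleton_le_iff_mem]
    obtain ⟨s, hs⟩ := exists_sum_eq_one hx
    rw [← mul_one d, ← hs, Finset.mul_sum]
    refine Ideal.sum_mem _ fun k _ => ?_
    by_cases hk : k ∈ J
    · rw [mul_left_comm, ← h.mem k hk]
      exact Ideal.mul_mem_left _ _ (Ideal.subset_span (.inr ⟨k, fun hk' => (hJ k).1 hk' hk, rfl⟩))
    · rw [h.notMem k hk, show d * (s k * (a * y k)) = (s k * y k) * t by rw [h.mul_eq]; ring]
      exact Ideal.mul_mem_left _ _ (Ideal.subset_span (.inl rfl))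

/-- All generators of the ideal are multiples of `a`: dividing `t` gives `d`, and dividing the `x k`
off `J` gives the `y k` there. -/
lemma exists_linked_of_span_eq (ha : a ∈ nonZeroDivisors R) (hx : Ideal.span (Set.range x) = ⊤)
    (h : Ideal.span (insert t (x '' {k | k ∉ J})) = Ideal.span {a}) :
    ∃ d y, Linked J t a d x y ∧ Ideal.span (Set.range y) = ⊤ := by
  classical
  have hmem (r : R) (hr : r ∈ insert t (x '' {k | k ∉ J})) : ∃ w, r = a * w :=
    Ideal.mem_span_singleton.1 (h ▸ Ideal.subset_span hr)
  obtain ⟨d, hd⟩ := hmem t (.inl rfl)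
  choose! w hw using fun k (hk : k ∉ J) => hmem (x k) (.inr ⟨k, hk, rfl⟩)
  let y (k : I) : R := if k ∈ J then d * x k else w k
  have hl : Linked J t a d x y := ⟨hd, fun k hk => if_pos hk, fun k hk => by
    rw [show y k = w k from if_neg hk, hw k hk]⟩
  refine ⟨d, y, hl, ?_⟩
  have hy (k) : y k ∈ Ideal.span (Set.range y) := Ideal.subset_span ⟨k, rfl⟩
  have hdy : d ∈ Ideal.span (Set.range y) := by
    obtain ⟨s, hs⟩ := exists_sum_eq_one hx
    rw [← mul_one d, ← hs, Finset.mul_sum]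
    refine Ideal.sum_mem _ fun k _ => ?_
    by_cases hk : k ∈ J
    · rw [mul_left_comm, ← hl.mem k hk]
      exact Ideal.mul_mem_left _ _ (hy k)
    · rw [hl.notMem k hk, ← mul_assoc, ← mul_assoc]
      exact Ideal.mul_mem_left _ _ (hy k)
  -- Both `t = a * d` and `x k = a * y k` lie in `a` times the ideal of the `y k`. As these elements
  -- generate `(a)`, cancelling `a` shows that `y` is unimodular.
  have key : Ideal.span {a} ≤ Ideal.span {a} * Ideal.span (Set.range y) := by
    rw [← h, Ideal.span_le, h, Set.insert_subset_iff, Set.image_subset_iff]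
    refine ⟨?_, fun k hk => ?_⟩
    · exact hd ▸ Ideal.mul_mem_mul (Ideal.mem_span_singleton_self a) hdy
    · change x k ∈ Ideal.span {a} * Ideal.span (Set.range y)
      rw [hl.notMem k hk]
      exact Ideal.mul_mem_mul (Ideal.mem_span_singleton_self a) (hy k)
  obtain ⟨r, hr, hra⟩ := Ideal.mem_span_singleton_mul.1 (key (Ideal.mem_span_singleton_self a))
  rw [Ideal.eq_top_iff_one]
  rwa [(mul_cancel_left_mem_nonZeroDivisors ha).1 (hra.trans (mul_one a).symm)] at hr

/-- Both `a * y` and `a' * y'` equal the same vector. Unimodularity of `y` and `y'` makes `a` and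
`a'` divide one another, and their ratio is the unit. -/
lemma Linked.exists_isUnit {a' d' : R} {y' : I → R} (ht : t ∈ nonZeroDivisors R)
    (h : Linked J t a d x y) (h' : Linked J t a' d' x y') (hy : Ideal.span (Set.range y) = ⊤)
    (hy' : Ideal.span (Set.range y') = ⊤) : ∃ c, IsUnit c ∧ ∀ k, y' k = c * y k := by
  have ha : a ∈ nonZeroDivisors R := (mul_mem_nonZeroDivisors.1 (h.mul_eq ▸ ht)).1
  have ha' : a' ∈ nonZeroDivisors R := (mul_mem_nonZeroDivisors.1 (h'.mul_eq ▸ ht)).1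
  have haa (k : I) : a * y k = a' * y' k := (h.eq k).symm.trans (h'.eq k)
  obtain ⟨s, hs⟩ := exists_sum_eq_one hy
  obtain ⟨s', hs'⟩ := exists_sum_eq_one hy'
  have h1 : a = a' * ∑ k, s k * y' k := by
    conv_lhs => rw [← mul_one a, ← hs]
    rw [Finset.mul_sum, Finset.mul_sum]
    exact Finset.sum_congr rfl fun k _ => by linear_combination s k * haa k
  have h2 : a' = a * ∑ k, s' k * y k := by
    conv_lhs => rw [← mul_one a', ← hs']
    rw [Finset.mul_sum, Finset.mul_sum]
    exact Finset.sum_congr rfl fun k _ => by linear_combination - s' k * haa k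
  refine ⟨∑ k, s k * y' k, .of_mul_eq_one (∑ k, s' k * y k)
    ((mul_cancel_left_mem_nonZeroDivisors ha').1 ?_), fun k =>
    (mul_cancel_left_mem_nonZeroDivisors ha').1 ?_⟩
  · rw [← mul_assoc, ← h1, ← h2, mul_one]
  · rw [← haa, ← mul_assoc, ← h1]

end Linked

section Unimodular
variable {T : Scheme.{u}} {W : T.Opens} {I : Type*} {x : I → Γ(T, W)}

lemma unimodular_iff_span_eq_top (hW : IsAffineOpen W) :
    Unimodular x ↔ Ideal.span (Set.range x) = ⊤ := by
  rw [← hW.iSup_basicOpen_eq_self_iff]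
  constructor
  · intro h
    refine le_antisymm (iSup_le fun f => T.basicOpen_le _) fun s hs => ?_
    obtain ⟨k, hk⟩ := h s hs
    exact Opens.mem_iSup.2 ⟨⟨x k, k, rfl⟩, hk⟩
  · intro h s hs
    rw [← h] at hs
    obtain ⟨⟨_, k, rfl⟩, hk⟩ := Opens.mem_iSup.1 hs
    exact ⟨k, hk⟩

end Unimodular

section Local
variable {T : Scheme.{u}} {M N : T.Modules}

lemma hom_eq_zero_of_locally (α : M ⟶ N)
    (h : ∀ s : T, ∃ V : T.Opens, s ∈ V ∧ (Scheme.Modules.pullback V.ι).map α = 0) : α = 0 := by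
  ext W m
  refine section_eq_zero_of_locally _ fun s hs => ?_
  obtain ⟨V, hsV, hV⟩ := h s
  refine ⟨V.ι ''ᵁ V.ι ⁻¹ᵁ W, homOfLE (V.ι.image_preimage_le W), ⟨⟨s, hsV⟩, hs, rfl⟩, ?_⟩
  rw [← restrictIso_inv_pullSection]
  have h1 := pullback_map_pullSection (f := V.ι) W α m
  rw [hV] at h1
  refine (congrArg _ h1.symm).trans ?_
  exact map_zero _

end Local

/-! ### Compatible pairs of quotients -/

section Rel
variable {S T T' : Scheme.{u}} {E E' : S.Modules}

/-- The quotient of `q^*E'` classified by `g` maps to the quotient of `q^*E` classified by `b`,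
compatibly with `κ : E' ⟶ E`. -/
def Rel (κ : E' ⟶ E) (P : ProjectiveBundle E) (P' : ProjectiveBundle E') (b : T ⟶ P.space)
    (g : T ⟶ P'.space) (q : T ⟶ S) : Prop :=
  ∃ (hb : b ≫ P.π = q) (hg : g ≫ P'.π = q)
    (j : (Scheme.Modules.pullback g).obj P'.O1 ⟶ (Scheme.Modules.pullback b).obj P.O1),
    pullTaut P'.taut g hg ≫ j = (Scheme.Modules.pullback q).map κ ≫ pullTaut P.taut b hb

variable {κ : E' ⟶ E} {P : ProjectiveBundle E} {P' : ProjectiveBundle E'} {b : T ⟶ P.space}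
  {g : T ⟶ P'.space} {q : T ⟶ S}

/-- The base change of `j` is kept explicit, because `Rel.mono` needs it for a given `j`. -/
lemma pullTaut_comp_eq (c : T' ⟶ T) {hb : b ≫ P.π = q} {hg : g ≫ P'.π = q}
    {j : (Scheme.Modules.pullback g).obj P'.O1 ⟶ (Scheme.Modules.pullback b).obj P.O1}
    (h : pullTaut P'.taut g hg ≫ j = (Scheme.Modules.pullback q).map κ ≫ pullTaut P.taut b hb)
    (hb' : (c ≫ b) ≫ P.π = c ≫ q) (hg' : (c ≫ g) ≫ P'.π = c ≫ q) :
    pullTaut P'.taut (c ≫ g) hg' ≫ ((Scheme.Modules.pullbackComp c g).inv.app _ ≫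
      (Scheme.Modules.pullback c).map j ≫ (Scheme.Modules.pullbackComp c b).hom.app _) =
    (Scheme.Modules.pullback (c ≫ q)).map κ ≫ pullTaut P.taut (c ≫ b) hb' := by
  rw [← Category.assoc, pullTaut_comp _ _ hg _ rfl, ← Category.assoc, pullTaut_comp_map, h,
    ← map_comp_pullTaut, ← pullTaut_comp _ _ hb _ rfl hb']
  simp

lemma Rel.comp (h : Rel κ P P' b g q) (c : T' ⟶ T) : Rel κ P P' (c ≫ b) (c ≫ g) (c ≫ q) := by
  obtain ⟨hb, hg, j, hj⟩ := h
  exact ⟨by rw [Category.assoc, hb], by rw [Category.assoc, hg], _, pullTaut_comp_eq c hj _ _⟩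

lemma pullback_map_eq {M : S.Modules} {N : T.Modules} (α : (Scheme.Modules.pullback q).obj M ⟶ N)
    (c : T' ⟶ T) : (Scheme.Modules.pullback c).map α =
      (Scheme.Modules.pullbackComp c q).hom.app M ≫ pullTaut α c rfl := by
  have h1 : pullTaut α c rfl = (Scheme.Modules.pullbackComp c q).inv.app M ≫
      (Scheme.Modules.pullback c).map α := by
    simp only [pullTaut]
    exact Category.id_comp _
  rw [h1]
  simp

/-- The map `j` exists if and only if the composite to `b^*𝒪(1)` kills the kernel of the quotient
for `g`, and vanishing of a morphism is local. -/
lemma Rel.of_locally (hb : b ≫ P.π = q) (hg : g ≫ P'.π = q)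
    (h : ∀ s : T, ∃ V : T.Opens, s ∈ V ∧ Rel κ P P' (V.ι ≫ b) (V.ι ≫ g) (V.ι ≫ q)) :
    Rel κ P P' b g q := by
  have := epi_pullTaut g hg
  have h0 : kernel.ι (pullTaut P'.taut g hg) ≫
      ((Scheme.Modules.pullback q).map κ ≫ pullTaut P.taut b hb) = 0 := by
    refine hom_eq_zero_of_locally _ fun s => ?_
    obtain ⟨V, hsV, hb', hg', j, hj⟩ := h s
    refine ⟨V, hsV, ?_⟩
    have h1 : (Scheme.Modules.pullback V.ι).map
        ((Scheme.Modules.pullback q).map κ ≫ pullTaut P.taut b hb) =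
        (Scheme.Modules.pullback V.ι).map (pullTaut P'.taut g hg) ≫
          (Scheme.Modules.pullbackComp V.ι g).hom.app _ ≫ j ≫
          (Scheme.Modules.pullbackComp V.ι b).inv.app _ := by
      rw [pullback_map_eq, pullback_map_eq, ← map_comp_pullTaut, ← pullTaut_comp _ _ hb _ rfl hb',
        ← pullTaut_comp _ _ hg _ rfl hg', ← reassoc_of% hj]
      simp
    rw [Functor.map_comp, h1, ← Category.assoc, ← Functor.map_comp, kernel.condition,
      Functor.map_zero, zero_comp]
  exact ⟨hb, hg, Abelian.epiDesc _ _ h0, Abelian.comp_epiDesc _ _ h0⟩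

end Rel
end Elementary

namespace Elementary
open Scheme.Modules hiding pullback pullbackComp
open Opposite TopologicalSpace

/-! ### The relation in coordinates, and gluing of morphisms -/

section RelCoords
variable {S T : Scheme.{u}} {E E' : S.Modules} {κ : E' ⟶ E} {P : ProjectiveBundle E}
  {P' : ProjectiveBundle E'} {b : T ⟶ P.space} {g : T ⟶ P'.space} {q : T ⟶ S} {I : Type u}
  {U : S.Opens} {t : Γ(S, U)} {J : Finset I} {e : I → Γ(E, U)} {e' : I → Γ(E', U)}
  {x y : I → Γ(T, q ⁻¹ᵁ U)}

lemma unit_end_app {W V : T.Opens} (ρ : unitMod T ⟶ unitMod T) (i : V ⟶ W) (r : Γ(T, V)) :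
    unitSec V (ρ.app V ((unitSec V).symm r)) =
      r * T.presheaf.map i.op (unitSec W (ρ.app W ((unitSec W).symm 1))) := by
  rw [unit_hom_app, _root_.map_smul, ← unitSec_map, ← hom_app_map, map_unitSec_one, smul_eq_mul,
    LinearEquiv.apply_symm_apply]

lemma mono_of_isRegularFun {W : T.Opens} (hW : W = ⊤) (ρ : unitMod T ⟶ unitMod T)
    (h : IsRegularFun (unitSec W (ρ.app W ((unitSec W).symm 1)))) : Mono ρ := by
  refine mono_of_app_injective ρ fun V => ?_
  let i : V ⟶ W := homOfLE (hW ▸ le_top)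
  refine (injective_iff_map_eq_zero (ρ.app V).hom).2 fun s hs => ?_
  have h1 := unit_end_app ρ i (unitSec V s)
  rw [LinearEquiv.symm_apply_apply] at h1
  have h2 : unitSec V s = 0 := by
    refine (mem_nonZeroDivisors_iff_right.1 (h V i)) _ (h1.symm.trans ?_)
    exact (congrArg (unitSec V) hs).trans (map_zero _)
  exact (unitSec V).map_eq_zero_iff.1 h2

open Classical in
/-- The relation in terms of coordinates. -/
lemma HasCoords.exists_mul_eq (hκ : ∀ k, κ.app U (e' k) = (if k ∈ J then t else 1) • e k)
    (hx : HasCoords P e b q x) (hy : HasCoords P' e' g q y) {hb : b ≫ P.π = q} {hg : g ≫ P'.π = q}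
    {j : (Scheme.Modules.pullback g).obj P'.O1 ⟶ (Scheme.Modules.pullback b).obj P.O1}
    (hj : pullTaut P'.taut g hg ≫ j = (Scheme.Modules.pullback q).map κ ≫ pullTaut P.taut b hb) :
    ∃ ρ : unitMod T ⟶ unitMod T, (Mono ρ → Mono j) ∧
      ∀ k, (if k ∈ J then q.app U t else 1) * x k =
        unitSec (q ⁻¹ᵁ U) (ρ.app _ ((unitSec _).symm 1)) * y k := by
  obtain ⟨_, β, H⟩ := hx
  obtain ⟨_, β', H'⟩ := hy
  -- `ρ` is `j` read in the two trivialisations; its value at `1` plays the role of `a` in `Linked`.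
  refine ⟨β'.inv ≫ j ≫ β.hom, fun h => ?_, fun k => ?_⟩
  · have : j = β'.hom ≫ (β'.inv ≫ j ≫ β.hom) ≫ β.inv := by simp
    rw [this]
    infer_instance
  · have h1 : (pullTaut P'.taut g hg ≫ β'.hom) ≫ (β'.inv ≫ j ≫ β.hom) =
        (Scheme.Modules.pullback q).map κ ≫ (pullTaut P.taut b hb ≫ β.hom) := by
      simp [reassoc_of% hj]
    have h2 := congr(adjSection $h1 U (e' k))
    rw [adjSection_comp, H', adjSection_map_comp, hκ, adjSection_smul, H] at h2
    have h3 := congr(unitSec _ $h2)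
    rw [unit_end_app _ (𝟙 _), _root_.map_smul, LinearEquiv.apply_symm_apply, smul_eq_mul, mul_comm] at h3
    simp only [op_id, CategoryTheory.Functor.map_id] at h3
    refine Eq.trans ?_ h3.symm
    split_ifs
    · rfl
    · rw [map_one]

-- In the trivialisations given by the coordinates, `j` is multiplication by `a`.
open Classical in
lemma HasCoords.rel [Fintype I] (he' : IsFrame E' U e')
    (hκ : ∀ k, κ.app U (e' k) = (if k ∈ J then t else 1) • e k) (hq : q ⁻¹ᵁ U = ⊤)
    (hx : HasCoords P e b q x) (hy : HasCoords P' e' g q y) {a d : Γ(T, q ⁻¹ᵁ U)}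
    (h : Linked J (q.app U t) a d x y) : Rel κ P P' b g q := by
  obtain ⟨hb, β, H⟩ := hx
  obtain ⟨hg, β', H'⟩ := hy
  obtain ⟨ρ, hρ⟩ := exists_unit_hom hq ((unitSec _).symm a)
  refine ⟨hb, hg, β'.hom ≫ ρ ≫ β.inv, ?_⟩
  rw [← cancel_mono β.hom]
  simp only [Category.assoc, Iso.inv_hom_id, Category.comp_id]
  refine he'.pullback_hom_ext hq fun k => ?_
  rw [← Category.assoc, adjSection_comp, H', adjSection_map_comp, hκ, adjSection_smul, H,
    hρ _ (𝟙 _)]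
  apply (unitSec _).injective
  have := h.eq k
  simp only [op_id, CategoryTheory.Functor.map_id, _root_.map_smul, LinearEquiv.apply_symm_apply,
    smul_eq_mul]
  refine (mul_comm _ _).trans (this.symm.trans ?_)
  split_ifs
  · rfl
  · rw [map_one]

open Classical in
lemma Rel.exists_linked [IsAffine T] [Fintype I] (hqa : IsAffineOpen (q ⁻¹ᵁ U)) (hq : q ⁻¹ᵁ U = ⊤)
    (he : IsFrame E U e) (hκ : ∀ k, κ.app U (e' k) = (if k ∈ J then t else 1) • e k)
    (ht : q.app U t ∈ nonZeroDivisors Γ(T, q ⁻¹ᵁ U))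
    (h : Rel κ P P' b g q) (hx : HasCoords P e b q x) (hy : HasCoords P' e' g q y) :
    ∃ a d, Linked J (q.app U t) a d x y := by
  obtain ⟨hb, hg, j, hj⟩ := h
  obtain ⟨ρ, -, hρ⟩ := hx.exists_mul_eq hκ hy hj
  exact ⟨_, Elementary.exists_linked ht ((unimodular_iff_span_eq_top hqa).1 (hx.unimodular he hq)) hρ⟩

end RelCoords

section GlueHom
variable {T X : Scheme.{u}}

/-- Overlaps are fibre products of opens, so uniqueness is needed only over open immersions into
`T`. These are flat and therefore keep the equation of `D` regular. -/
lemma exists_glue_hom (R : ∀ {T' : Scheme.{u}}, (T' ⟶ T) → (T' ⟶ X) → Prop)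
    (hcomp : ∀ {T' T'' : Scheme.{u}} (d : T'' ⟶ T') (c : T' ⟶ T) (g : T' ⟶ X), R c g →
      R (d ≫ c) (d ≫ g))
    (huniq : ∀ {T' : Scheme.{u}} (c : T' ⟶ T) [IsOpenImmersion c] (g g' : T' ⟶ X),
      R c g → R c g' → g = g')
    (h : ∀ s : T, ∃ (V : T.Opens) (g : V.toScheme ⟶ X), s ∈ V ∧ R V.ι g) :
    ∃ g : T ⟶ X, ∀ s : T, ∃ V : T.Opens, s ∈ V ∧ R V.ι (V.ι ≫ g) := by
  choose V g hV hg using h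
  let 𝒰 : T.OpenCover := T.openCoverOfIsOpenCover V
    (.mk (top_le_iff.1 fun s _ => Opens.mem_iSup.2 ⟨s, hV s⟩))
  have hf (s s' : T) : pullback.fst (V s).ι (V s').ι ≫ g s = pullback.snd (V s).ι (V s').ι ≫ g s' := by
    refine huniq (pullback.fst (V s).ι (V s').ι ≫ (V s).ι) _ _ (hcomp _ _ _ (hg s)) ?_
    rw [pullback.condition]
    exact hcomp _ _ _ (hg s')
  refine ⟨𝒰.glueMorphisms g hf, fun s => ⟨V s, hV s, ?_⟩⟩
  have := Scheme.Cover.ι_glueMorphisms 𝒰 g hf s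
  exact (show (V s).ι ≫ 𝒰.glueMorphisms g hf = g s from this) ▸ hg s

end GlueHom
end Elementary

namespace Elementary
open Scheme.Modules hiding pullback pullbackComp
open Opposite TopologicalSpace

/-! ### Correspondence of morphisms and the isomorphism of blowups -/

section Induced
variable {S D : Scheme.{u}} {ι : D ⟶ S} {E : S.Modules} {F : D.Modules}
  {p : (Scheme.Modules.pullback ι).obj E ⟶ F}

/-- Locally the target has a frame of values of `p`. This is how `E'|_D ⟶ F'` is seen to be
surjective. -/
lemma epi_of_isAdapted
    (hc : ∀ s : S, ∃ (U : S.affineOpens) (t : Γ(S, U)) (I : Type u) (_ : Fintype I) (J : Finset I)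
      (e : I → Γ(E, U)) (f : J → Γ(F, ι ⁻¹ᵁ U.1)), s ∈ U.1 ∧ IsAdapted ι p U t J e f) :
    Epi p := by
  refine Preadditive.epi_of_cancel_zero p fun {K} α hα => ?_
  ext W m
  refine section_eq_zero_of_locally _ fun s hs => ?_
  obtain ⟨U, t, I, _, J, e, f, hsU, ha⟩ := hc (ι s)
  refine ⟨W ⊓ ι ⁻¹ᵁ U.1, homOfLE inf_le_left, ⟨hs, hsU⟩, ?_⟩
  obtain ⟨c, hc⟩ := (ha.frame' (W ⊓ ι ⁻¹ᵁ U.1) (homOfLE inf_le_right)).2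
    (F.presheaf.map (homOfLE inf_le_left).op m)
  refine (hom_app_map α _ m).symm.trans ((congrArg _ hc.symm).trans ?_)
  simp only [map_sum]
  refine Finset.sum_eq_zero fun j _ => ?_
  rw [Hom.app_smul, hom_app_map, ← ha.map_mem, ← adjSection_comp, hα, adjSection_eq]
  simp

lemma exists_isInducedBy [Epi p] (X : ProjectiveBundle E) (Y : ProjectiveBundle F) :
    ∃ i, IsInducedBy ι p X Y i := by
  have := Y.epi_taut
  exact (X.universal (Y.π ≫ ι) Y.O1 _ Y.isLineBundle inferInstance).exists

end Induced

section Global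
variable {S D : Scheme.{u}} {ι : D ⟶ S} {E : S.Modules} {F : D.Modules}
  {p : (Scheme.Modules.pullback ι).obj E ⟶ F} {I : Type u} [Fintype I] {U : S.affineOpens}
  {t : Γ(S, U)} {J J' : Finset I} {e : I → Γ(E, U)} {e' : I → Γ(kernelOnBase ι p, U)}

open Classical in
lemma IsChart.map_eq (h : IsChart ι p U t J J' e e') (k : I) :
    (kernelOnBaseι ι p).app U (e' k) = (if k ∈ J then t else 1) • e k := by
  split_ifs with hk
  · exact h.map_mem k hk
  · rw [one_smul, h.map_notMem k hk]

lemma IsChart.frame (h : IsChart ι p U t J J' e e') : IsFrame E U.1 e :=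
  h.adapted.choose_spec.frame

lemma IsChart.frame' (h : IsChart ι p U t J J' e e') : IsFrame (kernelOnBase ι p) U.1 e' :=
  h.adapted'.choose_spec.frame

lemma IsChart.compl' (h : IsChart ι p U t J J' e e') (k : I) : k ∈ J ↔ k ∉ J' := by
  rw [h.compl, not_not]

lemma isAffineOpen_of_eq_top {T : Scheme.{u}} [IsAffine T] {W : T.Opens} (hW : W = ⊤) :
    IsAffineOpen W := hW ▸ isAffineOpen_top T

variable (ι p) in
/-- Each point of `S` has a chart around it. -/
def HasCharts : Prop :=
  ∀ s : S, ∃ (U : S.affineOpens) (t : Γ(S, U)) (I : Type u) (_ : Fintype I) (J J' : Finset I)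
    (e : I → Γ(E, U)) (e' : I → Γ(kernelOnBase ι p, U)), s ∈ U.1 ∧ IsChart ι p U t J J' e e'

variable {X : ProjectiveBundle E} {X' : ProjectiveBundle (kernelOnBase ι p)} {T : Scheme.{u}}
  {b b' : T ⟶ X.space} {g g' : T ⟶ X'.space} {q : T ⟶ S}

/-- A point of the source has an affine neighbourhood on which the two morphisms have linked
coordinates in some chart. -/
lemma Rel.exists_local (hc : HasCharts ι p) (hq : PreservesRegular q)
    (h : Rel (kernelOnBaseι ι p) X X' b g q) (s : T) {O : T.Opens} (hs : s ∈ O) :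
    ∃ (U : S.affineOpens) (t : Γ(S, U)) (I : Type u) (_ : Fintype I) (J J' : Finset I)
      (e : I → Γ(E, U)) (e' : I → Γ(kernelOnBase ι p, U)) (V : T.Opens)
      (x y : I → Γ(V.toScheme, (V.ι ≫ q) ⁻¹ᵁ U.1)) (a d : Γ(V.toScheme, (V.ι ≫ q) ⁻¹ᵁ U.1)),
      IsChart ι p U t J J' e e' ∧ s ∈ V ∧ V ≤ O ∧ IsAffineOpen V ∧ (V.ι ≫ q) ⁻¹ᵁ U.1 = ⊤ ∧
      IsRegularFun ((V.ι ≫ q).app U t) ∧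
      HasCoords X e (V.ι ≫ b) (V.ι ≫ q) x ∧ HasCoords X' e' (V.ι ≫ g) (V.ι ≫ q) y ∧
      Linked J ((V.ι ≫ q).app U t) a d x y := by
  obtain ⟨U, t, I, _, J, J', e, e', hsU, hch⟩ := hc (q s)
  obtain ⟨V₁, hsV₁, hV₁⟩ := exists_hasCoords_nhds h.1 s
  obtain ⟨V₂, hsV₂, hV₂⟩ := exists_hasCoords_nhds h.2.1 s
  obtain ⟨V, hVa, hsV, hle⟩ := exists_isAffineOpen_le
    (show s ∈ V₁ ⊓ V₂ ⊓ O ⊓ q ⁻¹ᵁ U.1 from ⟨⟨⟨hsV₁, hsV₂⟩, hs⟩, hsU⟩)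
  obtain ⟨x, hx⟩ := hV₁ V (hle.trans (inf_le_left.trans (inf_le_left.trans inf_le_left))) e
  obtain ⟨y, hy⟩ := hV₂ V (hle.trans (inf_le_left.trans (inf_le_left.trans inf_le_right))) e'
  have hq' : (V.ι ≫ q) ⁻¹ᵁ U.1 = ⊤ := ι_comp_preimage (hle.trans inf_le_right)
  have : IsAffine V := hVa
  have hreg : IsRegularFun ((V.ι ≫ q).app U t) := hq.ι_comp V _ _ hch.regular
  obtain ⟨a, d, hl⟩ := (h.comp V.ι).exists_linked (isAffineOpen_of_eq_top hq') hq' hch.frame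
    hch.map_eq hreg.mem hx hy
  exact ⟨U, t, I, inferInstance, J, J', e, e', V, x, y, a, d, hch, hsV,
    hle.trans (inf_le_left.trans inf_le_right), hVa, hq', hreg, hx, hy, hl⟩

/-- Locally both candidates are linked to the same `x`, so their coordinates differ by a unit. -/
lemma Rel.right_unique (hc : HasCharts ι p) (hq : PreservesRegular q)
    (h : Rel (kernelOnBaseι ι p) X X' b g q) (h' : Rel (kernelOnBaseι ι p) X X' b g' q) :
    g = g' := by
  refine Scheme.hom_ext_of_forall _ _ fun s => ?_
  obtain ⟨V₀, hsV₀, hV₀⟩ := exists_hasCoords_nhds h'.2.1 s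
  obtain ⟨U, t, I, _, J, J', e, e', V, x, y, a, d, hch, hsV, hle, hVa, hq', hreg, hx, hy, hl⟩ :=
    h.exists_local hc hq s hsV₀
  obtain ⟨y', hy'⟩ := hV₀ V hle e'
  have : IsAffine V := hVa
  have hqa := isAffineOpen_of_eq_top hq'
  obtain ⟨a', d', hl'⟩ := (h'.comp V.ι).exists_linked hqa hq' hch.frame
    hch.map_eq hreg.mem hx hy'
  obtain ⟨c, hcu, hyy⟩ := hl.exists_isUnit hreg.mem hl'
    ((unimodular_iff_span_eq_top hqa).1 (hy.unimodular hch.frame' hq'))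
    ((unimodular_iff_span_eq_top hqa).1 (hy'.unimodular hch.frame' hq'))
  refine ⟨V, hsV, HasCoords.eq hch.frame' hq' (hy.smul hq' hcu) ?_⟩
  rw [← show y' = fun k => c * y k from funext hyy]
  exact hy'

lemma Rel.left_unique (hc : HasCharts ι p) (hq : PreservesRegular q)
    (h : Rel (kernelOnBaseι ι p) X X' b g q) (h' : Rel (kernelOnBaseι ι p) X X' b' g q) :
    b = b' := by
  refine Scheme.hom_ext_of_forall _ _ fun s => ?_
  obtain ⟨V₀, hsV₀, hV₀⟩ := exists_hasCoords_nhds h'.1 s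
  obtain ⟨U, t, I, _, J, J', e, e', V, x, y, a, d, hch, hsV, hle, hVa, hq', hreg, hx, hy, hl⟩ :=
    h.exists_local hc hq s hsV₀
  obtain ⟨x', hx'⟩ := hV₀ V hle e
  have : IsAffine V := hVa
  have hqa := isAffineOpen_of_eq_top hq'
  obtain ⟨a', d', hl'⟩ := (h'.comp V.ι).exists_linked hqa hq' hch.frame
    hch.map_eq hreg.mem hx' hy
  obtain ⟨c, hcu, hxx⟩ := (hl.symm hch.compl).exists_isUnit hreg.mem (hl'.symm hch.compl)
    ((unimodular_iff_span_eq_top hqa).1 (hx.unimodular hch.frame hq'))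
    ((unimodular_iff_span_eq_top hqa).1 (hx'.unimodular hch.frame hq'))
  refine ⟨V, hsV, HasCoords.eq hch.frame hq' (hx.smul hq' hcu) ?_⟩
  rw [← show x' = fun k => c * x k from funext hxx]
  exact hx'

/-- In coordinates `j` is multiplication by `a`, a divisor of the regular function `t`. -/
lemma Rel.mono (hc : HasCharts ι p) (hq : PreservesRegular q) {hb : b ≫ X.π = q}
    {hg : g ≫ X'.π = q}
    {j : (Scheme.Modules.pullback g).obj X'.O1 ⟶ (Scheme.Modules.pullback b).obj X.O1}
    (hj : pullTaut X'.taut g hg ≫ j =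
      (Scheme.Modules.pullback q).map (kernelOnBaseι ι p) ≫ pullTaut X.taut b hb) : Mono j := by
  refine Preadditive.mono_of_kernel_zero (hom_eq_zero_of_locally _ fun s => ?_)
  have h : Rel (kernelOnBaseι ι p) X X' b g q := ⟨hb, hg, j, hj⟩
  obtain ⟨U, t, I, _, J, J', e, e', V, x, y, a, d, hch, hsV, hle, hVa, hq', hreg, hx, hy, hl⟩ :=
    h.exists_local hc hq s (O := ⊤) trivial
  have : IsAffine V := hVa
  have hqa := isAffineOpen_of_eq_top hq'
  refine ⟨V, hsV, ?_⟩
  have hj' := pullTaut_comp_eq V.ι hj (by rw [Category.assoc, hb]) (by rw [Category.assoc, hg])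
  obtain ⟨ρ, hρ, hρ'⟩ := hx.exists_mul_eq hch.map_eq hy hj'
  obtain ⟨d', hl'⟩ := Elementary.exists_linked hreg.mem
    ((unimodular_iff_span_eq_top hqa).1 (hx.unimodular hch.frame hq')) hρ'
  have hmono := hρ (mono_of_isRegularFun hq' ρ (IsRegularFun.of_mul_left (hl'.mul_eq ▸ hreg)))
  have hm : Mono ((Scheme.Modules.pullback V.ι).map j) := by
    have : (Scheme.Modules.pullback V.ι).map j = (Scheme.Modules.pullbackComp V.ι g).hom.app _ ≫
        ((Scheme.Modules.pullbackComp V.ι g).inv.app _ ≫ (Scheme.Modules.pullback V.ι).map j ≫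
          (Scheme.Modules.pullbackComp V.ι b).hom.app _) ≫
        (Scheme.Modules.pullbackComp V.ι b).inv.app _ := by simp
    rw [this]
    infer_instance
  rw [← cancel_mono ((Scheme.Modules.pullback V.ι).map j), ← Functor.map_comp, kernel.condition,
    Functor.map_zero, zero_comp]

variable [IsClosedImmersion ι] {Y : ProjectiveBundle F} {Y' : ProjectiveBundle (kernelOnDivisor ι p)}
  {i : Y.space ⟶ X.space} {i' : Y'.space ⟶ X'.space} [IsClosedImmersion i] [IsClosedImmersion i']

/-- The ideal of the inverse image is locally `(a)`, and `a` is regular because it divides `t`. -/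
lemma Rel.isCartierDivisor_left (hc : HasCharts ι p) (hi : IsInducedBy ι p X Y i)
    (hq : PreservesRegular q) (h : Rel (kernelOnBaseι ι p) X X' b g q) :
    IsCartierDivisor (i.ker.comap b) := by
  refine isCartierDivisor_of_locally fun s => ?_
  obtain ⟨U, t, I, _, J, J', e, e', V, x, y, a, d, hch, hsV, hle, hVa, hq', hreg, hx, hy, hl⟩ :=
    h.exists_local hc hq s (O := ⊤) trivial
  have : IsAffine V := hVa
  have hqa := isAffineOpen_of_eq_top hq'
  refine ⟨V, ⟨_, hqa⟩, hsV, hq', a, (IsRegularFun.of_mul_left (hl.mul_eq ▸ hreg)).mem, ?_⟩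
  obtain ⟨f, hf⟩ := hch.adapted
  rw [← Scheme.IdealSheafData.comap_comp, hx.ideal_comap hi hf hq' hqa]
  exact (hl.symm hch.compl).span_eq
    ((unimodular_iff_span_eq_top hqa).1 (hy.unimodular hch.frame' hq')) hch.compl'

lemma Rel.isCartierDivisor_right (hc : HasCharts ι p)
    (hi' : IsInducedBy ι (kernelRestriction ι p) X' Y' i')
    (hq : PreservesRegular q) (h : Rel (kernelOnBaseι ι p) X X' b g q) :
    IsCartierDivisor (i'.ker.comap g) := by
  refine isCartierDivisor_of_locally fun s => ?_
  obtain ⟨U, t, I, _, J, J', e, e', V, x, y, a, d, hch, hsV, hle, hVa, hq', hreg, hx, hy, hl⟩ :=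
    h.exists_local hc hq s (O := ⊤) trivial
  have : IsAffine V := hVa
  have hqa := isAffineOpen_of_eq_top hq'
  refine ⟨V, ⟨_, hqa⟩, hsV, hq', d, (IsRegularFun.of_mul_right (hl.mul_eq ▸ hreg)).mem, ?_⟩
  obtain ⟨f, hf⟩ := hch.adapted'
  rw [← Scheme.IdealSheafData.comap_comp, hy.ideal_comap hi' hf hq' hqa]
  exact hl.span_eq ((unimodular_iff_span_eq_top hqa).1 (hx.unimodular hch.frame hq')) hch.compl

/-- Locally, dividing the coordinates of `b` by the equation `a` of the inverse image of `Y` gives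
coordinates for `g`. The local solutions glue by `Rel.right_unique`. -/
lemma Rel.exists_right (hc : HasCharts ι p) (hi : IsInducedBy ι p X Y i)
    (X' : ProjectiveBundle (kernelOnBase ι p)) (hb : b ≫ X.π = q) (hq : PreservesRegular q)
    (hK : IsCartierDivisor (i.ker.comap b)) : ∃ g, Rel (kernelOnBaseι ι p) X X' b g q := by
  have hloc (s : T) : ∃ (V : T.Opens) (g : V.toScheme ⟶ X'.space), s ∈ V ∧
      Rel (kernelOnBaseι ι p) X X' (V.ι ≫ b) g (V.ι ≫ q) := by
    obtain ⟨U, t, I, _, J, J', e, e', hsU, hch⟩ := hc (q s)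
    obtain ⟨V₀, hsV₀, hV₀⟩ := exists_hasCoords_nhds hb s
    obtain ⟨V, hsV, hle, hVa, hV⟩ := hK.exists_local s (V₀ ⊓ q ⁻¹ᵁ U.1) ⟨hsV₀, hsU⟩
    obtain ⟨x, hx⟩ := hV₀ V (hle.trans inf_le_left) e
    have : IsAffine V := hVa
    have hq' : (V.ι ≫ q) ⁻¹ᵁ U.1 = ⊤ := ι_comp_preimage (hle.trans inf_le_right)
    have hqa := isAffineOpen_of_eq_top hq'
    obtain ⟨a, ha, hKa⟩ := hV ⟨_, hqa⟩ hq'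
    obtain ⟨f, hf⟩ := hch.adapted
    rw [← Scheme.IdealSheafData.comap_comp, hx.ideal_comap hi hf hq' hqa] at hKa
    obtain ⟨d, y, hl, hy⟩ := exists_linked_of_span_eq ha.mem
      ((unimodular_iff_span_eq_top hqa).1 (hx.unimodular hch.frame hq')) hKa
    obtain ⟨g, hg, -⟩ := existsUnique_hasCoords (P := X') hch.frame' hq'
      ((unimodular_iff_span_eq_top hqa).2 hy)
    exact ⟨V, g, hsV, hx.rel hch.frame' hch.map_eq hq' hg hl⟩
  obtain ⟨g, hg⟩ := exists_glue_hom (T := T) (X := X'.space)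
    (fun c g => Rel (kernelOnBaseι ι p) X X' (c ≫ b) g (c ≫ q))
    (fun d c g h => h.comp d)
    (fun c _ g g' h h' => h.right_unique hc ((PreservesRegular.of_flat c).comp hq) h') hloc
  refine ⟨g, .of_locally hb (Scheme.hom_ext_of_forall _ _ fun s => ?_) hg⟩
  obtain ⟨V, hsV, h⟩ := hg s
  exact ⟨V, hsV, h.2.1⟩

lemma Rel.exists_left (hc : HasCharts ι p) (hi' : IsInducedBy ι (kernelRestriction ι p) X' Y' i')
    (X : ProjectiveBundle E) (hg : g ≫ X'.π = q) (hq : PreservesRegular q)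
    (hK : IsCartierDivisor (i'.ker.comap g)) : ∃ b, Rel (kernelOnBaseι ι p) X X' b g q := by
  have hloc (s : T) : ∃ (V : T.Opens) (b : V.toScheme ⟶ X.space), s ∈ V ∧
      Rel (kernelOnBaseι ι p) X X' b (V.ι ≫ g) (V.ι ≫ q) := by
    obtain ⟨U, t, I, _, J, J', e, e', hsU, hch⟩ := hc (q s)
    obtain ⟨V₀, hsV₀, hV₀⟩ := exists_hasCoords_nhds hg s
    obtain ⟨V, hsV, hle, hVa, hV⟩ := hK.exists_local s (V₀ ⊓ q ⁻¹ᵁ U.1) ⟨hsV₀, hsU⟩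
    obtain ⟨y, hy⟩ := hV₀ V (hle.trans inf_le_left) e'
    have : IsAffine V := hVa
    have hq' : (V.ι ≫ q) ⁻¹ᵁ U.1 = ⊤ := ι_comp_preimage (hle.trans inf_le_right)
    have hqa := isAffineOpen_of_eq_top hq'
    obtain ⟨d, hd, hKd⟩ := hV ⟨_, hqa⟩ hq'
    obtain ⟨f, hf⟩ := hch.adapted'
    rw [← Scheme.IdealSheafData.comap_comp, hy.ideal_comap hi' hf hq' hqa] at hKd
    obtain ⟨a, x, hl, hx⟩ := exists_linked_of_span_eq hd.mem
      ((unimodular_iff_span_eq_top hqa).1 (hy.unimodular hch.frame' hq')) hKd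
    obtain ⟨b, hb, -⟩ := existsUnique_hasCoords (P := X) hch.frame hq'
      ((unimodular_iff_span_eq_top hqa).2 hx)
    exact ⟨V, b, hsV, hb.rel hch.frame' hch.map_eq hq' hy (hl.symm hch.compl')⟩
  obtain ⟨b, hb⟩ := exists_glue_hom (T := T) (X := X.space)
    (fun c b => Rel (kernelOnBaseι ι p) X X' b (c ≫ g) (c ≫ q))
    (fun d c g h => h.comp d)
    (fun c _ g g' h h' => h.left_unique hc ((PreservesRegular.of_flat c).comp hq) h') hloc
  refine ⟨b, .of_locally (Scheme.hom_ext_of_forall _ _ fun s => ?_) hg hb⟩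
  obtain ⟨V, hsV, h⟩ := hb s
  exact ⟨V, hsV, h.1⟩

/-- The elementary transformation isomorphism between the two blowups. -/
lemma exists_iso (hc : HasCharts ι p) (hi : IsInducedBy ι p X Y i)
    (hi' : IsInducedBy ι (kernelRestriction ι p) X' Y' i') (B : Blowup i.ker) (B' : Blowup i'.ker) :
    ∃ θ : B.space ≅ B'.space,
      Rel (kernelOnBaseι ι p) X X' B.map (θ.hom ≫ B'.map) (B.map ≫ X.π) := by
  have hB : PreservesRegular (B.map ≫ X.π) := B.preservesRegular (preservesRegular_π X fun s => by
    obtain ⟨U, t, I, _, J, J', e, e', hsU, hch⟩ := hc s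
    exact ⟨U.1, I, inferInstance, e, hsU, hch.frame⟩)
  have hB' : PreservesRegular (B'.map ≫ X'.π) := B'.preservesRegular (preservesRegular_π X' fun s => by
    obtain ⟨U, t, I, _, J, J', e, e', hsU, hch⟩ := hc s
    exact ⟨U.1, I, inferInstance, e', hsU, hch.frame'⟩)
  obtain ⟨g, hg⟩ := Rel.exists_right hc hi X' rfl hB B.isCartierDivisor
  obtain ⟨b, hb⟩ := Rel.exists_left hc hi' X rfl hB' B'.isCartierDivisor
  obtain ⟨u, hu, -⟩ := B'.universal g (hg.isCartierDivisor_right hc hi' hB)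
  obtain ⟨v, hv, -⟩ := B.universal b (hb.isCartierDivisor_left hc hi hB')
  -- Both `u ≫ b` and `B.map` are related to the same `g`, hence equal; the universal property of
  -- the blowup turns this into an identity of morphisms to it.
  have huv : u ≫ v = 𝟙 _ := by
    refine (B.universal B.map B.isCartierDivisor).unique ?_ (Category.id_comp _)
    rw [Category.assoc, hv]
    have h := hb.comp u
    rw [hu, ← Category.assoc, hu, hg.2.1] at h
    exact h.left_unique hc hB hg
  have hvu : v ≫ u = 𝟙 _ := by
    refine (B'.universal B'.map B'.isCartierDivisor).unique ?_ (Category.id_comp _)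
    rw [Category.assoc, hu]
    have h := hg.comp v
    rw [hv, ← Category.assoc, hv, hb.1] at h
    exact h.right_unique hc hB' hb
  exact ⟨⟨u, v, huv, hvu⟩, by rw [hu]; exact hg⟩

end Global
end Elementary

end

/-! ### The theorem -/

theorem theoremA5 {S D : Scheme.{u}} (ι : D ⟶ S) [IsClosedImmersion ι]
    (hD : Elementary.IsCartierDivisor ι.ker)
    (E : S.Modules) (hE : Elementary.IsVectorBundle E)
    (F : D.Modules) (hF : Elementary.IsVectorBundle F)
    (p : (Scheme.Modules.pullback ι).obj E ⟶ F) [Epi p]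
    (X : Elementary.ProjectiveBundle E) (Y : Elementary.ProjectiveBundle F)
    (X' : Elementary.ProjectiveBundle (Elementary.kernelOnBase ι p))
    (Y' : Elementary.ProjectiveBundle (Elementary.kernelOnDivisor ι p)) :
    ∃ (i : Y.space ⟶ X.space) (i' : Y'.space ⟶ X'.space),
      Elementary.IsInducedBy ι p X Y i ∧ IsClosedImmersion i ∧
      Elementary.IsInducedBy ι (Elementary.kernelRestriction ι p) X' Y' i' ∧
      IsClosedImmersion i' ∧
      ∀ (B : Elementary.Blowup i.ker) (B' : Elementary.Blowup i'.ker),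
        ∃! θ : B.space ≅ B'.space,
          ∃ (h : (θ.hom ≫ B'.map) ≫ X'.π = B.map ≫ X.π)
            (j : (Scheme.Modules.pullback (θ.hom ≫ B'.map)).obj X'.O1 ⟶
              (Scheme.Modules.pullback B.map).obj X.O1),
            Mono j ∧
            Elementary.pullTaut X'.taut (θ.hom ≫ B'.map) h ≫ j =
              (Scheme.Modules.pullback (B.map ≫ X.π)).map (Elementary.kernelOnBaseι ι p) ≫
                Elementary.pullTaut X.taut B.map rfl := by
  have hc : Elementary.HasCharts ι p := Elementary.exists_isChart hD hE hF
  have hc₁ : ∀ s : S, ∃ (U : S.affineOpens) (t : Γ(S, U)) (I : Type u) (_ : Fintype I)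
      (J : Finset I) (e : I → Γ(E, U)) (f : J → Γ(F, ι ⁻¹ᵁ U.1)),
      s ∈ U.1 ∧ Elementary.IsAdapted ι p U t J e f := fun s => by
    obtain ⟨U, t, I, _, J, J', e, e', hsU, hch⟩ := hc s
    obtain ⟨f, hf⟩ := hch.adapted
    exact ⟨U, t, I, inferInstance, J, e, f, hsU, hf⟩
  have hc₂ : ∀ s : S, ∃ (U : S.affineOpens) (t : Γ(S, U)) (I : Type u) (_ : Fintype I)
      (J : Finset I) (e : I → Γ(Elementary.kernelOnBase ι p, U))
      (f : J → Γ(Elementary.kernelOnDivisor ι p, ι ⁻¹ᵁ U.1)),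
      s ∈ U.1 ∧ Elementary.IsAdapted ι (Elementary.kernelRestriction ι p) U t J e f := fun s => by
    obtain ⟨U, t, I, _, J, J', e, e', hsU, hch⟩ := hc s
    obtain ⟨f, hf⟩ := hch.adapted'
    exact ⟨U, t, I, inferInstance, J', e', f, hsU, hf⟩
  -- Surjectivity of `E'|_D ⟶ F'` is what allows the universal property of `X'` to produce `i'`.
  have := Elementary.epi_of_isAdapted hc₂
  obtain ⟨i, hi⟩ := Elementary.exists_isInducedBy (p := p) X Y
  obtain ⟨i', hi'⟩ := Elementary.exists_isInducedBy (p := Elementary.kernelRestriction ι p) X' Y'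
  have hci := Elementary.isClosedImmersion_of_isInducedBy hi hc₁
  have hci' := Elementary.isClosedImmersion_of_isInducedBy hi' hc₂
  refine ⟨i, i', hi, hci, hi', hci', fun B B' => ?_⟩
  have hB : Elementary.PreservesRegular (B.map ≫ X.π) :=
    B.preservesRegular (Elementary.preservesRegular_π X fun s => by
      obtain ⟨U, t, I, _, J, J', e, e', hsU, hch⟩ := hc s
      exact ⟨U.1, I, inferInstance, e, hsU, hch.frame⟩)
  obtain ⟨θ, hθ⟩ := Elementary.exists_iso hc hi hi' B B'
  obtain ⟨hb, hg, j, hj⟩ := id hθ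
  refine ⟨θ, ⟨hg, j, Elementary.Rel.mono hc hB hj, hj⟩, ?_⟩
  rintro θ' ⟨h', j', -, hj'⟩
  have hθ' : Elementary.Rel (Elementary.kernelOnBaseι ι p) X X' B.map (θ'.hom ≫ B'.map)
    (B.map ≫ X.π) := ⟨rfl, h', j', hj'⟩
  -- Both isomorphisms give morphisms to `X'` related to `B.map`, so these agree; uniqueness in the
  -- universal property of `B'` then gives uniqueness of the isomorphism.
  have heq := hθ'.right_unique hc hB hθ
  ext1
  exact (B'.universal _ (hθ.isCartierDivisor_right hc hi' hB)).unique heq rfl
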